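/- Let $\Lambda$ be the von Mangoldt function and, for positive integers $n$, let $r_2(n)=\sum_{m+m'=n}\Lambda(m)\Lambda(m')$, the sum running over positive integers $m,m'$. Assume the Riemann Hypothesis. Then, for positive integers $N$, $$\sum_{n\le N}\Big(1-\frac nN\Big) r_2(n) = \frac16 N^2 - 2\sum_\rho \frac{N^{\rho+1}}{\rho(\rho+1)(\rho+2)} + O(N),$$ where the sum over $\rho$ runs over the complex (i.e. nontrivial) zeros of the Riemann zeta function, counted with multiplicity, and converges absolutely, and the implied constant is absolute. -/

import Mathlib

/-- The weighted Goldbach counting function `r₂(n) = ∑_{m + m' = n} Λ(m) Λ(m')`.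
The pairs with `m = 0` or `m' = 0` contribute nothing, since `Λ 0 = 0`. -/
noncomputable def goldbachR2 (n : ℕ) : ℝ :=
  ∑ p ∈ Finset.HasAntidiagonal.antidiagonal n,
    ArithmeticFunction.vonMangoldt p.1 * ArithmeticFunction.vonMangoldt p.2

/-- The complex (that is, nontrivial) zeros of the Riemann zeta function:
its zeros in the critical strip `0 < Re s < 1`. -/
def nontrivialZetaZeros : Set ℂ :=
  {ρ : ℂ | riemannZeta ρ = 0 ∧ 0 < ρ.re ∧ ρ.re < 1}

/-- The contribution of a zero `ρ` to `∑_ρ N^{ρ+1} / (ρ (ρ+1) (ρ+2))`. Zeros are counted with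
multiplicity, so the term is weighted by the order of vanishing of zeta at `ρ`. -/
noncomputable def cesaroZeroTerm (N : ℕ) (ρ : ℂ) : ℂ :=
  (analyticOrderNatAt riemannZeta ρ : ℂ) *
    ((N : ℂ) ^ (ρ + 1) / (ρ * (ρ + 1) * (ρ + 2)))

/-! Write ψ for Chebyshev's function, ψ₁ for its primitive and E(t) = ψ(t) - t. The convolution
integral of ψ(t)ψ(N - t) over [0, N] equals ∑ (N - n) r₂(n), because a pair (k, m) contributes
Λ(k)Λ(m) max(N - k - m, 0) (`integral_psi_mul_psi_sub`). Inserting ψ(t) = t + E(t) in both factors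
turns it into 2∫ψ₁ - N³/6 + ∫E(t)E(N - t) dt (`integral_psi_mul_psi_sub_eq`). Integrating the
explicit formula for ψ₁ gives ∫ψ₁ = N³/6 - N ∑ N^(ρ+1)/(ρ(ρ+1)(ρ+2)) + O(N²). The last integral is
at most ∫E², which is O(N²) under RH by Cramér's theorem. Division by N finishes.

Both analytic inputs rest on the partial fraction expansion of the logarithmic derivative of the
entire function (s - 1)ζ(s). It is proved for any entire f with f(0) ≠ 0 and order below 2: Jensen's
formula bounds the number of zeros, and on a disc the zeros are replaced by Blaschke-type factors so
that Borel–Carathéodory applies to the zero-free function that remains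
(`Differentiable.hasSum_logDeriv`). For zeta the growth exponent 5/4 is enough.

The explicit formula needs no contour shift. With x = exp u, its two sides have the same Laplace
transform on one vertical line, by partial fractions on one side and the Dirichlet series of Λ on
the other; Fourier inversion makes them equal (`RiemannHypothesis.psiPrimitive_exp_eq`).

For Cramér's bound, E is approximated by difference quotients of ψ₁(x) - x²/2 in log x. Their zero
sums converge absolutely, with coefficients O(m/|ρ|) uniformly in the step, m being the
multiplicity. Integrating the square against exp(-2|u - L|) leaves a double sum over zeros of
mm'/(|ρ||ρ'|) times 4/(4 + (γ - γ')²). It is bounded because, with multiplicity, only O(|t|^(1/2))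
zeros lie near height t and ∑ m|ρ|^(-3/2) converges. The step then tends to 0. -/

section EntireFunctions

/-! ### Zeros of entire functions of finite order: Jensen's bound and convergence exponents. -/

open Filter Topology MeromorphicOn Metric

/-- Two functions continuous on a closed disc and equal off a discrete subset agree on the disc. -/
lemma eqOn_closedBall_of_eventuallyEq_codiscreteWithin {f g : ℂ → ℂ} {R : ℝ} (hR : 0 < R)
    (hf : ContinuousOn f (closedBall 0 R)) (hg : ContinuousOn g (closedBall 0 R))
    (h : f =ᶠ[codiscreteWithin (closedBall 0 R)] g) : Set.EqOn f g (closedBall 0 R) := by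
  intro x hx
  have hacc : AccPt x (𝓟 (closedBall (0 : ℂ) R)) := by
    have hpre : (closedBall (0 : ℂ) R).Nontrivial :=
      ⟨0, by simp [hR.le], R, by simp [abs_of_pos hR], by exact_mod_cast hR.ne⟩
    exact (convex_closedBall (0 : ℂ) R).isPreconnected.preperfect_of_nontrivial hpre x hx
  have hne : (𝓝[≠] x ⊓ 𝓟 (closedBall (0 : ℂ) R)).NeBot := hacc
  have hev : ∀ᶠ y in 𝓝[≠] x ⊓ 𝓟 (closedBall (0 : ℂ) R), f y = g y := by
    have h1 := mem_codiscreteWithin.1 h x hx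
    rw [disjoint_principal_right] at h1
    rw [eventually_inf_principal]
    filter_upwards [h1] with y hy hyU
    by_contra hcon
    exact hy ⟨hyU, hcon⟩
  have hle : 𝓝[≠] x ⊓ 𝓟 (closedBall (0 : ℂ) R) ≤ 𝓝[closedBall 0 R] x := by
    rw [nhdsWithin, nhdsWithin]
    exact inf_le_inf_right _ inf_le_left
  have t1 : Tendsto f (𝓝[≠] x ⊓ 𝓟 (closedBall (0 : ℂ) R)) (𝓝 (f x)) := (hf x hx).mono_left hle
  have t2 : Tendsto g (𝓝[≠] x ⊓ 𝓟 (closedBall (0 : ℂ) R)) (𝓝 (g x)) := (hg x hx).mono_left hle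
  exact tendsto_nhds_unique (t1.congr' hev) t2

section Entire

variable {f : ℂ → ℂ}

lemma Differentiable.analyticOrderAt_ne_top' (hf : Differentiable ℂ f) (h0 : f 0 ≠ 0) (z : ℂ) :
    analyticOrderAt f z ≠ ⊤ := by
  have han : AnalyticOnNhd ℂ f Set.univ := fun z _ => hf.analyticAt z
  have h00 : analyticOrderAt f 0 ≠ ⊤ := by
    rw [(hf.analyticAt 0).analyticOrderAt_eq_zero.2 h0]; simp
  exact han.analyticOrderAt_ne_top_of_isPreconnected isPreconnected_univ (Set.mem_univ 0)
    (Set.mem_univ z) h00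

lemma Differentiable.analyticOrderNatAt_eq_zero_iff (hf : Differentiable ℂ f) (h0 : f 0 ≠ 0)
    (z : ℂ) : analyticOrderNatAt f z = 0 ↔ f z ≠ 0 := by
  rw [← (hf.analyticAt z).analyticOrderAt_eq_zero, analyticOrderNatAt, ENat.toNat_eq_zero]
  simp [hf.analyticOrderAt_ne_top' h0 z]

lemma Differentiable.divisor_eq (hf : Differentiable ℂ f) (h0 : f 0 ≠ 0) {R : ℝ} {z : ℂ}
    (hz : z ∈ closedBall (0 : ℂ) R) :
    divisor f (closedBall 0 R) z = (analyticOrderNatAt f z : ℤ) := by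
  rw [AnalyticOnNhd.divisor_apply (fun z _ => hf.analyticAt z) hz]
  have := hf.analyticOrderAt_ne_top' h0 z
  lift analyticOrderAt f z to ℕ using this with n hn
  simp [analyticOrderNatAt, ← hn]

lemma Differentiable.finite_zeros (hf : Differentiable ℂ f) (h0 : f 0 ≠ 0) (R : ℝ) :
    {z ∈ closedBall (0 : ℂ) R | f z = 0}.Finite := by
  refine ((divisor f (closedBall 0 R)).finiteSupport (isCompact_closedBall 0 R)).subset ?_
  rintro z ⟨hz, hfz⟩
  rw [Function.mem_support, hf.divisor_eq h0 hz, Ne, Int.natCast_eq_zero,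
    hf.analyticOrderNatAt_eq_zero_iff h0]
  simp [hfz]

lemma Differentiable.countable_zeros (hf : Differentiable ℂ f) (h0 : f 0 ≠ 0) :
    {z : ℂ | f z = 0}.Countable := by
  refine (Set.countable_iUnion fun n : ℕ => (hf.finite_zeros h0 n).countable).mono ?_
  intro z hz
  obtain ⟨n, hn⟩ := exists_nat_ge ‖z‖
  exact Set.mem_iUnion.2 ⟨n, by simpa using hn, hz⟩

/-- The zeros of `f` in the closed disc of radius `R`. -/
noncomputable def zerosIn (hf : Differentiable ℂ f) (h0 : f 0 ≠ 0) (R : ℝ) : Finset ℂ :=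
  (hf.finite_zeros h0 R).toFinset

lemma mem_zerosIn (hf : Differentiable ℂ f) (h0 : f 0 ≠ 0) {R : ℝ} {z : ℂ} :
    z ∈ zerosIn hf h0 R ↔ ‖z‖ ≤ R ∧ f z = 0 := by
  simp [zerosIn]

lemma Differentiable.divisor_support_subset (hf : Differentiable ℂ f) (h0 : f 0 ≠ 0) (R : ℝ) :
    Function.support (divisor f (closedBall 0 R)) ⊆ zerosIn hf h0 R := by
  intro z hz
  have hzR : z ∈ closedBall (0 : ℂ) R := by
    by_contra hcon
    exact hz (Function.locallyFinsuppWithin.apply_eq_zero_of_notMem _ hcon)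
  rw [Function.mem_support, hf.divisor_eq h0 hzR, Ne, Int.natCast_eq_zero,
    hf.analyticOrderNatAt_eq_zero_iff h0, not_not] at hz
  exact (mem_zerosIn hf h0).2 ⟨by simpa using hzR, hz⟩

/-- Jensen's bound for the number of zeros of an entire function of finite order. -/
lemma Differentiable.exists_sum_order_le (hf : Differentiable ℂ f) (h0 : f 0 ≠ 0) {C l : ℝ}
    (hC : 0 ≤ C) (hl : 0 ≤ l) (hgr : ∀ z, ‖f z‖ ≤ Real.exp (C * (1 + ‖z‖) ^ l)) :
    ∃ K : ℝ, 0 ≤ K ∧ ∀ r : ℝ, 1 ≤ r →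
      ∑ w ∈ zerosIn hf h0 r, (analyticOrderNatAt f w : ℝ) ≤ K * r ^ l := by
  refine ⟨C * 4 ^ l + |Real.log ‖f 0‖|, by positivity, fun r hr => ?_⟩
  have hr0 : 0 < r := by linarith
  have he : Real.exp 1 < 3 := Real.exp_one_lt_three
  have he1 : 1 < Real.exp 1 := Real.one_lt_exp_iff.2 one_pos
  -- The outer radius e·r makes the denominator log(R/r) in Jensen's bound equal to 1. For r ≥ 1, 1
  -- + e·r ≤ 4r, which is the source of 4 ^ l.
  have hJ := AnalyticOnNhd.sum_divisor_le (c := 0) (r := r) (R := Real.exp 1 * r)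
    (M := Real.exp (C * (1 + Real.exp 1 * r) ^ l)) (f := f) (by simpa using hr0.ne')
    (by rw [abs_of_pos hr0, abs_of_pos (by positivity)]; nlinarith)
    (Real.one_le_exp (by positivity)) (fun z _ => hf.analyticAt z) h0
    (by
      intro z hz
      rw [mem_sphere_zero_iff_norm, abs_of_pos (by positivity)] at hz
      rw [← hz]; exact hgr z)
  rw [abs_of_pos hr0, finsum_eq_sum_of_support_subset _ (hf.divisor_support_subset h0 r)] at hJ
  have hsum : ((∑ u ∈ zerosIn hf h0 r, (divisor f (closedBall 0 r)) u : ℤ) : ℝ)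
      = ∑ w ∈ zerosIn hf h0 r, (analyticOrderNatAt f w : ℝ) := by
    push_cast
    refine Finset.sum_congr rfl fun w hw => ?_
    rw [hf.divisor_eq h0 (by simpa using ((mem_zerosIn hf h0).1 hw).1)]
    simp
  rw [hsum] at hJ
  refine hJ.trans ?_
  rw [mul_div_cancel_right₀ _ hr0.ne', Real.log_exp, div_one,
    Real.log_div (Real.exp_ne_zero _) (norm_ne_zero_iff.2 h0), Real.log_exp, add_mul]
  have h1 : (1 + Real.exp 1 * r) ^ l ≤ 4 ^ l * r ^ l := by
    rw [← Real.mul_rpow (by norm_num) hr0.le]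
    exact Real.rpow_le_rpow (by positivity) (by nlinarith) hl
  have h2 : |Real.log ‖f 0‖| ≤ |Real.log ‖f 0‖| * r ^ l :=
    le_mul_of_one_le_right (abs_nonneg _) (Real.one_le_rpow hr hl)
  have h3 := neg_abs_le (Real.log ‖f 0‖)
  nlinarith [mul_le_mul_of_nonneg_left h1 hC]

/-- Convergence of `∑ m(ω) |ω|^{-p}` over the zeros, for `p` above the growth exponent. -/
lemma Differentiable.summable_order_mul_rpow (hf : Differentiable ℂ f) (h0 : f 0 ≠ 0) {C l p : ℝ}
    (hC : 0 ≤ C) (hl : 0 ≤ l) (hgr : ∀ z, ‖f z‖ ≤ Real.exp (C * (1 + ‖z‖) ^ l)) (hp : l < p) :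
    Summable fun w : {z : ℂ | f z = 0} => (analyticOrderNatAt f w : ℝ) * ‖(w : ℂ)‖ ^ (-p) := by
  obtain ⟨K, hK0, hK⟩ := hf.exists_sum_order_le h0 hC hl hgr
  have hp0 : 0 < p := by linarith
  obtain ⟨d, hd0, hd1, hd⟩ : ∃ d : ℝ, 0 < d ∧ d ≤ 1 ∧ ∀ z, f z = 0 → d ≤ ‖z‖ := by
    have hev := (hf.continuous.continuousAt (x := 0)).eventually_ne h0
    obtain ⟨e, he, hb⟩ := Metric.eventually_nhds_iff.1 hev
    refine ⟨min e 1, by positivity, min_le_right _ _, fun z hz => ?_⟩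
    by_contra hcon
    exact hb (y := z) (by simpa using lt_of_lt_of_le (not_le.1 hcon) (min_le_left _ _)) hz
  -- Ratio of the dyadic series: at most K·2^(jl) zeros lie within 2^j, each weighted by about
  -- 2^(-jp).
  set q : ℝ := (2 : ℝ) ^ (l - p) with hq
  have hq0 : 0 < q := by positivity
  have hq1 : q < 1 := Real.rpow_lt_one_of_one_lt_of_neg (by norm_num) (by linarith)
  -- The factor d^(-p) covers the zeros of modulus at most 1, none closer to 0 than d; the factor
  -- 2^p pays for replacing |w| > 2^(k-1) by 2^k.
  set D : ℝ := d ^ (-p) * 2 ^ p with hD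
  have hD0 : 0 < D := by positivity
  have hdp : 1 ≤ d ^ (-p) := Real.one_le_rpow_of_pos_of_le_one_of_nonpos hd0 hd1 (by linarith)
  have h2p : 1 ≤ (2 : ℝ) ^ p := Real.one_le_rpow (by norm_num) hp0.le
  refine summable_of_sum_le (c := D * (K * (1 - q)⁻¹)) (fun w => by positivity) fun T => ?_
  classical
  -- each zero is counted at the first power of two above its modulus
  have hkey : ∀ w : {z : ℂ | f z = 0}, ∃ k : ℕ, ‖(w : ℂ)‖ ≤ 2 ^ k ∧
      ‖(w : ℂ)‖ ^ (-p) ≤ D * ((2 : ℝ) ^ k) ^ (-p) := by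
    intro w
    have hex : ∃ k : ℕ, ‖(w : ℂ)‖ ≤ 2 ^ k :=
      (pow_unbounded_of_one_lt ‖(w : ℂ)‖ (by norm_num : (1 : ℝ) < 2)).imp fun _ h => h.le
    refine ⟨Nat.find hex, Nat.find_spec hex, ?_⟩
    rcases h : Nat.find hex with _ | k
    · simp only [pow_zero, Real.one_rpow, mul_one]
      calc ‖(w : ℂ)‖ ^ (-p) ≤ d ^ (-p) :=
            Real.rpow_le_rpow_of_nonpos hd0 (hd w w.2) (by linarith)
        _ ≤ D := le_mul_of_one_le_right (by positivity) h2p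
    · have hlt : (2 : ℝ) ^ k < ‖(w : ℂ)‖ := by
        have := Nat.find_min hex (m := k) (by omega)
        exact not_le.1 this
      calc ‖(w : ℂ)‖ ^ (-p) ≤ ((2 : ℝ) ^ k) ^ (-p) :=
            Real.rpow_le_rpow_of_nonpos (by positivity) hlt.le (by linarith)
        _ = 2 ^ p * ((2 : ℝ) ^ (k + 1)) ^ (-p) := by
            rw [pow_succ, Real.mul_rpow (by positivity) (by norm_num), mul_comm _ ((2 : ℝ) ^ (-p)),
              ← mul_assoc, ← Real.rpow_add (by norm_num)]
            simp
        _ ≤ D * ((2 : ℝ) ^ (k + 1)) ^ (-p) := by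
            apply mul_le_mul_of_nonneg_right _ (by positivity)
            exact le_mul_of_one_le_left (by positivity) hdp
  choose k hk1 hk2 using hkey
  have hrw : ∀ j : ℕ, ((2 : ℝ) ^ j) ^ (-p) * ((2 : ℝ) ^ j) ^ l = q ^ j := by
    intro j
    rw [← Real.rpow_add (by positivity), hq, ← Real.rpow_natCast, ← Real.rpow_mul (by norm_num),
      ← Real.rpow_natCast, ← Real.rpow_mul (by norm_num)]
    congr 1; ring
  calc ∑ w ∈ T, (analyticOrderNatAt f w : ℝ) * ‖(w : ℂ)‖ ^ (-p)
      ≤ ∑ w ∈ T, (analyticOrderNatAt f w : ℝ) * (D * ((2 : ℝ) ^ k w) ^ (-p)) :=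
        Finset.sum_le_sum fun w _ => mul_le_mul_of_nonneg_left (hk2 w) (by positivity)
    _ = ∑ j ∈ T.image k, ∑ w ∈ T with k w = j,
          (analyticOrderNatAt f w : ℝ) * (D * ((2 : ℝ) ^ k w) ^ (-p)) :=
        (Finset.sum_fiberwise_of_maps_to (fun w hw => Finset.mem_image_of_mem k hw) _).symm
    _ ≤ ∑ j ∈ T.image k, D * (K * q ^ j) := by
        refine Finset.sum_le_sum fun j _ => ?_
        have h1 : ∑ w ∈ T with k w = j, (analyticOrderNatAt f w : ℝ) ≤ K * ((2 : ℝ) ^ j) ^ l := by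
          refine le_trans ?_ (hK (2 ^ j) (one_le_pow₀ (by norm_num)))
          have himg : ∑ w ∈ (T.filter (k · = j)).map (Function.Embedding.subtype _),
              (analyticOrderNatAt f w : ℝ) = ∑ w ∈ T with k w = j, (analyticOrderNatAt f w : ℝ) := by
            rw [Finset.sum_map]; rfl
          rw [← himg]
          refine Finset.sum_le_sum_of_subset_of_nonneg ?_ fun _ _ _ => by positivity
          intro z hz
          simp only [Finset.mem_map, Finset.mem_filter] at hz
          obtain ⟨w, ⟨-, hwj⟩, rfl⟩ := hz
          exact (mem_zerosIn hf h0).2 ⟨hwj ▸ hk1 w, w.2⟩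
        calc ∑ w ∈ T with k w = j, (analyticOrderNatAt f w : ℝ) * (D * ((2 : ℝ) ^ k w) ^ (-p))
            = (∑ w ∈ T with k w = j, (analyticOrderNatAt f w : ℝ)) * (D * ((2 : ℝ) ^ j) ^ (-p)) := by
              rw [Finset.sum_mul]
              refine Finset.sum_congr rfl fun w hw => ?_
              rw [(Finset.mem_filter.1 hw).2]
          _ ≤ K * ((2 : ℝ) ^ j) ^ l * (D * ((2 : ℝ) ^ j) ^ (-p)) :=
              mul_le_mul_of_nonneg_right h1 (by positivity)
          _ = D * (K * (((2 : ℝ) ^ j) ^ (-p) * ((2 : ℝ) ^ j) ^ l)) := by ring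
          _ = D * (K * q ^ j) := by rw [hrw]
    _ = D * (K * ∑ j ∈ T.image k, q ^ j) := by rw [← Finset.mul_sum, ← Finset.mul_sum]
    _ ≤ D * (K * (1 - q)⁻¹) := by
        gcongr
        rw [← tsum_geometric_of_lt_one hq0.le hq1]
        exact (summable_geometric_of_lt_one hq0.le hq1).sum_le_tsum _ fun _ _ => by positivity

end Entire

/-! ### Partial fractions for the logarithmic derivative. -/

/-- Borel–Carathéodory for the logarithmic derivative of a zero-free function on a disc. -/
lemma norm_logDeriv_sub_le_of_ne_zero {h : ℂ → ℂ} {R M : ℝ} (hR : 0 < R)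
    (hd : DifferentiableOn ℂ h (ball 0 R)) (hne : ∀ z ∈ ball (0 : ℂ) R, h z ≠ 0)
    (hM : ∀ z ∈ ball (0 : ℂ) R, ‖h z‖ ≤ M) {s : ℂ} (hs : ‖s‖ ≤ R / 4) :
    ‖logDeriv h s - logDeriv h 0‖ ≤ 128 * (Real.log (M / ‖h 0‖) + 1) / R ^ 2 * ‖s‖ := by
  have h0b : (0 : ℂ) ∈ ball (0 : ℂ) R := by simpa using hR
  have ha : 0 < ‖h 0‖ := norm_pos_iff.2 (hne 0 h0b)
  have hM0 : 0 < M := ha.trans_le (hM 0 h0b)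
  -- The extra 1 keeps L strictly positive, as Borel–Carathéodory requires.
  set L : ℝ := Real.log (M / ‖h 0‖) + 1 with hL
  have hlog : 0 ≤ Real.log (M / ‖h 0‖) := Real.log_nonneg ((one_le_div ha).2 (hM 0 h0b))
  have hLpos : 0 < L := by linarith
  have hk : DifferentiableOn ℂ (logDeriv h) (ball 0 R) := (hd.deriv isOpen_ball).div hd hne
  obtain ⟨G, hG⟩ := hk.isExactOn_ball
  have hhd : ∀ z ∈ ball (0 : ℂ) R, HasDerivAt h (deriv h z) z := fun z hz =>
    (hd.differentiableAt (isOpen_ball.mem_nhds hz)).hasDerivAt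
  -- Since G is a primitive of h'/h, the function G - G 0 is a logarithm of h / h 0; its real part
  -- is bounded by the growth of h.
  have hconst : ∀ z ∈ ball (0 : ℂ) R, h z * Complex.exp (-(G z)) = h 0 * Complex.exp (-(G 0)) := by
    have hder : ∀ z ∈ ball (0 : ℂ) R,
        HasDerivAt (fun z => h z * Complex.exp (-(G z))) 0 z := by
      intro z hz
      refine ((hhd z hz).fun_mul (hG z hz).fun_neg.cexp).congr_deriv ?_
      rw [logDeriv_apply]
      field_simp [hne z hz]
      ring
    intro z hz
    exact isOpen_ball.is_const_of_deriv_eq_zero (convex_ball _ _).isPreconnected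
      (fun z hz => (hder z hz).differentiableAt.differentiableWithinAt)
      (fun z hz => (hder z hz).deriv) hz h0b
  have hre : Set.MapsTo (fun z => G z - G 0) (ball 0 R) {z | z.re ≤ L} := by
    intro z hz
    have h1 : h z = h 0 * Complex.exp (G z - G 0) := by
      have := hconst z hz
      rw [Complex.exp_neg, Complex.exp_neg] at this
      rw [Complex.exp_sub]
      field_simp at this ⊢
      exact this
    have h2 := hM z hz
    rw [h1, norm_mul, Complex.norm_exp] at h2
    have h3 : Real.exp ((G z - G 0).re) ≤ M / ‖h 0‖ := by
      rw [le_div_iff₀ ha]; linarith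
    have h4 := (Real.le_log_iff_exp_le (by positivity)).2 h3
    show (G z - G 0).re ≤ L
    linarith
  have hGd : DifferentiableOn ℂ (fun z => G z - G 0) (ball 0 R) := fun z hz =>
    ((hG z hz).differentiableAt.sub_const _).differentiableWithinAt
  have hGb : ∀ z : ℂ, ‖z‖ ≤ R / 2 → ‖G z - G 0‖ ≤ 2 * L := by
    intro z hz
    have hzb : z ∈ ball (0 : ℂ) R := by simp; linarith
    refine (Complex.borelCaratheodory_zero hLpos hGd hre hR hzb (by simp)).trans ?_
    rw [div_le_iff₀ (by linarith)]
    nlinarith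
  -- Two Cauchy estimates on circles of radius R/8 shrink the disc from R/2 to 3R/8 and then to R/4.
  -- Each costs a factor 8/R, so 2L becomes 16L/R and then 128L/R².
  have hk1 : ∀ z : ℂ, ‖z‖ ≤ 3 * R / 8 → ‖logDeriv h z‖ ≤ 16 * L / R := by
    intro z hz
    have hzb : z ∈ ball (0 : ℂ) R := by simp; linarith
    have hsub : closedBall z (R / 8) ⊆ ball (0 : ℂ) R := by
      intro w hw
      have h1 : ‖w - z‖ ≤ R / 8 := by simpa [dist_eq_norm] using hw
      have := norm_le_norm_add_norm_sub' w z
      simp; linarith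
    have := Complex.norm_deriv_le_of_forall_mem_sphere_norm_le (c := z) (R := R / 8) (C := 2 * L)
      (f := fun z => G z - G 0) (by positivity) ((hGd.mono hsub).diffContOnCl_ball (subset_refl _)) (by
        intro w hw
        have h1 : ‖w - z‖ = R / 8 := by simpa [dist_eq_norm] using hw
        have := norm_le_norm_add_norm_sub' w z
        exact hGb w (by linarith))
    rw [((hG z hzb).sub_const _).deriv] at this
    refine this.trans (le_of_eq ?_)
    field_simp; norm_num
  have hk2 : ∀ z : ℂ, ‖z‖ ≤ R / 4 → ‖deriv (logDeriv h) z‖ ≤ 128 * L / R ^ 2 := by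
    intro z hz
    have hsub : closedBall z (R / 8) ⊆ ball (0 : ℂ) R := by
      intro w hw
      have h1 : ‖w - z‖ ≤ R / 8 := by simpa [dist_eq_norm] using hw
      have := norm_le_norm_add_norm_sub' w z
      simp; linarith
    have := Complex.norm_deriv_le_of_forall_mem_sphere_norm_le (c := z) (R := R / 8)
      (C := 16 * L / R) (f := logDeriv h) (by positivity)
      ((hk.mono hsub).diffContOnCl_ball (subset_refl _)) (by
        intro w hw
        have h1 : ‖w - z‖ = R / 8 := by simpa [dist_eq_norm] using hw
        have := norm_le_norm_add_norm_sub' w z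
        exact hk1 w (by linarith))
    refine this.trans (le_of_eq ?_)
    field_simp; norm_num
  have := Convex.norm_image_sub_le_of_norm_deriv_le (f := logDeriv h) (s := closedBall 0 (R / 4))
    (x := 0) (y := s) (C := 128 * L / R ^ 2)
    (fun z hz => hk.differentiableAt (isOpen_ball.mem_nhds (by simp at hz ⊢; linarith)))
    (fun z hz => hk2 z (by simpa using hz)) (convex_closedBall _ _)
    (by simp; positivity) (by simpa using hs)
  simpa using this

/-- On the circle, R² is z times its conjugate. Hence a factor z - w can be exchanged for (R² -
w̄z)/R without changing the modulus on the boundary. -/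
lemma norm_sq_sub_conj_mul_eq {R : ℝ} {w z : ℂ} (hz : ‖z‖ = R) :
    ‖(R : ℂ) ^ 2 - starRingEnd ℂ w * z‖ = R * ‖z - w‖ := by
  have h1 : (R : ℂ) ^ 2 = starRingEnd ℂ z * z := by
    rw [← hz, Complex.conj_mul']
  rw [h1, ← sub_mul, norm_mul, hz, ← map_sub, RCLike.norm_conj, mul_comm]

lemma sq_sub_conj_mul_ne_zero {R : ℝ} {w z : ℂ} (hw : ‖w‖ ≤ R) (hz : ‖z‖ < R) :
    (R : ℂ) ^ 2 - starRingEnd ℂ w * z ≠ 0 := by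
  intro h
  have hR : 0 < R := (norm_nonneg z).trans_lt hz
  have h1 : (R : ℂ) ^ 2 = starRingEnd ℂ w * z := sub_eq_zero.1 h
  have h2 := congrArg norm h1
  rw [norm_mul, RCLike.norm_conj, norm_pow, Complex.norm_real, Real.norm_eq_abs, abs_of_pos hR] at h2
  nlinarith [norm_nonneg w, norm_nonneg z]

section Entire

variable {f : ℂ → ℂ}

/-- An entire function is, on a disc, a polynomial carrying its zeros times a zero-free function. -/
lemma Differentiable.exists_eq_prod_mul (hf : Differentiable ℂ f) (h0 : f 0 ≠ 0) {R : ℝ}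
    (hR : 0 < R) : ∃ g : ℂ → ℂ, AnalyticOnNhd ℂ g (closedBall 0 R) ∧
      (∀ z ∈ closedBall (0 : ℂ) R, g z ≠ 0) ∧ ∀ z ∈ closedBall (0 : ℂ) R,
        f z = (∏ w ∈ zerosIn hf h0 R, (z - w) ^ analyticOrderNatAt f w) * g z := by
  have hmer : MeromorphicOn f (closedBall 0 R) := fun z _ => (hf.analyticAt z).meromorphicAt
  obtain ⟨g, hg, hgne, heq⟩ := hmer.extract_zeros_poles
    (by
      intro u
      rw [(hf.analyticAt u).meromorphicOrderAt_eq]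
      simpa using hf.analyticOrderAt_ne_top' h0 u)
    ((divisor f (closedBall 0 R)).finiteSupport (isCompact_closedBall 0 R))
  refine ⟨g, hg, fun z hz => hgne ⟨z, hz⟩, ?_⟩
  have hprod : (∏ᶠ u : ℂ, (fun x => x - u) ^ (divisor f (closedBall 0 R)) u)
      = fun z => ∏ w ∈ zerosIn hf h0 R, (z - w) ^ analyticOrderNatAt f w := by
    rw [finprod_eq_prod_of_mulSupport_subset (s := zerosIn hf h0 R)]
    · ext z
      rw [Finset.prod_apply]
      refine Finset.prod_congr rfl fun w hw => ?_
      rw [Pi.pow_apply, hf.divisor_eq h0 (by simpa using ((mem_zerosIn hf h0).1 hw).1),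
        zpow_natCast]
    · intro u hu
      apply hf.divisor_support_subset h0 R
      rw [Function.mem_support]
      intro hcon
      exact hu (by simp only [hcon, zpow_zero])
  rw [hprod] at heq
  refine eqOn_closedBall_of_eventuallyEq_codiscreteWithin hR hf.continuous.continuousOn ?_ heq
  exact ContinuousOn.mul (by fun_prop) hg.continuousOn

/-- Truncated partial fraction expansion of the logarithmic derivative of an entire function. -/
lemma Differentiable.norm_logDeriv_sub_sum_le (hf : Differentiable ℂ f) (h0 : f 0 ≠ 0) {R M : ℝ}
    (hR : 0 < R) (hM : ∀ z, ‖z‖ = R → ‖f z‖ ≤ M) {s : ℂ} (hs : ‖s‖ ≤ R / 4) (hfs : f s ≠ 0) :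
    ‖logDeriv f s - logDeriv f 0
        - ∑ w ∈ zerosIn hf h0 R, (analyticOrderNatAt f w : ℂ) * (1 / (s - w) + 1 / w)‖
      ≤ (128 * (Real.log (M / ‖f 0‖) + 1)
          + 2 * ∑ w ∈ zerosIn hf h0 R, (analyticOrderNatAt f w : ℝ)) / R ^ 2 * ‖s‖ := by
  obtain ⟨g, hg, hgne, hfg⟩ := hf.exists_eq_prod_mul h0 hR
  set Z := zerosIn hf h0 R with hZ
  set m := fun w => analyticOrderNatAt f w with hm
  have hZR : ∀ w ∈ Z, ‖w‖ ≤ R := fun w hw => ((mem_zerosIn hf h0).1 hw).1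
  have hZ0 : ∀ w ∈ Z, w ≠ 0 := fun w hw h => h0 (h ▸ ((mem_zerosIn hf h0).1 hw).2)
  have hRC : (R : ℂ) ≠ 0 := by exact_mod_cast hR.ne'
  -- Replacing each z - w by `B w z` keeps the modulus on |z| = R, removes the zeros inside, and
  -- does not decrease the modulus at 0, since |w| ≤ R there. So h is zero-free with the same bound
  -- M and ‖f 0‖ ≤ ‖h 0‖.
  set B : ℂ → ℂ → ℂ := fun w z => ((R : ℂ) ^ 2 - starRingEnd ℂ w * z) / R with hB
  have hBne : ∀ w ∈ Z, ∀ z ∈ ball (0 : ℂ) R, B w z ≠ 0 := fun w hw z hz =>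
    div_ne_zero (sq_sub_conj_mul_ne_zero (hZR w hw) (by simpa using hz)) hRC
  have hBd : ∀ w z, DifferentiableAt ℂ (B w) z := fun w z => by simp only [hB]; fun_prop
  set h : ℂ → ℂ := fun z => (∏ w ∈ Z, B w z ^ m w) * g z with hh
  have hsubc : ball (0 : ℂ) R ⊆ closedBall 0 R := ball_subset_closedBall
  have hhd : DifferentiableOn ℂ h (closedBall 0 R) := by
    intro z hz
    have h1 := (hg z hz).differentiableAt
    have h2 : DifferentiableAt ℂ (fun z => ∏ w ∈ Z, B w z ^ m w) z := by
      simp only [hB]; fun_prop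
    exact (h2.mul h1).differentiableWithinAt
  have hhne : ∀ z ∈ ball (0 : ℂ) R, h z ≠ 0 := fun z hz =>
    mul_ne_zero (Finset.prod_ne_zero_iff.2 fun w hw => pow_ne_zero _ (hBne w hw z hz))
      (hgne z (hsubc hz))
  have hsph : ∀ z ∈ sphere (0 : ℂ) R, ‖h z‖ ≤ M := by
    intro z hz
    have hzR : ‖z‖ = R := by simpa using hz
    refine le_trans (le_of_eq ?_) (hM z hzR)
    rw [hfg z (sphere_subset_closedBall hz), norm_mul, norm_mul, norm_prod, norm_prod]
    congr 1
    refine Finset.prod_congr rfl fun w _ => ?_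
    rw [norm_pow, norm_pow, hB]
    simp only
    rw [norm_div, norm_sq_sub_conj_mul_eq hzR, Complex.norm_real, Real.norm_eq_abs,
      abs_of_pos hR, mul_div_cancel_left₀ _ hR.ne']
  have hball : ∀ z ∈ ball (0 : ℂ) R, ‖h z‖ ≤ M := by
    intro z hz
    refine Complex.norm_le_of_forall_mem_frontier_norm_le isBounded_ball
      (hhd.diffContOnCl_ball (subset_refl _)) ?_ (subset_closure hz)
    rwa [frontier_ball _ hR.ne']
  have h0b : (0 : ℂ) ∈ ball (0 : ℂ) R := by simpa using hR
  have hf0 : ‖f 0‖ ≤ ‖h 0‖ := by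
    rw [hfg 0 (hsubc h0b), norm_mul, norm_mul, norm_prod, norm_prod]
    refine mul_le_mul_of_nonneg_right ?_ (norm_nonneg _)
    refine Finset.prod_le_prod (fun _ _ => norm_nonneg _) fun w hw => ?_
    rw [norm_pow, norm_pow]
    refine pow_le_pow_left₀ (norm_nonneg _) ?_ _
    simp only [hB, mul_zero, sub_zero, zero_sub, norm_neg, norm_div, norm_pow, Complex.norm_real,
      Real.norm_eq_abs, abs_of_pos hR]
    rw [pow_two, mul_div_cancel_right₀ _ hR.ne']
    exact hZR w hw
  have hf0pos : 0 < ‖f 0‖ := norm_pos_iff.2 h0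
  have hM0 : 0 < M := hf0pos.trans_le (hf0.trans (hball 0 h0b))
  have hmain := norm_logDeriv_sub_le_of_ne_zero hR (hhd.mono hsubc) hhne hball hs
  -- logarithmic derivatives of the two factorisations
  have hld : ∀ z ∈ ball (0 : ℂ) R, f z ≠ 0 →
      logDeriv f z = ∑ w ∈ Z, (m w : ℂ) / (z - w) + logDeriv g z := by
    intro z hz hfz
    have hev : f =ᶠ[𝓝 z] fun z => (∏ w ∈ Z, (z - w) ^ m w) * g z := by
      filter_upwards [isOpen_ball.mem_nhds hz] with y hy using hfg y (hsubc hy)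
    have hzw : ∀ w ∈ Z, z - w ≠ 0 := fun w hw hzw => hfz (by
      rw [sub_eq_zero.1 hzw]; exact ((mem_zerosIn hf h0).1 hw).2)
    rw [logDeriv_apply, hev.deriv_eq, hev.eq_of_nhds, ← logDeriv_apply
      (fun z => (∏ w ∈ Z, (z - w) ^ m w) * g z), logDeriv_mul z
      (Finset.prod_ne_zero_iff.2 fun w hw => pow_ne_zero _ (hzw w hw)) (hgne z (hsubc hz))
      (by fun_prop) (hg z (hsubc hz)).differentiableAt,
      logDeriv_prod (f := fun w z => (z - w) ^ m w) (fun w hw => pow_ne_zero _ (hzw w hw))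
      (fun w _ => by fun_prop)]
    congr 1
    refine Finset.sum_congr rfl fun w _ => ?_
    rw [logDeriv_fun_pow (by fun_prop), logDeriv_apply]
    simp [div_eq_mul_inv]
  have hlh : ∀ z ∈ ball (0 : ℂ) R,
      logDeriv h z = ∑ w ∈ Z, (m w : ℂ) * (-(starRingEnd ℂ w) / ((R : ℂ) ^ 2 - starRingEnd ℂ w * z))
        + logDeriv g z := by
    intro z hz
    rw [hh, logDeriv_mul z
      (Finset.prod_ne_zero_iff.2 fun w hw => pow_ne_zero _ (hBne w hw z hz)) (hgne z (hsubc hz))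
      (by simp only [hB]; fun_prop) (hg z (hsubc hz)).differentiableAt,
      logDeriv_prod (f := fun w z => B w z ^ m w) (fun w hw => pow_ne_zero _ (hBne w hw z hz))
      (fun w _ => (hBd w z).fun_pow _)]
    congr 1
    refine Finset.sum_congr rfl fun w _ => ?_
    rw [logDeriv_fun_pow (hBd w z), logDeriv_apply]
    congr 1
    have hder : HasDerivAt (B w) (-(starRingEnd ℂ w) / R) z := by
      have := (((hasDerivAt_id z).const_mul (starRingEnd ℂ w)).const_sub ((R : ℂ) ^ 2)).div_const (R : ℂ)
      simpa [hB] using this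
    rw [hder.deriv, hB]
    simp only
    rw [div_div_div_cancel_right₀ hRC]
  have hsb : s ∈ ball (0 : ℂ) R := by simp; linarith
  -- The contribution of g cancels. What separates f from h is one term per zero coming from `B`,
  -- and its increment from 0 to s is O(|s|/R²).
  have hident : logDeriv f s - logDeriv f 0 - ∑ w ∈ Z, (m w : ℂ) * (1 / (s - w) + 1 / w)
      = (logDeriv h s - logDeriv h 0) + ∑ w ∈ Z, (m w : ℂ) *
          (starRingEnd ℂ w / ((R : ℂ) ^ 2 - starRingEnd ℂ w * s) - starRingEnd ℂ w / (R : ℂ) ^ 2) := by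
    rw [hld s hsb hfs, hld 0 h0b h0, hlh s hsb, hlh 0 h0b]
    have : ∀ a b c d e x y : ℂ, (a + x) - (b + y) - e - ((c + x - (d + y))) = a - b - e - c + d := by
      intros; ring
    rw [← sub_eq_iff_eq_add', this, ← Finset.sum_sub_distrib, ← Finset.sum_sub_distrib,
      ← Finset.sum_sub_distrib, ← Finset.sum_add_distrib]
    refine Finset.sum_congr rfl fun w _ => ?_
    rw [mul_zero, sub_zero, zero_sub, div_neg]
    ring
  rw [hident]
  have hsum : ‖∑ w ∈ Z, (m w : ℂ) * (starRingEnd ℂ w / ((R : ℂ) ^ 2 - starRingEnd ℂ w * s)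
      - starRingEnd ℂ w / (R : ℂ) ^ 2)‖ ≤ (2 * ∑ w ∈ Z, (m w : ℝ)) / R ^ 2 * ‖s‖ := by
    have : (2 * ∑ w ∈ Z, (m w : ℝ)) / R ^ 2 * ‖s‖ = ∑ w ∈ Z, (m w : ℝ) * (2 / R ^ 2 * ‖s‖) := by
      rw [← Finset.sum_mul]; ring
    rw [this]
    refine norm_sum_le_of_le _ fun w hw => ?_
    rw [norm_mul, Complex.norm_natCast]
    refine mul_le_mul_of_nonneg_left ?_ (by positivity)
    have hne := sq_sub_conj_mul_ne_zero (hZR w hw) (show ‖s‖ < R by linarith)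
    have hlow : R ^ 2 / 2 ≤ ‖(R : ℂ) ^ 2 - starRingEnd ℂ w * s‖ := by
      have h1 := norm_sub_norm_le ((R : ℂ) ^ 2) (starRingEnd ℂ w * s)
      rw [norm_mul, RCLike.norm_conj, norm_pow, Complex.norm_real, Real.norm_eq_abs,
        abs_of_pos hR] at h1
      nlinarith [hZR w hw, norm_nonneg w, norm_nonneg s]
    have hcalc : starRingEnd ℂ w / ((R : ℂ) ^ 2 - starRingEnd ℂ w * s) - starRingEnd ℂ w / (R : ℂ) ^ 2
        = starRingEnd ℂ w ^ 2 * s / (((R : ℂ) ^ 2 - starRingEnd ℂ w * s) * (R : ℂ) ^ 2) := by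
      rw [div_sub_div _ _ hne (pow_ne_zero 2 hRC)]
      congr 1; ring
    rw [hcalc, norm_div, norm_mul, norm_mul, norm_pow, norm_pow, RCLike.norm_conj,
      Complex.norm_real, Real.norm_eq_abs, abs_of_pos hR, div_le_iff₀ (by positivity)]
    have hw2 : ‖w‖ ^ 2 ≤ R ^ 2 := pow_le_pow_left₀ (norm_nonneg _) (hZR w hw) 2
    calc ‖w‖ ^ 2 * ‖s‖ ≤ R ^ 2 * ‖s‖ := by gcongr
      _ = 2 / R ^ 2 * ‖s‖ * (R ^ 2 / 2 * R ^ 2) := by field_simp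
      _ ≤ _ := by gcongr
  have hlogle : Real.log (M / ‖h 0‖) ≤ Real.log (M / ‖f 0‖) :=
    Real.log_le_log (by have := hf0pos.trans_le hf0; positivity) (by gcongr)
  calc _ ≤ 128 * (Real.log (M / ‖h 0‖) + 1) / R ^ 2 * ‖s‖
        + (2 * ∑ w ∈ Z, (m w : ℝ)) / R ^ 2 * ‖s‖ :=
        (norm_add_le _ _).trans (add_le_add hmain hsum)
    _ ≤ 128 * (Real.log (M / ‖f 0‖) + 1) / R ^ 2 * ‖s‖
        + (2 * ∑ w ∈ Z, (m w : ℝ)) / R ^ 2 * ‖s‖ := by gcongr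
    _ = _ := by ring

end Entire

section Entire

variable {f : ℂ → ℂ}

/-- The partial fraction expansion of the logarithmic derivative of an entire function of order
less than two. -/
lemma Differentiable.hasSum_logDeriv (hf : Differentiable ℂ f) (h0 : f 0 ≠ 0) {C l : ℝ}
    (hC : 0 ≤ C) (hl : 0 ≤ l) (hl2 : l < 2) (hgr : ∀ z, ‖f z‖ ≤ Real.exp (C * (1 + ‖z‖) ^ l))
    {s : ℂ} (hfs : f s ≠ 0) :
    HasSum (fun w : {z : ℂ | f z = 0} => (analyticOrderNatAt f w : ℂ) * (1 / (s - w) + 1 / w))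
      (logDeriv f s - logDeriv f 0) := by
  have hsum2 := hf.summable_order_mul_rpow h0 hC hl hgr hl2
  have hne : ∀ w : {z : ℂ | f z = 0}, (w : ℂ) ≠ 0 ∧ s - w ≠ 0 := fun w =>
    ⟨fun h => h0 ((congrArg f h).symm.trans w.2), fun h => hfs (by rw [sub_eq_zero.1 h]; exact w.2)⟩
  have hsummable : Summable (fun w : {z : ℂ | f z = 0} =>
      (analyticOrderNatAt f w : ℂ) * (1 / (s - w) + 1 / w)) := by
    -- Each bracket equals s/((s - w)w), so for |w| > 2|s| it is at most 2|s|/|w|²; only finitely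
    -- many zeros are excluded.
    refine Summable.of_norm_bounded_eventually (hsum2.mul_left (2 * ‖s‖)) ?_
    have hfin : {w : {z : ℂ | f z = 0} | ‖(w : ℂ)‖ ≤ 2 * ‖s‖}.Finite := by
      refine Set.Finite.of_finite_image (f := Subtype.val) ((hf.finite_zeros h0 (2 * ‖s‖)).subset ?_)
        Subtype.val_injective.injOn
      rintro _ ⟨w, hw, rfl⟩
      exact ⟨by simpa using hw, w.2⟩
    filter_upwards [hfin.compl_mem_cofinite] with w hw
    have hw' : 2 * ‖s‖ < ‖(w : ℂ)‖ := not_le.1 hw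
    have hw0 : 0 < ‖(w : ℂ)‖ := norm_pos_iff.2 (hne w).1
    have h1 : ‖(w : ℂ)‖ / 2 ≤ ‖s - w‖ := by
      have := norm_sub_norm_le (w : ℂ) s
      rw [norm_sub_rev] at this
      linarith
    have h2 : 1 / (s - w) + 1 / (w : ℂ) = s / ((s - w) * w) := by
      rw [div_add_div _ _ (hne w).2 (hne w).1]; congr 1; ring
    rw [h2, norm_mul, norm_div, norm_mul, Complex.norm_natCast, Real.rpow_neg hw0.le,
      show (2 : ℝ) = ((2 : ℕ) : ℝ) by norm_num, Real.rpow_natCast]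
    push_cast
    have : ‖s‖ / (‖s - w‖ * ‖(w : ℂ)‖) ≤ 2 * ‖s‖ * (‖(w : ℂ)‖ ^ 2)⁻¹ := by
      calc ‖s‖ / (‖s - w‖ * ‖(w : ℂ)‖) ≤ ‖s‖ / (‖(w : ℂ)‖ / 2 * ‖(w : ℂ)‖) := by gcongr
        _ = _ := by field_simp
    calc _ ≤ (analyticOrderNatAt f w : ℝ) * (2 * ‖s‖ * (‖(w : ℂ)‖ ^ 2)⁻¹) := by gcongr
      _ = _ := by ring
  have hlim := hsummable.hasSum
  convert hlim using 1
  classical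
  -- exhaust the zeros by discs
  set F : ℕ → Finset {z : ℂ | f z = 0} := fun n => (zerosIn hf h0 n).subtype (· ∈ {z : ℂ | f z = 0})
    with hF
  have hFt : Tendsto F atTop atTop := by
    refine tendsto_atTop_finset_of_monotone ?_ ?_
    · intro a b hab w hw
      simp only [hF, Finset.mem_subtype, mem_zerosIn] at hw ⊢
      exact ⟨hw.1.trans (by exact_mod_cast hab), hw.2⟩
    · intro w
      obtain ⟨n, hn⟩ := exists_nat_ge ‖(w : ℂ)‖
      exact ⟨n, by simp only [hF, Finset.mem_subtype, mem_zerosIn]; exact ⟨hn, w.2⟩⟩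
  have hlim2 := hlim.comp hFt
  -- Summability being known, the value can be read off along one exhausting sequence of discs. The
  -- truncation error there is O(n^(l-2)), which tends to 0 because l < 2.
  refine tendsto_nhds_unique ?_ hlim2
  obtain ⟨K, hK0, hK⟩ := hf.exists_sum_order_le h0 hC hl hgr
  set A : ℝ := 128 * (C * 2 ^ l + |Real.log ‖f 0‖| + 1) + 2 * K with hA
  rw [tendsto_iff_norm_sub_tendsto_zero]
  have hbound : Tendsto (fun n : ℕ => A * ‖s‖ * (n : ℝ) ^ (-(2 - l))) atTop (𝓝 0) := by
    have := (tendsto_rpow_neg_atTop (sub_pos.2 hl2)).comp tendsto_natCast_atTop_atTop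
    simpa using this.const_mul (A * ‖s‖)
  refine squeeze_zero' (Eventually.of_forall fun _ => norm_nonneg _) ?_ hbound
  obtain ⟨n0, hn0⟩ := exists_nat_ge (4 * ‖s‖)
  filter_upwards [eventually_ge_atTop (max n0 1)] with n hn
  have hn1 : (1 : ℝ) ≤ n := by exact_mod_cast (le_max_right _ _).trans hn
  have hns : ‖s‖ ≤ (n : ℝ) / 4 := by
    have : (n0 : ℝ) ≤ n := by exact_mod_cast (le_max_left _ _).trans hn
    linarith
  have hn0' : (0 : ℝ) < n := by linarith
  have hmain := hf.norm_logDeriv_sub_sum_le h0 (R := n) (M := Real.exp (C * (1 + (n : ℝ)) ^ l)) hn0'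
    (fun z hz => hz ▸ hgr z) hns hfs
  have hFs : ((fun T : Finset {z : ℂ | f z = 0} => ∑ w ∈ T, (analyticOrderNatAt f w : ℂ) *
      (1 / (s - w) + 1 / w)) ∘ F) n
      = ∑ w ∈ zerosIn hf h0 n, (analyticOrderNatAt f w : ℂ) * (1 / (s - w) + 1 / w) := by
    simp only [Function.comp, hF]
    rw [← Finset.sum_subtype_of_mem (p := (· ∈ {z : ℂ | f z = 0})) (fun w =>
      (analyticOrderNatAt f w : ℂ) * (1 / (s - w) + 1 / w)) (fun w hw => ((mem_zerosIn hf h0).1 hw).2)]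
  rw [hFs, norm_sub_rev]
  refine hmain.trans ?_
  have hnl : (1 : ℝ) ≤ (n : ℝ) ^ l := Real.one_le_rpow hn1 hl
  have e1 : Real.log (Real.exp (C * (1 + (n : ℝ)) ^ l) / ‖f 0‖) + 1
      ≤ (C * 2 ^ l + |Real.log ‖f 0‖| + 1) * (n : ℝ) ^ l := by
    rw [Real.log_div (Real.exp_ne_zero _) (norm_ne_zero_iff.2 h0), Real.log_exp]
    have h1 : (1 + (n : ℝ)) ^ l ≤ 2 ^ l * (n : ℝ) ^ l := by
      rw [← Real.mul_rpow (by norm_num) hn0'.le]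
      exact Real.rpow_le_rpow (by positivity) (by linarith) hl
    have h2 : |Real.log ‖f 0‖| ≤ |Real.log ‖f 0‖| * (n : ℝ) ^ l :=
      le_mul_of_one_le_right (abs_nonneg _) hnl
    nlinarith [mul_le_mul_of_nonneg_left h1 hC, neg_abs_le (Real.log ‖f 0‖)]
  have e2 := hK n hn1
  have e3 : (n : ℝ) ^ (-(2 - l)) = (n : ℝ) ^ l / (n : ℝ) ^ 2 := by
    rw [show -(2 - l) = l - (2 : ℕ) by push_cast; ring, Real.rpow_sub hn0', Real.rpow_natCast]
  rw [e3]
  calc _ ≤ (128 * ((C * 2 ^ l + |Real.log ‖f 0‖| + 1) * (n : ℝ) ^ l) + 2 * (K * (n : ℝ) ^ l))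
        / (n : ℝ) ^ 2 * ‖s‖ := by gcongr
    _ = _ := by rw [hA]; ring

end Entire

end EntireFunctions

section ExplicitFormula

open Filter Topology Metric MeasureTheory

/-! ### Continuation of zeta to Re s > 0 and growth of (s - 1)ζ(s). -/

/-- The fractional part on `(1, ∞)`, extended by zero. -/
noncomputable def fractAboveOne (t : ℝ) : ℂ :=
  (Set.Ioi (1 : ℝ)).indicator (fun t : ℝ => ((Int.fract t : ℝ) : ℂ)) t

lemma measurable_fractAboveOne : Measurable fractAboveOne :=
  (Complex.measurable_ofReal.comp measurable_fract).indicator measurableSet_Ioi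

lemma norm_fractAboveOne_le (t : ℝ) : ‖fractAboveOne t‖ ≤ 1 := by
  unfold fractAboveOne
  refine (norm_indicator_le_norm_self _ _).trans ?_
  rw [Complex.norm_real, Real.norm_eq_abs, abs_of_nonneg (Int.fract_nonneg t)]
  exact (Int.fract_lt_one t).le

lemma differentiableAt_mellin_fractAboveOne {s : ℂ} (hs : s.re < 0) :
    DifferentiableAt ℂ (mellin fractAboveOne) s := by
  refine mellin_differentiableAt_of_isBigO_rpow (a := 0) (b := s.re - 1) ?_ ?_ hs ?_ (by linarith)
  · have : LocallyIntegrable fractAboveOne volume := by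
      refine (locallyIntegrable_const (1 : ℝ)).mono measurable_fractAboveOne.aestronglyMeasurable ?_
      filter_upwards with t
      simpa using norm_fractAboveOne_le t
    exact this.locallyIntegrableOn _
  · refine Asymptotics.IsBigO.of_bound 1 (Eventually.of_forall fun t => ?_)
    simpa using norm_fractAboveOne_le t
  · refine Asymptotics.IsBigO.of_bound 1 ?_
    filter_upwards [nhdsWithin_le_nhds (Iio_mem_nhds (show (0 : ℝ) < 1 by norm_num))] with t ht
    have : fractAboveOne t = 0 := Set.indicator_of_notMem (by simpa using le_of_lt ht) _
    rw [this, norm_zero]; positivity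

lemma norm_mellin_fractAboveOne_le {s : ℂ} (hs : 0 < s.re) :
    ‖mellin fractAboveOne (-s)‖ ≤ 1 / s.re := by
  have hint : ∫ t in Set.Ioi (1 : ℝ), t ^ (-s.re - 1) = 1 / s.re := by
    rw [integral_Ioi_rpow_of_lt (by linarith) one_pos]
    simp [neg_div_neg_eq]
  have hint' : IntegrableOn (fun t : ℝ => t ^ (-s.re - 1)) (Set.Ioi 1) :=
    integrableOn_Ioi_rpow_of_lt (by linarith) one_pos
  rw [mellin, ← hint]
  have h1 : ∫ t in Set.Ioi (1 : ℝ), t ^ (-s.re - 1)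
      = ∫ t in Set.Ioi (0 : ℝ), (Set.Ioi (1 : ℝ)).indicator (fun t => t ^ (-s.re - 1)) t := by
    rw [setIntegral_indicator measurableSet_Ioi]
    congr 2
    ext t; simp only [Set.mem_inter_iff, Set.mem_Ioi]
    constructor
    · intro h; exact ⟨by linarith, h⟩
    · exact fun h => h.2
  rw [h1]
  refine norm_integral_le_of_norm_le ?_ ?_
  · exact ((integrable_indicator_iff measurableSet_Ioi).2 hint').integrableOn
  · filter_upwards [ae_restrict_mem measurableSet_Ioi] with t ht
    have ht0 : 0 < t := ht
    by_cases h : t ∈ Set.Ioi (1 : ℝ)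
    · rw [Set.indicator_of_mem h, norm_smul, Complex.norm_cpow_eq_rpow_re_of_pos ht0]
      simpa using mul_le_mul_of_nonneg_left (norm_fractAboveOne_le t)
        (Real.rpow_nonneg ht0.le (-s.re - 1))
    · rw [Set.indicator_of_notMem h, fractAboveOne, Set.indicator_of_notMem h]; simp

/-- Abel summation gives ζ(s) = s∫ ⌊t⌋ t^(-s-1) dt over t > 1; then ⌊t⌋ = t - {t}. The part with {t}
is still analytic for Re s > 0, which is what the continuation uses. -/
lemma riemannZeta_eq_sub_mellin {s : ℂ} (hs : 1 < s.re) :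
    riemannZeta s = s / (s - 1) - s * mellin fractAboveOne (-s) := by
  have h1 := LSeries_eq_mul_integral_of_nonneg (fun _ => (1 : ℝ)) (r := 1) zero_le_one (s := s) hs
    (by simpa using Asymptotics.isBigO_refl _ _) (fun _ => zero_le_one)
  have h2 : LSeries (fun n => ((1 : ℝ) : ℂ)) s = riemannZeta s := by
    rw [← LSeries_one_eq_riemannZeta hs]; simp; rfl
  have hs1 : s - 1 ≠ 0 := by
    intro h; rw [sub_eq_zero.1 h] at hs; simp at hs
  rw [h2] at h1
  rw [h1]
  have hA : ∫ t in Set.Ioi (1 : ℝ), (t : ℂ) ^ (-s) = 1 / (s - 1) := by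
    rw [integral_Ioi_cpow_of_lt (by simpa using hs) one_pos]
    have : -s + 1 = -(s - 1) := by ring
    rw [this, Complex.ofReal_one, Complex.one_cpow, neg_div_neg_eq]
  have hAi : IntegrableOn (fun t : ℝ => (t : ℂ) ^ (-s)) (Set.Ioi 1) :=
    integrableOn_Ioi_cpow_of_lt (by simpa using hs) one_pos
  have hB : mellin fractAboveOne (-s)
      = ∫ t in Set.Ioi (1 : ℝ), (t : ℂ) ^ (-s - 1) * ((Int.fract t : ℝ) : ℂ) := by
    rw [mellin]
    have : ∀ t : ℝ, (t : ℂ) ^ (-s - 1) • fractAboveOne t = (Set.Ioi (1 : ℝ)).indicator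
        (fun t : ℝ => (t : ℂ) ^ (-s - 1) * ((Int.fract t : ℝ) : ℂ)) t := by
      intro t
      by_cases h : t ∈ Set.Ioi (1 : ℝ)
      · rw [fractAboveOne, Set.indicator_of_mem h, Set.indicator_of_mem h, smul_eq_mul]
      · rw [fractAboveOne, Set.indicator_of_notMem h, Set.indicator_of_notMem h, smul_zero]
    simp_rw [this]
    rw [setIntegral_indicator measurableSet_Ioi]
    congr 2
    ext t; simp only [Set.mem_inter_iff, Set.mem_Ioi]
    constructor
    · exact fun h => h.2
    · intro h; exact ⟨by linarith, h⟩
  have hBi : IntegrableOn (fun t : ℝ => (t : ℂ) ^ (-s - 1) * ((Int.fract t : ℝ) : ℂ)) (Set.Ioi 1) := by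
    refine Integrable.mul_bdd (c := 1) (integrableOn_Ioi_cpow_of_lt (by simp; linarith) one_pos)
      (Complex.measurable_ofReal.comp measurable_fract).aestronglyMeasurable ?_
    filter_upwards with t
    rw [Complex.norm_real, Real.norm_eq_abs, abs_of_nonneg (Int.fract_nonneg t)]
    exact (Int.fract_lt_one t).le
  rw [hB, div_eq_mul_one_div s, ← hA, ← mul_sub, ← integral_sub hAi hBi]
  congr 1
  refine setIntegral_congr_fun measurableSet_Ioi fun t ht => ?_
  have ht0 : (0 : ℝ) < t := lt_trans one_pos ht
  have htC : (t : ℂ) ≠ 0 := by exact_mod_cast ht0.ne'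
  have hfl : ((⌊t⌋₊ : ℝ) : ℂ) = t - Int.fract t := by
    rw [← Complex.ofReal_sub, natCast_floor_eq_intCast_floor ht0.le, Int.self_sub_fract]
  have hpow : (t : ℂ) ^ (-s) = t * (t : ℂ) ^ (-s - 1) := by
    rw [Complex.cpow_sub _ _ htC, Complex.cpow_one]; field_simp
  simp only [Complex.ofReal_one, Finset.sum_const, Nat.card_Icc, Nat.add_sub_cancel, nsmul_eq_mul,
    mul_one]
  rw [hpow, show -(s + 1) = -s - 1 by ring, ← Complex.ofReal_natCast, hfl]
  ring

lemma riemannZeta₁_eq_mul {s : ℂ} (hs : s ≠ 1) : riemannZeta₁ s = (s - 1) * riemannZeta s := by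
  rw [riemannZeta_eq_inv_sub_mul hs, mul_inv_cancel_left₀ (sub_ne_zero.2 hs)]

lemma riemannZeta₁_eq_mellin {s : ℂ} (hs : 0 < s.re) :
    riemannZeta₁ s = s - s * (s - 1) * mellin fractAboveOne (-s) := by
  have hopen : IsOpen {s : ℂ | 0 < s.re} := isOpen_lt continuous_const Complex.continuous_re
  have h1 : AnalyticOnNhd ℂ riemannZeta₁ {s : ℂ | 0 < s.re} := fun z _ =>
    differentiable_riemannZeta₁.analyticAt z
  have h2 : AnalyticOnNhd ℂ (fun s => s - s * (s - 1) * mellin fractAboveOne (-s))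
      {s : ℂ | 0 < s.re} := by
    refine DifferentiableOn.analyticOnNhd (fun z hz => ?_) hopen
    have hm : DifferentiableAt ℂ (fun s => mellin fractAboveOne (-s)) z :=
      (differentiableAt_mellin_fractAboveOne (s := -z) (by simpa using hz)).fun_comp' z
        differentiableAt_fun_id.fun_neg
    exact (differentiableAt_fun_id.fun_sub ((differentiableAt_fun_id.fun_mul
      (differentiableAt_fun_id.sub_const 1)).fun_mul hm)).differentiableWithinAt
  refine h1.eqOn_of_preconnected_of_eventuallyEq h2
    (convex_halfSpace_re_gt 0).isPreconnected (z₀ := 2) (by simp) ?_ hs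
  filter_upwards [(isOpen_lt continuous_const Complex.continuous_re).mem_nhds
    (show (1 : ℝ) < (2 : ℂ).re by simp)] with z hz
  have hz1 : z - 1 ≠ 0 := by
    intro h; rw [sub_eq_zero.1 h] at hz; simp at hz
  rw [riemannZeta₁_eq_mul (sub_ne_zero.1 hz1), riemannZeta_eq_sub_mellin hz]
  field_simp

/-- Covers the right of the critical line; the other half-plane is reached through the functional
equation in `exists_norm_riemannZeta₁_le`. -/
lemma norm_riemannZeta₁_le {s : ℂ} (hs : 1 / 2 ≤ s.re) : ‖riemannZeta₁ s‖ ≤ 3 * (1 + ‖s‖) ^ 2 := by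
  have hs0 : 0 < s.re := by linarith
  rw [riemannZeta₁_eq_mellin hs0]
  have h1 : ‖mellin fractAboveOne (-s)‖ ≤ 2 := by
    refine (norm_mellin_fractAboveOne_le hs0).trans ?_
    rw [div_le_iff₀ hs0]; linarith
  have h2 : ‖s - 1‖ ≤ ‖s‖ + 1 := by simpa using norm_sub_le s 1
  calc _ ≤ ‖s‖ + ‖s‖ * ‖s - 1‖ * ‖mellin fractAboveOne (-s)‖ := by
        refine (norm_sub_le _ _).trans ?_
        rw [norm_mul, norm_mul]
    _ ≤ ‖s‖ + ‖s‖ * (‖s‖ + 1) * 2 := by gcongr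
    _ ≤ _ := by nlinarith [norm_nonneg s]

lemma Complex.norm_Gamma_le_Gamma_re {s : ℂ} (hs : 0 < s.re) : ‖Complex.Gamma s‖ ≤ Real.Gamma s.re := by
  rw [Complex.Gamma_eq_integral hs, Real.Gamma_eq_integral hs, Complex.GammaIntegral]
  refine norm_integral_le_of_norm_le (Real.GammaIntegral_convergent hs) ?_
  filter_upwards [ae_restrict_mem measurableSet_Ioi] with t ht
  rw [norm_mul, Complex.norm_cpow_eq_rpow_re_of_pos ht, Complex.norm_real, Real.norm_eq_abs,
    Real.abs_exp]
  simp

/-- A crude form of Stirling: Γ is compared with n! ≤ n^n, and log n ≤ 4n^(1/4) turns n log n into a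
power. The shift to x + 2 reaches the range where Γ is increasing. -/
lemma Real.Gamma_le_exp_rpow {x : ℝ} (hx : 1 / 2 ≤ x) :
    Real.Gamma x ≤ 2 * Real.exp (4 * (x + 2) ^ (5 / 4 : ℝ)) := by
  have hx0 : 0 < x := by linarith
  set n := ⌈x + 1⌉₊ with hn
  have hn1 : x + 1 ≤ n := Nat.le_ceil _
  have hn2 : (n : ℝ) ≤ x + 2 := by have := Nat.ceil_lt_add_one (show 0 ≤ x + 1 by linarith); linarith
  have hn0 : (0 : ℝ) < n := by linarith
  have h1 : Real.Gamma (x + 2) = (x + 1) * (x * Real.Gamma x) := by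
    rw [← Real.Gamma_add_one hx0.ne', ← Real.Gamma_add_one (by linarith)]; ring_nf
  have hG : 0 < Real.Gamma x := Real.Gamma_pos_of_pos hx0
  have h2 : Real.Gamma x ≤ 2 * Real.Gamma (x + 2) := by
    rw [h1]
    have : 1 ≤ 2 * ((x + 1) * x) := by nlinarith
    nlinarith
  have h3 : Real.Gamma (x + 2) ≤ Real.Gamma (n + 1) :=
    Real.Gamma_strictMonoOn_Ici.monotoneOn (by simp; linarith) (by simp; linarith) (by linarith)
  have h4 : Real.Gamma (n + 1) ≤ (n : ℝ) ^ n := by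
    rw [Real.Gamma_nat_eq_factorial]; exact_mod_cast Nat.factorial_le_pow n
  have h5 : (n : ℝ) ^ n ≤ Real.exp (4 * (x + 2) ^ (5 / 4 : ℝ)) := by
    rw [← Real.rpow_natCast, Real.rpow_def_of_pos hn0]
    refine Real.exp_le_exp.2 ?_
    have h6 := Real.log_le_rpow_div hn0.le (show (0 : ℝ) < 1 / 4 by norm_num)
    calc Real.log n * n ≤ (n : ℝ) ^ (1 / 4 : ℝ) / (1 / 4) * n := by gcongr
      _ = 4 * ((n : ℝ) ^ (1 / 4 : ℝ) * (n : ℝ) ^ (1 : ℝ)) := by rw [Real.rpow_one]; ring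
      _ = 4 * (n : ℝ) ^ (5 / 4 : ℝ) := by rw [← Real.rpow_add hn0]; norm_num
      _ ≤ _ := by gcongr
  linarith

lemma Complex.norm_cos_le_exp (z : ℂ) : ‖Complex.cos z‖ ≤ Real.exp ‖z‖ := by
  rw [Complex.cos, norm_div, Complex.norm_ofNat, div_le_iff₀ two_pos]
  have h : ∀ w : ℂ, ‖w‖ = ‖z‖ → ‖Complex.exp w‖ ≤ Real.exp ‖z‖ := fun w hw => by
    rw [Complex.norm_exp, ← hw]; exact Real.exp_le_exp.2 (Complex.re_le_norm w)
  have h1 := h (z * Complex.I) (by simp)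
  have h2 := h (-z * Complex.I) (by simp)
  linarith [norm_add_le (Complex.exp (z * Complex.I)) (Complex.exp (-z * Complex.I))]

/-- The true size is exp(O(|z| log |z|)); the exponent 5/4 absorbs the logarithm and stays below the
3/2 needed later. A compact disc is treated separately, so that |s - 1| ≥ 1 when the functional
equation divides by it. -/
lemma exists_norm_riemannZeta₁_le :
    ∃ C : ℝ, 0 ≤ C ∧ ∀ z, ‖riemannZeta₁ z‖ ≤ Real.exp (C * (1 + ‖z‖) ^ (5 / 4 : ℝ)) := by
  obtain ⟨D, hD⟩ := (isCompact_closedBall (0 : ℂ) 2).exists_bound_of_continuousOn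
    differentiable_riemannZeta₁.continuous.continuousOn
  refine ⟨100 + |D|, by positivity, fun z => ?_⟩
  obtain ⟨X, hX⟩ : ∃ X, X = 1 + ‖z‖ := ⟨_, rfl⟩
  rw [← hX]
  have hX1 : 1 ≤ X := by simp [hX]
  have hXp : X ≤ X ^ (5 / 4 : ℝ) := by
    simpa using Real.rpow_le_rpow_of_exponent_le hX1 (show (1 : ℝ) ≤ 5 / 4 by norm_num)
  have hXe : X ≤ Real.exp X := by linarith [Real.add_one_le_exp X]
  by_cases hz2 : ‖z‖ ≤ 2
  · calc ‖riemannZeta₁ z‖ ≤ D := hD z (by simpa using hz2)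
      _ ≤ Real.exp |D| := by linarith [Real.add_one_le_exp |D|, le_abs_self D]
      _ ≤ _ := Real.exp_le_exp.2 (by nlinarith [abs_nonneg D])
  by_cases hre : 1 / 2 ≤ z.re
  · calc ‖riemannZeta₁ z‖ ≤ 3 * X ^ 2 := by rw [hX]; exact norm_riemannZeta₁_le hre
      _ ≤ Real.exp 3 * (Real.exp X) ^ 2 := by
          gcongr
          linarith [Real.add_one_le_exp (3 : ℝ)]
      _ = Real.exp (3 + 2 * X) := by rw [Real.exp_add, ← Real.exp_nat_mul]; norm_num
      _ ≤ _ := Real.exp_le_exp.2 (by nlinarith [abs_nonneg D])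
  push Not at hz2 hre
  obtain ⟨s, rfl⟩ : ∃ s, z = 1 - s := ⟨1 - z, by ring⟩
  have hsre : 1 / 2 < s.re := by simp at hre; linarith
  have hs1 : s ≠ 1 := by rintro rfl; simp at hz2; linarith
  have hs1' : s - 1 ≠ 0 := sub_ne_zero.2 hs1
  have hsn : ∀ n : ℕ, s ≠ -n := by
    rintro n rfl; simp at hsre
    have : (0 : ℝ) ≤ n := n.cast_nonneg
    linarith
  have hz1 : (1 - s : ℂ) ≠ 1 := by
    intro h; have : s = 0 := by linear_combination -h
    rw [this] at hsre; simp at hsre; linarith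
  have hsX : ‖s‖ ≤ X := by
    have : ‖(1 : ℂ) - (1 - s)‖ ≤ ‖(1 : ℂ)‖ + ‖1 - s‖ := norm_sub_le _ _
    rw [sub_sub_cancel] at this
    rw [hX]; simpa using this
  have heq : riemannZeta₁ (1 - s) = -s * (2 * (2 * Real.pi) ^ (-s) * Complex.Gamma s *
      Complex.cos (Real.pi * s / 2) * (riemannZeta₁ s / (s - 1))) := by
    rw [riemannZeta₁_eq_mul hz1, riemannZeta_one_sub hsn hs1, riemannZeta₁_eq_mul hs1]
    field_simp; ring
  rw [heq]
  have b1 : ‖((2 * Real.pi : ℂ)) ^ (-s)‖ ≤ 1 := by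
    have : (2 * Real.pi : ℂ) = ((2 * Real.pi : ℝ) : ℂ) := by push_cast; ring
    rw [this, Complex.norm_cpow_eq_rpow_re_of_pos (by positivity)]
    exact Real.rpow_le_one_of_one_le_of_nonpos (by linarith [Real.pi_gt_three]) (by simp; linarith)
  have b2 : ‖Complex.Gamma s‖ ≤ 2 * Real.exp (36 * X ^ (5 / 4 : ℝ)) := by
    refine (Complex.norm_Gamma_le_Gamma_re (by linarith)).trans
      ((Real.Gamma_le_exp_rpow hsre.le).trans ?_)
    refine mul_le_mul_of_nonneg_left (Real.exp_le_exp.2 ?_) two_pos.le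
    have h1 : s.re + 2 ≤ 3 * X := by linarith [Complex.re_le_norm s]
    have h2 : (3 : ℝ) ^ (5 / 4 : ℝ) ≤ 9 := by
      calc (3 : ℝ) ^ (5 / 4 : ℝ) ≤ 3 ^ (2 : ℝ) :=
            Real.rpow_le_rpow_of_exponent_le (by norm_num) (by norm_num)
        _ = 9 := by norm_num
    calc 4 * (s.re + 2) ^ (5 / 4 : ℝ) ≤ 4 * (3 * X) ^ (5 / 4 : ℝ) := by
          gcongr
      _ = 4 * (3 ^ (5 / 4 : ℝ) * X ^ (5 / 4 : ℝ)) := by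
          rw [Real.mul_rpow (by norm_num) (by linarith)]
      _ ≤ 4 * (9 * X ^ (5 / 4 : ℝ)) := by gcongr
      _ = _ := by ring
  have b3 : ‖Complex.cos (Real.pi * s / 2)‖ ≤ Real.exp (2 * X) := by
    refine (Complex.norm_cos_le_exp _).trans (Real.exp_le_exp.2 ?_)
    rw [norm_div, norm_mul, Complex.norm_real, Real.norm_eq_abs, abs_of_pos Real.pi_pos,
      Complex.norm_ofNat]
    nlinarith [Real.pi_le_four, norm_nonneg s, Real.pi_pos]
  have b4 : ‖riemannZeta₁ s / (s - 1)‖ ≤ 12 * X ^ 2 := by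
    have h1 : 1 ≤ ‖s - 1‖ := by rw [norm_sub_rev]; linarith
    rw [norm_div, div_le_iff₀ (by linarith)]
    have h2 := norm_riemannZeta₁_le hsre.le
    have h3 : (1 + ‖s‖) ^ 2 ≤ (2 * X) ^ 2 := by gcongr; linarith
    have h4 : 0 ≤ 12 * X ^ 2 := by positivity
    nlinarith
  calc _ = ‖s‖ * (2 * ‖((2 * Real.pi : ℂ)) ^ (-s)‖ * ‖Complex.Gamma s‖ *
        ‖Complex.cos (Real.pi * s / 2)‖ * ‖riemannZeta₁ s / (s - 1)‖) := by
        simp only [norm_mul, norm_neg, Complex.norm_ofNat]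
    _ ≤ X * (2 * 1 * (2 * Real.exp (36 * X ^ (5 / 4 : ℝ))) * Real.exp (2 * X) * (12 * X ^ 2)) := by
        gcongr
    _ = 48 * X ^ 3 * (Real.exp (36 * X ^ (5 / 4 : ℝ)) * Real.exp (2 * X)) := by ring
    _ ≤ Real.exp 48 * (Real.exp X) ^ 3 * (Real.exp (36 * X ^ (5 / 4 : ℝ)) * Real.exp (2 * X)) := by
        gcongr
        linarith [Real.add_one_le_exp (48 : ℝ)]
    _ = Real.exp (48 + 3 * X + (36 * X ^ (5 / 4 : ℝ) + 2 * X)) := by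
        rw [Real.exp_add, Real.exp_add, Real.exp_add, ← Real.exp_nat_mul]; norm_num
    _ ≤ _ := Real.exp_le_exp.2 (by nlinarith [abs_nonneg D])

/-! ### Zeros of (s - 1)ζ(s): summability, partial fractions, density under RH. -/

/-- The multiplicity of a zero of `(s - 1) ζ(s)`. -/
noncomputable def zetaOrder (w : ℂ) : ℝ := analyticOrderNatAt riemannZeta₁ w

lemma zetaOrder_nonneg (w : ℂ) : 0 ≤ zetaOrder w := Nat.cast_nonneg _

/-- The zeros of the entire function `(s - 1) ζ(s)`, trivial and nontrivial. -/
abbrev ZetaZero : Type := {z : ℂ | riemannZeta₁ z = 0}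

lemma riemannZeta₁_zero_ne_zero : riemannZeta₁ 0 ≠ 0 := by
  rw [riemannZeta₁_eq_mul zero_ne_one, riemannZeta_zero]; norm_num

instance : Countable ZetaZero :=
  (differentiable_riemannZeta₁.countable_zeros riemannZeta₁_zero_ne_zero).to_subtype

lemma summable_zetaOrder_mul_rpow :
    Summable fun w : ZetaZero => zetaOrder w * ‖(w : ℂ)‖ ^ (-(3 / 2) : ℝ) := by
  obtain ⟨C, hC, hgr⟩ := exists_norm_riemannZeta₁_le
  exact differentiable_riemannZeta₁.summable_order_mul_rpow riemannZeta₁_zero_ne_zero hC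
    (by norm_num) hgr (by norm_num)

lemma hasSum_logDeriv_riemannZeta₁ {s : ℂ} (hs : riemannZeta₁ s ≠ 0) :
    HasSum (fun w : ZetaZero => (zetaOrder w : ℂ) * (1 / (s - w) + 1 / w))
      (logDeriv riemannZeta₁ s - logDeriv riemannZeta₁ 0) := by
  obtain ⟨C, hC, hgr⟩ := exists_norm_riemannZeta₁_le
  have := differentiable_riemannZeta₁.hasSum_logDeriv riemannZeta₁_zero_ne_zero hC
    (by norm_num) (by norm_num) hgr hs
  simpa [zetaOrder] using this

lemma riemannZeta₁_ne_zero_of_one_lt_re {s : ℂ} (hs : 1 < s.re) : riemannZeta₁ s ≠ 0 := by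
  have h1 : s ≠ 1 := by rintro rfl; simp at hs
  rw [riemannZeta₁_eq_mul h1]
  exact mul_ne_zero (sub_ne_zero.2 h1) (riemannZeta_ne_zero_of_one_lt_re hs)

lemma logDeriv_riemannZeta₁_eq {s : ℂ} (hs : 1 < s.re) :
    logDeriv riemannZeta₁ s
      = 1 / (s - 1) - LSeries (fun n => (ArithmeticFunction.vonMangoldt n : ℂ)) s := by
  have h1 : s ≠ 1 := by rintro rfl; simp at hs
  have hev : riemannZeta₁ =ᶠ[𝓝 s] fun z => (z - 1) * riemannZeta z := by
    filter_upwards [isOpen_ne.mem_nhds h1] with z hz using riemannZeta₁_eq_mul hz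
  rw [logDeriv_apply, hev.deriv_eq, hev.eq_of_nhds, ← logDeriv_apply
    (fun z => (z - 1) * riemannZeta z), logDeriv_mul (f := fun z => z - 1) s (sub_ne_zero.2 h1)
    (riemannZeta_ne_zero_of_one_lt_re hs) (by fun_prop) (differentiableAt_riemannZeta h1),
    ArithmeticFunction.LSeries_vonMangoldt_eq_deriv_riemannZeta_div hs, logDeriv_apply,
    logDeriv_apply]
  simp [neg_div]

/-- On Re s = 3/2 the Dirichlet series of Λ converges absolutely, and the norms of its terms do not
depend on t. -/
lemma exists_norm_logDeriv_riemannZeta₁_le : ∃ A : ℝ, 0 ≤ A ∧ ∀ t : ℝ,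
    ‖logDeriv riemannZeta₁ (3 / 2 + t * Complex.I)‖ ≤ A := by
  have hre : ∀ t : ℝ, ((3 / 2 + t * Complex.I : ℂ)).re = 3 / 2 := fun t => by simp
  refine ⟨2 + ∑' n, ‖LSeries.term (fun n => (ArithmeticFunction.vonMangoldt n : ℂ)) (3 / 2 : ℂ) n‖,
    by positivity, fun t => ?_⟩
  set s : ℂ := 3 / 2 + t * Complex.I with hs
  have h1 : 1 < s.re := by rw [hre]; norm_num
  rw [logDeriv_riemannZeta₁_eq h1]
  refine (norm_sub_le _ _).trans (add_le_add ?_ ?_)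
  · rw [norm_div, norm_one, div_le_iff₀ (norm_pos_iff.2 (sub_ne_zero.2 (by
      intro h; rw [h] at h1; simp at h1)))]
    have := Complex.re_le_norm (s - 1)
    rw [Complex.sub_re, hre, Complex.one_re] at this
    linarith
  · have hsum := (ArithmeticFunction.LSeriesSummable_vonMangoldt h1).norm
    have hterm : ∀ n, ‖LSeries.term (fun n => (ArithmeticFunction.vonMangoldt n : ℂ)) s n‖
        = ‖LSeries.term (fun n => (ArithmeticFunction.vonMangoldt n : ℂ)) (3 / 2 : ℂ) n‖ := by
      intro n
      rw [LSeries.norm_term_eq, LSeries.norm_term_eq, hre]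
      norm_num
    rw [LSeries]
    refine (norm_tsum_le_tsum_norm hsum).trans (le_of_eq ?_)
    simp_rw [hterm]

lemma ZetaZero.ne_zero (w : ZetaZero) : (w : ℂ) ≠ 0 := fun h =>
  riemannZeta₁_zero_ne_zero ((congrArg riemannZeta₁ h).symm.trans w.2)

lemma ZetaZero.norm_pos (w : ZetaZero) : 0 < ‖(w : ℂ)‖ := norm_pos_iff.2 w.ne_zero

lemma ZetaZero.ne_one (w : ZetaZero) : (w : ℂ) ≠ 1 := fun h => by
  have := (congrArg riemannZeta₁ h).symm.trans w.2
  simp at this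

lemma ZetaZero.riemannZeta_eq_zero (w : ZetaZero) : riemannZeta w = 0 := by
  rw [riemannZeta_eq_inv_sub_mul w.ne_one, show riemannZeta₁ w = 0 from w.2, mul_zero]

lemma RiemannHypothesis.re_eq_or (hRH : RiemannHypothesis) (w : ZetaZero) :
    (w : ℂ).re = 1 / 2 ∨ ((w : ℂ).re ≤ -2 ∧ (w : ℂ).im = 0) := by
  by_cases h : ∃ n : ℕ, (w : ℂ) = -2 * (n + 1)
  · obtain ⟨n, hn⟩ := h
    right
    have hr : (w : ℂ) = ((-2 * (n + 1) : ℝ) : ℂ) := by rw [hn]; push_cast; ring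
    rw [hr, Complex.ofReal_re, Complex.ofReal_im]
    have : (0 : ℝ) ≤ n := n.cast_nonneg
    exact ⟨by linarith, rfl⟩
  · exact Or.inl (hRH w w.riemannZeta_eq_zero h w.ne_one)

lemma RiemannHypothesis.norm_ge_half (hRH : RiemannHypothesis) (w : ZetaZero) :
    1 / 2 ≤ ‖(w : ℂ)‖ := by
  have := Complex.abs_re_le_norm (w : ℂ)
  rcases hRH.re_eq_or w with h | ⟨h, -⟩
  · rw [h] at this; exact (le_abs_self _).trans this
  · rw [abs_of_neg (by linarith)] at this; linarith

/-- Under RH, the density of zeros near height `t` is `O(|t|^{1/2})`. -/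
lemma RiemannHypothesis.exists_sum_div_le (hRH : RiemannHypothesis) : ∃ A : ℝ, 0 ≤ A ∧
    ∀ (t : ℝ) (T : Finset ZetaZero), (∀ w ∈ T, (w : ℂ).re = 1 / 2) →
      ∑ w ∈ T, zetaOrder w / (1 + (t - (w : ℂ).im) ^ 2) ≤ A * (2 + |t|) ^ (1 / 2 : ℝ) := by
  obtain ⟨A, hA0, hA⟩ := exists_norm_logDeriv_riemannZeta₁_le
  set S := ∑' w : ZetaZero, zetaOrder w * ‖(w : ℂ)‖ ^ (-(3 / 2) : ℝ) with hS
  have hterm0 : ∀ w : ZetaZero, 0 ≤ zetaOrder w * ‖(w : ℂ)‖ ^ (-(3 / 2) : ℝ) := fun w =>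
    mul_nonneg (zetaOrder_nonneg _) (by positivity)
  have hS0 : 0 ≤ S := tsum_nonneg hterm0
  refine ⟨A + ‖logDeriv riemannZeta₁ 0‖ + S, by positivity, fun t T hT => ?_⟩
  set s : ℂ := 3 / 2 + t * Complex.I with hs
  have hsre : s.re = 3 / 2 := by simp [hs]
  have hsim : s.im = t := by simp [hs]
  set X : ℝ := (2 + |t|) ^ (1 / 2 : ℝ) with hX
  have hX1 : 1 ≤ X := Real.one_le_rpow (by linarith [abs_nonneg t]) (by norm_num)
  have hsn : ‖s‖ ≤ 2 + |t| := by
    have := Complex.norm_le_abs_re_add_abs_im s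
    rw [hsre, hsim] at this
    norm_num at this ⊢; linarith
  have hsum := Complex.hasSum_re (hasSum_logDeriv_riemannZeta₁
    (riemannZeta₁_ne_zero_of_one_lt_re (s := s) (by rw [hsre]; norm_num)))
  have hsum2 := hsum.add (summable_zetaOrder_mul_rpow.hasSum.mul_left X)
  -- On the line Re s = 3/2, a critical zero contributes a nonnegative real part that dominates m/(1
  -- + (t - γ)²). Trivial zeros may contribute negatively; the added term X·m|w|^(-3/2) makes every
  -- summand nonnegative and costs only X·S in total. A finite partial sum is then bounded by the
  -- full one.
  set g : ZetaZero → ℝ := fun w => ((zetaOrder w : ℂ) * (1 / (s - w) + 1 / (w : ℂ))).re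
    + X * (zetaOrder w * ‖(w : ℂ)‖ ^ (-(3 / 2) : ℝ)) with hg
  have hre1 : ∀ w : ZetaZero, ((zetaOrder w : ℂ) * (1 / (s - w) + 1 / (w : ℂ))).re
      = zetaOrder w * (1 / (s - w) + 1 / (w : ℂ)).re := fun w => Complex.re_ofReal_mul _ _
  have hline : ∀ w : ZetaZero, (w : ℂ).re = 1 / 2 →
      zetaOrder w / (1 + (t - (w : ℂ).im) ^ 2) ≤ g w := by
    intro w hw
    have h1 : (1 / (s - (w : ℂ))).re = 1 / (1 + (t - (w : ℂ).im) ^ 2) := by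
      rw [one_div, Complex.inv_re, Complex.normSq_apply, Complex.sub_re, Complex.sub_im, hsre, hsim,
        hw]
      norm_num [pow_two]
    have h2 : 0 ≤ (1 / (w : ℂ)).re := by
      rw [one_div, Complex.inv_re, hw]
      exact div_nonneg (by norm_num) (Complex.normSq_nonneg _)
    simp only [hg]
    rw [hre1, Complex.add_re, h1, mul_add, mul_one_div]
    have h3 := mul_nonneg (zetaOrder_nonneg w) h2
    have h4 := mul_nonneg (zero_le_one.trans hX1) (hterm0 w)
    linarith
  have hg0 : ∀ w : ZetaZero, 0 ≤ g w := by
    intro w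
    rcases hRH.re_eq_or w with hw | ⟨hw, hwi⟩
    · exact (div_nonneg (zetaOrder_nonneg w) (by positivity)).trans (hline w hw)
    · have hw0 := w.norm_pos
      have hwn : ‖(w : ℂ)‖ = -(w : ℂ).re := by
        have : (w : ℂ) = (((w : ℂ).re : ℝ) : ℂ) := Complex.ext rfl (by simp [hwi])
        rw [this, Complex.norm_real, Real.norm_eq_abs, Complex.ofReal_re, abs_of_neg (by linarith)]
      have hsw1 : ‖(w : ℂ)‖ ≤ ‖s - w‖ := by
        have := Complex.re_le_norm (s - w)
        rw [Complex.sub_re, hsre] at this; linarith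
      have hsw2 : ‖s‖ ≤ ‖s - w‖ := by
        rw [Complex.norm_eq_sqrt_sq_add_sq, Complex.norm_eq_sqrt_sq_add_sq]
        refine Real.sqrt_le_sqrt ?_
        rw [Complex.sub_re, Complex.sub_im, hwi, hsre]
        nlinarith
      have hsw0 : s - w ≠ 0 := norm_pos_iff.1 (hw0.trans_le hsw1)
      have hb : ‖1 / (s - w) + 1 / (w : ℂ)‖ ≤ X * ‖(w : ℂ)‖ ^ (-(3 / 2) : ℝ) := by
        have h2 : 1 / (s - w) + 1 / (w : ℂ) = s / ((s - w) * w) := by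
          rw [div_add_div _ _ hsw0 w.ne_zero]; congr 1; ring
        have hs0 : 0 < ‖s‖ := by
          have := Complex.re_le_norm s
          rw [hsre] at this; linarith
        -- As w is real and negative, |s - w| dominates both |s| and |w|, hence their geometric
        -- mean. This splits |s|/(|s - w||w|) into |s|^(1/2) times the summable |w|^(-3/2).
        have h3 : ‖s‖ ^ (1 / 2 : ℝ) * ‖(w : ℂ)‖ ^ (1 / 2 : ℝ) ≤ ‖s - w‖ := by
          calc _ ≤ ‖s - w‖ ^ (1 / 2 : ℝ) * ‖s - w‖ ^ (1 / 2 : ℝ) := by gcongr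
            _ = ‖s - w‖ := by
              rw [← Real.rpow_add (hw0.trans_le hsw1)]; norm_num
        have h4 : ‖s‖ = ‖s‖ ^ (1 / 2 : ℝ) * ‖s‖ ^ (1 / 2 : ℝ) := by
          rw [← Real.rpow_add hs0]; norm_num
        have h5 : ‖(w : ℂ)‖ ^ (-(3 / 2) : ℝ) = (‖(w : ℂ)‖ ^ (1 / 2 : ℝ) * ‖(w : ℂ)‖)⁻¹ := by
          rw [Real.rpow_neg hw0.le, show (3 / 2 : ℝ) = 1 / 2 + 1 by norm_num,
            Real.rpow_add hw0, Real.rpow_one]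
        rw [h2, norm_div, norm_mul, h5]
        have h6 : 0 < ‖s‖ ^ (1 / 2 : ℝ) := by positivity
        calc ‖s‖ / (‖s - w‖ * ‖(w : ℂ)‖)
            ≤ ‖s‖ / (‖s‖ ^ (1 / 2 : ℝ) * ‖(w : ℂ)‖ ^ (1 / 2 : ℝ) * ‖(w : ℂ)‖) := by gcongr
          _ = ‖s‖ ^ (1 / 2 : ℝ) * (‖(w : ℂ)‖ ^ (1 / 2 : ℝ) * ‖(w : ℂ)‖)⁻¹ := by
              nth_rewrite 1 [h4]
              field_simp
          _ ≤ _ := by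
              refine mul_le_mul_of_nonneg_right ?_ (by positivity)
              exact Real.rpow_le_rpow (norm_nonneg _) hsn (by norm_num)
      have h7 := (neg_le_of_abs_le ((Complex.abs_re_le_norm _).trans hb))
      simp only [hg]
      rw [hre1]
      nlinarith [mul_le_mul_of_nonneg_left h7 (zetaOrder_nonneg w)]
  calc ∑ w ∈ T, zetaOrder w / (1 + (t - (w : ℂ).im) ^ 2) ≤ ∑ w ∈ T, g w :=
        Finset.sum_le_sum fun w hw => hline w (hT w hw)
    _ ≤ (logDeriv riemannZeta₁ s - logDeriv riemannZeta₁ 0).re + X * S :=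
        sum_le_hasSum T (fun w _ => hg0 w) hsum2
    _ ≤ (A + ‖logDeriv riemannZeta₁ 0‖) + X * S := by
        gcongr
        exact (Complex.re_le_norm _).trans ((norm_sub_le _ _).trans (by gcongr; exact hA t))
    _ ≤ (A + ‖logDeriv riemannZeta₁ 0‖) * X + X * S := by
        gcongr
        exact le_mul_of_one_le_right (by positivity) hX1
    _ = _ := by ring

lemma analyticOrderNatAt_riemannZeta_eq {w : ℂ} (hw : w ≠ 1) :
    (analyticOrderNatAt riemannZeta w : ℝ) = zetaOrder w := by
  have hev : riemannZeta₁ =ᶠ[𝓝 w] (fun z => z - 1) * riemannZeta := by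
    filter_upwards [isOpen_ne.mem_nhds hw] with z hz using riemannZeta₁_eq_mul hz
  have han : AnalyticAt ℂ riemannZeta w :=
    analyticOn_riemannZeta w hw
  have h1 : AnalyticAt ℂ (fun z : ℂ => z - 1) w := by fun_prop
  rw [zetaOrder, analyticOrderNatAt, analyticOrderNatAt, analyticOrderAt_congr hev,
    analyticOrderAt_mul h1 han, h1.analyticOrderAt_eq_zero.2 (sub_ne_zero.2 hw), zero_add]

lemma RiemannHypothesis.mem_nontrivialZetaZeros_iff (hRH : RiemannHypothesis) {w : ℂ} :
    w ∈ nontrivialZetaZeros ↔ riemannZeta₁ w = 0 ∧ w.re = 1 / 2 := by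
  constructor
  · rintro ⟨h1, h2, h3⟩
    have hw1 : w ≠ 1 := by rintro rfl; simp at h3
    have h0 : riemannZeta₁ w = 0 := by rw [riemannZeta₁_eq_mul hw1, h1, mul_zero]
    refine ⟨h0, ?_⟩
    rcases hRH.re_eq_or ⟨w, h0⟩ with h | ⟨h, -⟩
    · exact h
    · simp only at h; linarith
  · rintro ⟨h1, h2⟩
    exact ⟨ZetaZero.riemannZeta_eq_zero ⟨w, h1⟩, by rw [h2]; norm_num, by rw [h2]; norm_num⟩

/-! ### The primitive of ψ as a weighted sum of Λ. -/

/-- The primitive of the Chebyshev function. -/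
noncomputable def psiPrimitive (x : ℝ) : ℝ := ∫ t in (0 : ℝ)..x, Chebyshev.psi t

lemma intervalIntegrable_psi (a b : ℝ) : IntervalIntegrable Chebyshev.psi volume a b :=
  Chebyshev.psi_mono.intervalIntegrable

lemma continuous_psiPrimitive : Continuous psiPrimitive :=
  intervalIntegral.continuous_primitive intervalIntegrable_psi 0

lemma psi_eq_sum_ite {M : ℕ} {t : ℝ} (ht : t ≤ M) : Chebyshev.psi t
    = ∑ n ∈ Finset.Icc 1 M, ArithmeticFunction.vonMangoldt n * (Set.Ici (n : ℝ)).indicator 1 t := by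
  have hsub : Finset.Ioc 0 ⌊t⌋₊ ⊆ Finset.Icc 1 M := by
    intro n hn
    rw [Finset.mem_Ioc] at hn
    rw [Finset.mem_Icc]
    refine ⟨hn.1, hn.2.trans ?_⟩
    rw [← Nat.floor_natCast (R := ℝ) M]
    exact Nat.floor_mono ht
  rw [Chebyshev.psi, ← Finset.sum_subset hsub]
  · refine Finset.sum_congr rfl fun n hn => ?_
    rw [Finset.mem_Ioc] at hn
    have : (n : ℝ) ≤ t := (Nat.le_floor_iff' (by omega)).1 hn.2
    simp [this]
  · intro n hn1 hn2
    rw [Finset.mem_Icc] at hn1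
    rw [Finset.mem_Ioc] at hn2
    have : ¬ (n : ℝ) ≤ t := fun h => hn2 ⟨hn1.1, Nat.le_floor h⟩
    simp [this]

lemma intervalIntegral_indicator_Ici {a x : ℝ} (ha : 0 ≤ a) (hx : 0 ≤ x) :
    ∫ t in (0 : ℝ)..x, (Set.Ici a).indicator (1 : ℝ → ℝ) t = max (x - a) 0 := by
  rw [intervalIntegral.integral_of_le hx, integral_indicator measurableSet_Ici,
    Measure.restrict_restrict measurableSet_Ici]
  simp only [Pi.one_apply, integral_const, smul_eq_mul, mul_one, measureReal_restrict_apply_univ]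
  rcases ha.eq_or_lt with rfl | ha'
  · have : Set.Ici (0 : ℝ) ∩ Set.Ioc 0 x = Set.Ioc 0 x :=
      Set.inter_eq_right.2 fun t ht => ht.1.le
    rw [this, Real.volume_real_Ioc]
  · have : Set.Ici a ∩ Set.Ioc 0 x = Set.Icc a x := by
      ext t; simp only [Set.mem_inter_iff, Set.mem_Ici, Set.mem_Ioc, Set.mem_Icc]
      exact ⟨fun h => ⟨h.1, h.2.2⟩, fun h => ⟨h.1, ha'.trans_le h.1, h.2⟩⟩
    rw [this, Real.volume_real_Icc]

lemma intervalIntegrable_indicator_Ici (a b c : ℝ) :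
    IntervalIntegrable ((Set.Ici c).indicator (1 : ℝ → ℝ)) volume a b := by
  refine Monotone.intervalIntegrable fun s t hst => ?_
  by_cases hs : c ≤ s
  · simp [hs, hs.trans hst]
  · simp only [Set.indicator, Set.mem_Ici, hs, if_false]
    split_ifs <;> simp

lemma psiPrimitive_eq_sum {M : ℕ} {x : ℝ} (hx : 0 ≤ x) (hxM : x ≤ M) : psiPrimitive x
    = ∑ n ∈ Finset.Icc 1 M, ArithmeticFunction.vonMangoldt n * max (x - n) 0 := by
  rw [psiPrimitive]
  have : ∫ t in (0 : ℝ)..x, Chebyshev.psi t = ∫ t in (0 : ℝ)..x, ∑ n ∈ Finset.Icc 1 M,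
      ArithmeticFunction.vonMangoldt n * (Set.Ici (n : ℝ)).indicator 1 t := by
    refine intervalIntegral.integral_congr fun t ht => ?_
    rw [Set.uIcc_of_le hx] at ht
    exact psi_eq_sum_ite (ht.2.trans hxM)
  rw [this, intervalIntegral.integral_finsetSum fun n _ =>
    (intervalIntegrable_indicator_Ici _ _ _).const_mul _]
  refine Finset.sum_congr rfl fun n _ => ?_
  rw [intervalIntegral.integral_const_mul, intervalIntegral_indicator_Ici n.cast_nonneg hx]

lemma hasSum_psiPrimitive {x : ℝ} (hx : 0 ≤ x) :
    HasSum (fun n : ℕ => ArithmeticFunction.vonMangoldt n * max (x - n) 0) (psiPrimitive x) := by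
  obtain ⟨M, hM⟩ := exists_nat_ge x
  rw [psiPrimitive_eq_sum hx hM]
  refine hasSum_sum_of_ne_finset_zero fun n hn => ?_
  rw [Finset.mem_Icc, not_and_or] at hn
  rcases hn with hn | hn
  · have : n = 0 := by omega
    simp [this]
  · have : (M : ℝ) ≤ n := by exact_mod_cast (by omega : M ≤ n)
    rw [max_eq_right (by linarith), mul_zero]

/-! ### The explicit formula by uniqueness of the Laplace transform. -/

/-- Injectivity of the Laplace transform on a vertical line. -/
lemma eq_zero_of_forall_integral_exp_mul_eq_zero {G : ℝ → ℂ} (hc : ContinuousOn G (Set.Ici 0))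
    (h0 : G 0 = 0) (hi : IntegrableOn G (Set.Ioi 0))
    (hG : ∀ y : ℝ, ∫ u in Set.Ioi (0 : ℝ), Complex.exp (-(y * u) * Complex.I) * G u = 0) :
    ∀ u : ℝ, 0 ≤ u → G u = 0 := by
  -- Extension by zero to the left, continuous because G 0 = 0. Continuity gives Fourier inversion
  -- at every point rather than almost everywhere.
  set D : ℝ → ℂ := fun u => G (max u 0) with hD
  have hDc : Continuous D := by
    refine hc.comp_continuous (by fun_prop) fun u => ?_
    simp
  have hDi : D = (Set.Ioi (0 : ℝ)).indicator G := by
    ext u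
    by_cases hu : 0 < u
    · rw [Set.indicator_of_mem (Set.mem_Ioi.2 hu), hD]; simp only; rw [max_eq_left hu.le]
    · rw [Set.indicator_of_notMem (by simpa using hu), hD]; simp only
      rw [max_eq_right (not_lt.1 hu), h0]
  have hDint : Integrable D := by rw [hDi]; exact (integrable_indicator_iff measurableSet_Ioi).2 hi
  have hF : FourierTransform.fourier D = fun _ => (0 : ℂ) := by
    ext y
    rw [Real.fourier_eq']
    have : ∀ v : ℝ, Complex.exp (((-2 * Real.pi * inner ℝ v y : ℝ) : ℂ) * Complex.I) • D v
        = (Set.Ioi (0 : ℝ)).indicator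
          (fun u : ℝ => Complex.exp (-(((2 * Real.pi * y : ℝ) : ℂ) * u) * Complex.I) * G u) v := by
      intro v
      rw [hDi]
      by_cases hv : v ∈ Set.Ioi (0 : ℝ)
      · rw [Set.indicator_of_mem hv, Set.indicator_of_mem hv, smul_eq_mul]
        congr 3
        simp only [RCLike.inner_apply, conj_trivial]
        push_cast; ring
      · rw [Set.indicator_of_notMem hv, Set.indicator_of_notMem hv, smul_zero]
    simp_rw [this]
    rw [integral_indicator measurableSet_Ioi, hG]
  have hinv := hDc.fourierInv_fourier_eq hDint (by rw [hF]; exact integrable_zero _ _ _)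
  intro u hu
  have h1 : D u = G u := by rw [hD]; simp only; rw [max_eq_left hu]
  rw [← h1, ← hinv, hF, Real.fourierInv_eq']
  simp

lemma summable_zetaOrder_div_sq : Summable fun w : ZetaZero => zetaOrder w / ‖(w : ℂ)‖ ^ 2 := by
  obtain ⟨C, hC, hgr⟩ := exists_norm_riemannZeta₁_le
  have := differentiable_riemannZeta₁.summable_order_mul_rpow riemannZeta₁_zero_ne_zero hC
    (by norm_num) hgr (show (5 / 4 : ℝ) < 2 by norm_num)
  refine this.congr fun w => ?_
  rw [Real.rpow_neg (norm_nonneg _), show (2 : ℝ) = ((2 : ℕ) : ℝ) by norm_num, Real.rpow_natCast]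
  rfl

/-- Allows 1/(w(w + 1)) to be replaced by a multiple of 1/|w|². The constant 2 is forced by the
trivial zero -2. -/
lemma RiemannHypothesis.norm_le_two_mul_norm_add_one (hRH : RiemannHypothesis) (w : ZetaZero) :
    ‖(w : ℂ)‖ ≤ 2 * ‖(w : ℂ) + 1‖ := by
  rcases hRH.re_eq_or w with h | ⟨h, hi⟩
  · have : ‖(w : ℂ)‖ ≤ ‖(w : ℂ) + 1‖ := by
      rw [Complex.norm_eq_sqrt_sq_add_sq, Complex.norm_eq_sqrt_sq_add_sq]
      refine Real.sqrt_le_sqrt ?_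
      simp [h]; norm_num
    linarith [norm_nonneg ((w : ℂ) + 1)]
  · have hw : (w : ℂ) = (((w : ℂ).re : ℝ) : ℂ) := Complex.ext rfl (by simp [hi])
    have h1 : ‖(w : ℂ)‖ = -(w : ℂ).re := by
      rw [hw, Complex.norm_real, Real.norm_eq_abs, Complex.ofReal_re, abs_of_neg (by linarith)]
    have h2 := neg_abs_le ((w : ℂ) + 1).re
    have h3 := Complex.abs_re_le_norm ((w : ℂ) + 1)
    rw [Complex.add_re, Complex.one_re] at h2 h3
    linarith

lemma RiemannHypothesis.add_one_ne_zero (hRH : RiemannHypothesis) (w : ZetaZero) :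
    (w : ℂ) + 1 ≠ 0 := by
  have := hRH.norm_le_two_mul_norm_add_one w
  have h := w.norm_pos
  exact norm_pos_iff.1 (by linarith)

lemma RiemannHypothesis.re_le (hRH : RiemannHypothesis) (w : ZetaZero) : (w : ℂ).re ≤ 1 / 2 := by
  rcases hRH.re_eq_or w with h | ⟨h, -⟩ <;> linarith

/-- The contribution of a zero to the explicit formula for `psiPrimitive (exp u)`. -/
noncomputable def zeroTerm (w : ZetaZero) (u : ℝ) : ℂ :=
  zetaOrder w * ((Complex.exp (((w : ℂ) + 1) * u) - 1) / (w * (w + 1)))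

lemma RiemannHypothesis.norm_zeroTerm_le (hRH : RiemannHypothesis) (w : ZetaZero) {u : ℝ}
    (hu : 0 ≤ u) : ‖zeroTerm w u‖ ≤ 4 * (zetaOrder w / ‖(w : ℂ)‖ ^ 2) * Real.exp (3 / 2 * u) := by
  have hw := w.norm_pos
  have h1 := hRH.norm_le_two_mul_norm_add_one w
  have h2 : ‖Complex.exp (((w : ℂ) + 1) * u) - 1‖ ≤ 2 * Real.exp (3 / 2 * u) := by
    refine (norm_sub_le _ _).trans ?_
    rw [Complex.norm_exp, norm_one]
    have h3 : (((w : ℂ) + 1) * u).re ≤ 3 / 2 * u := by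
      rw [Complex.re_mul_ofReal, Complex.add_re, Complex.one_re]
      have := hRH.re_le w
      nlinarith
    have h4 := Real.exp_le_exp.2 h3
    have h5 : 1 ≤ Real.exp (3 / 2 * u) := Real.one_le_exp (by positivity)
    linarith
  rw [zeroTerm, norm_mul, norm_div, norm_mul, Complex.norm_real, Real.norm_eq_abs,
    abs_of_nonneg (zetaOrder_nonneg w)]
  calc _ ≤ zetaOrder w * (2 * Real.exp (3 / 2 * u) / (‖(w : ℂ)‖ * (‖(w : ℂ)‖ / 2))) := by
        have := zetaOrder_nonneg w
        gcongr
        linarith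
    _ = _ := by field_simp; ring

lemma RiemannHypothesis.summable_zeroTerm (hRH : RiemannHypothesis) {u : ℝ} (hu : 0 ≤ u) :
    Summable fun w => zeroTerm w u :=
  Summable.of_norm_bounded ((summable_zetaOrder_div_sq.mul_left 4).mul_right _)
    fun w => hRH.norm_zeroTerm_le w hu

lemma integral_exp_neg_mul_exp {a s : ℂ} (h : a.re < s.re) :
    IntegrableOn (fun u : ℝ => Complex.exp (-s * u) * Complex.exp (a * u)) (Set.Ioi 0) ∧
    ∫ u in Set.Ioi (0 : ℝ), Complex.exp (-s * u) * Complex.exp (a * u) = 1 / (s - a) := by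
  have he : ∀ u : ℝ, Complex.exp (-s * u) * Complex.exp (a * u) = Complex.exp ((a - s) * u) := by
    intro u; rw [← Complex.exp_add]; ring_nf
  have hre : (a - s).re < 0 := by rw [Complex.sub_re]; linarith
  simp_rw [he]
  refine ⟨integrableOn_exp_mul_complex_Ioi hre 0, ?_⟩
  rw [integral_exp_mul_complex_Ioi hre, ← neg_sub s a, Complex.ofReal_zero, mul_zero,
    Complex.exp_zero, neg_div_neg_eq]

/-- The transform at s + 1 of one zero term is m/(w(s - w)(s + 1)), which is the partial fraction
term m(1/(s - w) + 1/w) divided by s(s + 1). Summation over the zeros therefore reproduces the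
logarithmic derivative. -/
lemma RiemannHypothesis.hasSum_laplace_zeroTerm (hRH : RiemannHypothesis) {s : ℂ} (hs : s.re = 2) :
    IntegrableOn (fun u : ℝ => Complex.exp (-(s + 1) * u) * ∑' w, zeroTerm w u) (Set.Ioi 0) ∧
    ∫ u in Set.Ioi (0 : ℝ), Complex.exp (-(s + 1) * u) * ∑' w, zeroTerm w u
      = (logDeriv riemannZeta₁ s - logDeriv riemannZeta₁ 0) / (s * (s + 1)) := by
  have hs1 : (s + 1).re = 3 := by rw [Complex.add_re, hs, Complex.one_re]; norm_num
  have hsne : s ≠ 0 := by rintro rfl; simp at hs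
  have hs1ne : s + 1 ≠ 0 := by intro h; rw [h] at hs1; simp at hs1
  have hterm : ∀ w : ZetaZero,
      IntegrableOn (fun u : ℝ => Complex.exp (-(s + 1) * u) * zeroTerm w u) (Set.Ioi 0) ∧
      ∫ u in Set.Ioi (0 : ℝ), Complex.exp (-(s + 1) * u) * zeroTerm w u
        = (zetaOrder w : ℂ) * (1 / (s - w) + 1 / w) / (s * (s + 1)) := by
    intro w
    have hw2 := hRH.re_le w
    have h1 := integral_exp_neg_mul_exp (a := (w : ℂ) + 1) (s := s + 1)
      (by rw [Complex.add_re, Complex.one_re, hs1]; linarith)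
    have h2 := integral_exp_neg_mul_exp (a := 0) (s := s + 1) (by rw [hs1]; simp)
    have hsw : s - w ≠ 0 := by
      intro h; have := congrArg Complex.re h
      rw [Complex.sub_re, hs, Complex.zero_re] at this; linarith
    have hw1 := hRH.add_one_ne_zero w
    have hw0 := w.ne_zero
    have he : ∀ u : ℝ, Complex.exp (-(s + 1) * u) * zeroTerm w u
        = (zetaOrder w / (w * (w + 1)) : ℂ) * (Complex.exp (-(s + 1) * u) *
          Complex.exp (((w : ℂ) + 1) * u) - Complex.exp (-(s + 1) * u) * Complex.exp (0 * u)) := by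
      intro u; rw [zeroTerm, zero_mul, Complex.exp_zero]; ring
    simp_rw [he]
    refine ⟨(h1.1.sub h2.1).const_mul _, ?_⟩
    rw [integral_const_mul, integral_sub h1.1 h2.1, h1.2, h2.2]
    have : s + 1 - (w + 1 : ℂ) = s - w := by ring
    rw [this, sub_zero]
    field_simp
    ring
  have hnorm : ∀ w : ZetaZero, ∀ u ∈ Set.Ioi (0 : ℝ),
      ‖Complex.exp (-(s + 1) * u) * zeroTerm w u‖
        ≤ 4 * (zetaOrder w / ‖(w : ℂ)‖ ^ 2) * Real.exp (-(3 / 2) * u) := by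
    intro w u hu
    rw [norm_mul, Complex.norm_exp, Complex.re_mul_ofReal, Complex.neg_re, hs1]
    calc _ ≤ Real.exp (-3 * u) * (4 * (zetaOrder w / ‖(w : ℂ)‖ ^ 2) * Real.exp (3 / 2 * u)) :=
          mul_le_mul_of_nonneg_left (hRH.norm_zeroTerm_le w (le_of_lt hu)) (Real.exp_nonneg _)
      _ = 4 * (zetaOrder w / ‖(w : ℂ)‖ ^ 2) * (Real.exp (-3 * u) * Real.exp (3 / 2 * u)) := by ring
      _ = _ := by rw [← Real.exp_add]; ring_nf
  have hexp : IntegrableOn (fun u : ℝ => Real.exp (-(3 / 2) * u)) (Set.Ioi 0) :=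
    integrableOn_exp_mul_Ioi (by norm_num) 0
  have hsum : Summable fun w : ZetaZero =>
      ∫ u in Set.Ioi (0 : ℝ), ‖Complex.exp (-(s + 1) * u) * zeroTerm w u‖ := by
    refine Summable.of_nonneg_of_le (fun w => integral_nonneg fun _ => norm_nonneg _) (fun w => ?_)
      ((summable_zetaOrder_div_sq.mul_left 4).mul_right
        (∫ u in Set.Ioi (0 : ℝ), Real.exp (-(3 / 2) * u)))
    rw [← integral_const_mul]
    exact setIntegral_mono_on (hterm w).1.norm (hexp.const_mul _) measurableSet_Ioi (hnorm w)
  have hHS := hasSum_integral_of_summable_integral_norm (fun w => (hterm w).1) hsum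
  have hmul : ∀ u : ℝ, Complex.exp (-(s + 1) * u) * ∑' w, zeroTerm w u
      = ∑' w, Complex.exp (-(s + 1) * u) * zeroTerm w u := fun u => tsum_mul_left.symm
  simp_rw [hmul]
  constructor
  · refine Integrable.mono' (hexp.const_mul (∑' w : ZetaZero, 4 * (zetaOrder w / ‖(w : ℂ)‖ ^ 2))) ?_ ?_
    · refine ContinuousOn.aestronglyMeasurable ?_ measurableSet_Ioi
      refine continuousOn_tsum (u := fun w : ZetaZero => 4 * (zetaOrder w / ‖(w : ℂ)‖ ^ 2))
        (fun w => ?_) (summable_zetaOrder_div_sq.mul_left 4) fun w u hu => ?_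
      · unfold zeroTerm; fun_prop
      · refine (hnorm w u hu).trans ?_
        have h1 : Real.exp (-(3 / 2) * u) ≤ 1 :=
          Real.exp_le_one_iff.2 (by have : 0 < u := hu; linarith)
        exact mul_le_of_le_one_right (by have := zetaOrder_nonneg w; positivity) h1
    · filter_upwards [ae_restrict_mem measurableSet_Ioi] with u hu
      rw [← tsum_mul_right]
      exact tsum_of_norm_bounded
        ((summable_zetaOrder_div_sq.mul_left 4).mul_right _).hasSum fun w => hnorm w u hu
  · rw [← hHS.tsum_eq]
    simp_rw [fun w => (hterm w).2]
    rw [tsum_div_const, (hasSum_logDeriv_riemannZeta₁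
      (riemannZeta₁_ne_zero_of_one_lt_re (by rw [hs]; norm_num))).tsum_eq]

/-- The integrand lives on u > log n, where it is exp(-su) - n exp(-(s+1)u); the integral is
n^(-s)(1/s - 1/(s + 1)). -/
lemma laplace_max_exp_sub {n : ℕ} (hn : n ≠ 0) {s : ℂ} (hs : 0 < s.re) :
    IntegrableOn (fun u : ℝ => Complex.exp (-(s + 1) * u) * ((max (Real.exp u - n) 0 : ℝ) : ℂ))
      (Set.Ioi 0) ∧
    ∫ u in Set.Ioi (0 : ℝ), Complex.exp (-(s + 1) * u) * ((max (Real.exp u - n) 0 : ℝ) : ℂ)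
      = 1 / (n : ℂ) ^ s / (s * (s + 1)) := by
  have hnR : (0 : ℝ) < n := by exact_mod_cast Nat.pos_of_ne_zero hn
  have hnC : (n : ℂ) ≠ 0 := by exact_mod_cast hn
  have hl0 : 0 ≤ Real.log n := Real.log_nonneg (by exact_mod_cast Nat.one_le_iff_ne_zero.2 hn)
  have hsne : s ≠ 0 := by rintro rfl; simp at hs
  have hs1ne : s + 1 ≠ 0 := by
    intro h; have := congrArg Complex.re h; simp at this; linarith
  have h1re : (-s).re < 0 := by simpa using hs
  have h2re : (-(s + 1)).re < 0 := by simp; linarith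
  have he : ∀ u : ℝ, Complex.exp (-(s + 1) * u) * ((max (Real.exp u - n) 0 : ℝ) : ℂ)
      = (Set.Ioi (Real.log n)).indicator (fun u : ℝ => Complex.exp (-s * u)
          - n * Complex.exp (-(s + 1) * u)) u := by
    intro u
    by_cases hu : Real.log n < u
    · rw [Set.indicator_of_mem (Set.mem_Ioi.2 hu)]
      have h1 : (n : ℝ) < Real.exp u := (Real.log_lt_iff_lt_exp hnR).1 hu
      rw [max_eq_left (by linarith)]
      have h2 : Complex.exp (-s * u) = Complex.exp (-(s + 1) * u) * Complex.exp u := by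
        rw [← Complex.exp_add]; ring_nf
      rw [h2]; push_cast; ring
    · rw [Set.indicator_of_notMem (by simpa using hu)]
      have h1 : Real.exp u ≤ n := by
        rw [← Real.le_log_iff_exp_le hnR]; exact not_lt.1 hu
      rw [max_eq_right (by linarith)]; simp
  simp_rw [he]
  have hi1 := integrableOn_exp_mul_complex_Ioi h1re (Real.log n)
  have hi2 := (integrableOn_exp_mul_complex_Ioi h2re (Real.log n)).const_mul (n : ℂ)
  have hinter : Set.Ioi 0 ∩ Set.Ioi (Real.log n) = Set.Ioi (Real.log n) :=
    Set.inter_eq_right.2 (Set.Ioi_subset_Ioi hl0)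
  constructor
  · exact ((integrable_indicator_iff measurableSet_Ioi).2 (hi1.sub hi2)).integrableOn
  · rw [setIntegral_indicator measurableSet_Ioi, hinter, integral_sub hi1 hi2, integral_const_mul,
      integral_exp_mul_complex_Ioi h1re, integral_exp_mul_complex_Ioi h2re]
    have h3 : ((Real.log n : ℝ) : ℂ) = Complex.log n := by rw [Complex.ofReal_log hnR.le]; simp
    have h4 : Complex.exp (-s * (Real.log n : ℝ)) = 1 / (n : ℂ) ^ s := by
      rw [h3, Complex.cpow_def_of_ne_zero hnC, one_div, ← Complex.exp_neg]; ring_nf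
    have h5 : Complex.exp (-(s + 1) * (Real.log n : ℝ)) = 1 / (n : ℂ) ^ s / n := by
      have : -(s + 1) * ((Real.log n : ℝ) : ℂ) = -s * (Real.log n : ℝ) - Complex.log n := by
        rw [h3]; ring
      rw [this, Complex.exp_sub, h4, Complex.exp_log hnC]
    rw [h4, h5]
    field_simp
    ring

lemma laplace_psiPrimitive {s : ℂ} (hs : s.re = 2) :
    IntegrableOn (fun u : ℝ => Complex.exp (-(s + 1) * u) * (psiPrimitive (Real.exp u) : ℂ))
      (Set.Ioi 0) ∧
    ∫ u in Set.Ioi (0 : ℝ), Complex.exp (-(s + 1) * u) * (psiPrimitive (Real.exp u) : ℂ)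
      = LSeries (fun n => (ArithmeticFunction.vonMangoldt n : ℂ)) s / (s * (s + 1)) := by
  set L : ℕ → ℂ := fun n => (ArithmeticFunction.vonMangoldt n : ℂ) with hL
  have h1s : 1 < s.re := by rw [hs]; norm_num
  have h2 : (2 : ℂ).re = 2 := rfl
  set P : ℕ → ℝ → ℂ := fun n u => Complex.exp (-(s + 1) * u) *
    ((ArithmeticFunction.vonMangoldt n * max (Real.exp u - n) 0 : ℝ) : ℂ) with hP
  -- Stated for every z on the line because the case z = 2 evaluates the integrals of the norms;
  -- absolute convergence of the Dirichlet series at 2 then justifies the interchange.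
  have hterm : ∀ z : ℂ, z.re = 2 → ∀ n : ℕ,
      IntegrableOn (fun u : ℝ => Complex.exp (-(z + 1) * u) *
        ((ArithmeticFunction.vonMangoldt n * max (Real.exp u - n) 0 : ℝ) : ℂ)) (Set.Ioi 0) ∧
      ∫ u in Set.Ioi (0 : ℝ), Complex.exp (-(z + 1) * u) *
        ((ArithmeticFunction.vonMangoldt n * max (Real.exp u - n) 0 : ℝ) : ℂ)
        = LSeries.term L z n / (z * (z + 1)) := by
    intro z hz n
    rcases eq_or_ne n 0 with rfl | hn
    · simp
    · have := laplace_max_exp_sub hn (s := z) (by rw [hz]; norm_num)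
      have he : ∀ u : ℝ, Complex.exp (-(z + 1) * u) *
          ((ArithmeticFunction.vonMangoldt n * max (Real.exp u - n) 0 : ℝ) : ℂ)
          = L n * (Complex.exp (-(z + 1) * u) * ((max (Real.exp u - n) 0 : ℝ) : ℂ)) := by
        intro u; simp only [hL]; push_cast; ring
      simp_rw [he]
      refine ⟨this.1.const_mul _, ?_⟩
      rw [integral_const_mul, this.2, LSeries.term_of_ne_zero hn]
      ring
  have hnorm : ∀ n u, ‖P n u‖ = Real.exp (-3 * u) *
      (ArithmeticFunction.vonMangoldt n * max (Real.exp u - n) 0) := by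
    intro n u
    have : 0 ≤ ArithmeticFunction.vonMangoldt n * max (Real.exp u - n) 0 :=
      mul_nonneg ArithmeticFunction.vonMangoldt_nonneg (le_max_right _ _)
    rw [hP]; simp only
    rw [norm_mul, Complex.norm_real, Real.norm_eq_abs, abs_of_nonneg this, Complex.norm_exp,
      Complex.re_mul_ofReal, Complex.neg_re, Complex.add_re, hs, Complex.one_re]
    norm_num
  have hnormint : ∀ n, ((∫ u in Set.Ioi (0 : ℝ), ‖P n u‖ : ℝ) : ℂ)
      = LSeries.term L 2 n / ((2 : ℂ) * (2 + 1)) := by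
    intro n
    rw [← (hterm 2 h2 n).2, ← integral_complex_ofReal]
    refine setIntegral_congr_fun measurableSet_Ioi fun u _ => ?_
    rw [hnorm]
    push_cast
    norm_num
  have hsum : Summable fun n => ∫ u in Set.Ioi (0 : ℝ), ‖P n u‖ := by
    rw [← Complex.summable_ofReal]
    simp_rw [hnormint]
    exact (ArithmeticFunction.LSeriesSummable_vonMangoldt (s := 2) (by norm_num)).div_const _
  have hHS := hasSum_integral_of_summable_integral_norm (fun n => (hterm s hs n).1) hsum
  have hps : ∀ u : ℝ, HasSum (fun n => P n u)
      (Complex.exp (-(s + 1) * u) * (psiPrimitive (Real.exp u) : ℂ)) := by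
    intro u
    exact (Complex.hasSum_ofReal.2 (hasSum_psiPrimitive (Real.exp_nonneg u))).mul_left _
  have hpe : ∀ u : ℝ, Complex.exp (-(s + 1) * u) * (psiPrimitive (Real.exp u) : ℂ)
      = ∑' n, P n u := fun u => (hps u).tsum_eq.symm
  constructor
  · have hc : Continuous fun u : ℝ =>
        Complex.exp (-(s + 1) * u) * (psiPrimitive (Real.exp u) : ℂ) := by
      have := continuous_psiPrimitive
      fun_prop
    have hdom : IntegrableOn (fun u : ℝ => (Real.log 4 + 4) * Real.exp (-u)) (Set.Ioi 0) := by
      have := integrableOn_exp_mul_Ioi (show (-1 : ℝ) < 0 by norm_num) 0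
      simp only [neg_mul, one_mul] at this
      exact this.const_mul _
    refine Integrable.mono' hdom hc.aestronglyMeasurable ?_
    filter_upwards with u
    have hx : 0 ≤ Real.exp u := Real.exp_nonneg u
    have hpsi : |psiPrimitive (Real.exp u)| ≤ (Real.log 4 + 4) * Real.exp u * Real.exp u := by
      have := intervalIntegral.norm_integral_le_of_norm_le_const (a := 0) (b := Real.exp u)
        (f := Chebyshev.psi) (C := (Real.log 4 + 4) * Real.exp u) fun t ht => by
          rw [Set.uIoc_of_le hx] at ht
          rw [Real.norm_eq_abs, abs_of_nonneg (Chebyshev.psi_nonneg t)]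
          refine (Chebyshev.psi_le_const_mul_self ht.1.le).trans ?_
          have : 0 ≤ Real.log 4 := Real.log_nonneg (by norm_num)
          gcongr
          exact ht.2
      rwa [sub_zero, abs_of_nonneg hx, Real.norm_eq_abs] at this
    rw [norm_mul, Complex.norm_real, Real.norm_eq_abs, Complex.norm_exp,
      Complex.re_mul_ofReal, Complex.neg_re, Complex.add_re, hs, Complex.one_re]
    calc _ ≤ Real.exp (-(2 + 1) * u) * ((Real.log 4 + 4) * Real.exp u * Real.exp u) := by gcongr
      _ = (Real.log 4 + 4) * (Real.exp (-(2 + 1) * u) * (Real.exp u * Real.exp u)) := by ring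
      _ = (Real.log 4 + 4) * Real.exp (-u) := by
          rw [← Real.exp_add, ← Real.exp_add]; ring_nf
  · simp_rw [hpe]
    rw [← hHS.tsum_eq]
    simp_rw [fun n => (hterm s hs n).2]
    rw [tsum_div_const, LSeries]

lemma psiPrimitive_one : psiPrimitive 1 = 0 := by
  rw [psiPrimitive_eq_sum (M := 1) zero_le_one (by norm_num)]
  simp

/-- The explicit formula for the primitive of the Chebyshev function. -/
lemma RiemannHypothesis.psiPrimitive_exp_eq (hRH : RiemannHypothesis) {u : ℝ} (hu : 0 ≤ u) :
    (psiPrimitive (Real.exp u) : ℂ) = (Complex.exp (2 * u) - 1) / 2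
      - (1 + logDeriv riemannZeta₁ 0) * (Complex.exp u - 1) - ∑' w, zeroTerm w u := by
  set B := logDeriv riemannZeta₁ 0 with hB
  -- The coefficient 1 + B is the one that cancels the transforms: (s²+s)⁻¹ times -s/(s - 1) + (1 +
  -- B) + 1/(s - 1) - B is zero, the Dirichlet series having dropped out. The damping exp(-3u) is
  -- the factor exp(-(s+1)u) at s = 2.
  set F : ℝ → ℂ := fun u => (psiPrimitive (Real.exp u) : ℂ) - (Complex.exp (2 * u) - 1) / 2
      + (1 + B) * (Complex.exp u - 1) + ∑' w, zeroTerm w u with hF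
  suffices h : ∀ u : ℝ, 0 ≤ u → Complex.exp (-3 * u) * F u = 0 by
    have h1 := (mul_eq_zero.1 (h u hu)).resolve_left (Complex.exp_ne_zero _)
    simp only [hF] at h1
    linear_combination h1
  -- the Laplace transform of `F` vanishes on `Re s = 2`
  have hlap : ∀ y : ℝ, IntegrableOn (fun u : ℝ => Complex.exp (-(2 + y * Complex.I + 1) * u) * F u)
      (Set.Ioi 0) ∧ ∫ u in Set.Ioi (0 : ℝ), Complex.exp (-(2 + y * Complex.I + 1) * u) * F u = 0 := by
    intro y
    set s : ℂ := 2 + y * Complex.I with hs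
    have hsre : s.re = 2 := by simp [hs]
    have hs1re : (s + 1).re = 3 := by rw [Complex.add_re, hsre, Complex.one_re]; norm_num
    have a1 := laplace_psiPrimitive hsre
    have a2 := hRH.hasSum_laplace_zeroTerm hsre
    have a3 := integral_exp_neg_mul_exp (a := 2) (s := s + 1) (by rw [hs1re]; norm_num)
    have a4 := integral_exp_neg_mul_exp (a := 1) (s := s + 1) (by rw [hs1re]; norm_num)
    have a5 := integral_exp_neg_mul_exp (a := 0) (s := s + 1) (by rw [hs1re]; norm_num)
    have he : ∀ u : ℝ, Complex.exp (-(s + 1) * u) * F u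
        = Complex.exp (-(s + 1) * u) * (psiPrimitive (Real.exp u) : ℂ)
          - (1 / 2) * (Complex.exp (-(s + 1) * u) * Complex.exp (2 * u)
            - Complex.exp (-(s + 1) * u) * Complex.exp (0 * u))
          + (1 + B) * (Complex.exp (-(s + 1) * u) * Complex.exp (1 * u)
            - Complex.exp (-(s + 1) * u) * Complex.exp (0 * u))
          + Complex.exp (-(s + 1) * u) * ∑' w, zeroTerm w u := by
      intro u
      simp only [hF, zero_mul, Complex.exp_zero, one_mul]
      ring
    simp_rw [he]
    have i2 : IntegrableOn (fun u : ℝ => (1 / 2 : ℂ) * (Complex.exp (-(s + 1) * u) *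
        Complex.exp (2 * u) - Complex.exp (-(s + 1) * u) * Complex.exp (0 * u))) (Set.Ioi 0) :=
      (a3.1.sub a5.1).const_mul (1 / 2 : ℂ)
    have i3 : IntegrableOn (fun u : ℝ => (1 + B) * (Complex.exp (-(s + 1) * u) *
        Complex.exp (1 * u) - Complex.exp (-(s + 1) * u) * Complex.exp (0 * u))) (Set.Ioi 0) :=
      (a4.1.sub a5.1).const_mul (1 + B)
    have i12 := integral_sub a1.1 i2
    have i123 := integral_add (a1.1.sub i2) i3
    have i1234 := integral_add ((a1.1.sub i2).add i3) a2.1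
    simp only [Pi.sub_apply, Pi.add_apply] at i12 i123 i1234
    refine ⟨((a1.1.sub i2).add i3).add a2.1, ?_⟩
    rw [i1234, i123, i12,
      integral_const_mul, integral_const_mul, integral_sub a3.1 a5.1,
      integral_sub a4.1 a5.1, a1.2, a2.2, a3.2, a4.2, a5.2,
      logDeriv_riemannZeta₁_eq (by rw [hsre]; norm_num)]
    have n0 : s ≠ 0 := by intro h; rw [h] at hsre; simp at hsre
    have n1 : s + 1 ≠ 0 := by intro h; rw [h] at hs1re; simp at hs1re
    have n2 : s - 1 ≠ 0 := by
      intro h; rw [sub_eq_zero.1 h] at hsre; simp at hsre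
    have e1 : s + 1 - 2 = s - 1 := by ring
    have e2 : s + 1 - 1 = s := by ring
    rw [e1, e2, sub_zero, ← hB]
    field_simp
    ring
  refine eq_zero_of_forall_integral_exp_mul_eq_zero ?_ ?_ ?_ ?_
  · have hz : ContinuousOn (fun u : ℝ => Complex.exp (-3 * u) * ∑' w, zeroTerm w u) (Set.Ici 0) := by
      have : ∀ u : ℝ, Complex.exp (-3 * u) * ∑' w, zeroTerm w u
          = ∑' w, Complex.exp (-3 * u) * zeroTerm w u := fun u => tsum_mul_left.symm
      simp_rw [this]
      refine continuousOn_tsum (u := fun w : ZetaZero => 4 * (zetaOrder w / ‖(w : ℂ)‖ ^ 2))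
        (fun w => ?_) (summable_zetaOrder_div_sq.mul_left 4) fun w u hu => ?_
      · unfold zeroTerm; fun_prop
      · have hu0 : 0 ≤ u := hu
        have h0 : 0 ≤ 4 * (zetaOrder w / ‖(w : ℂ)‖ ^ 2) := by
          have := zetaOrder_nonneg w; positivity
        have hre : (-3 * (u : ℂ)).re = -3 * u := by simp
        rw [norm_mul, Complex.norm_exp, hre]
        calc _ ≤ Real.exp (-3 * u) * (4 * (zetaOrder w / ‖(w : ℂ)‖ ^ 2) * Real.exp (3 / 2 * u)) :=
              mul_le_mul_of_nonneg_left (hRH.norm_zeroTerm_le w hu0) (Real.exp_nonneg _)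
          _ = 4 * (zetaOrder w / ‖(w : ℂ)‖ ^ 2) * (Real.exp (-3 * u) * Real.exp (3 / 2 * u)) := by
              ring
          _ = 4 * (zetaOrder w / ‖(w : ℂ)‖ ^ 2) * Real.exp (-(3 / 2) * u) := by
              rw [← Real.exp_add]; ring_nf
          _ ≤ _ := mul_le_of_le_one_right h0 (Real.exp_le_one_iff.2 (by linarith))
    have hc : Continuous fun u : ℝ => Complex.exp (-3 * u) * ((psiPrimitive (Real.exp u) : ℂ)
        - (Complex.exp (2 * u) - 1) / 2 + (1 + B) * (Complex.exp u - 1)) := by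
      have := continuous_psiPrimitive
      fun_prop
    refine (hc.continuousOn.add hz).congr fun u _ => ?_
    simp only [hF, Pi.add_apply]; ring
  -- The "- 1" subtracted from each exponential makes F vanish at 0, as inversion on the half-line
  -- needs.
  · simp [hF, zeroTerm, psiPrimitive_one]
  · refine (hlap 0).1.congr_fun (fun u _ => ?_) measurableSet_Ioi
    simp only [Complex.ofReal_zero, zero_mul, add_zero]
    norm_num
  · intro y
    rw [← (hlap y).2]
    refine setIntegral_congr_fun measurableSet_Ioi fun u _ => ?_
    rw [← mul_assoc, ← Complex.exp_add]
    ring_nf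

/-! ### Mean squares of exponential sums. -/

lemma integral_exp_mul_exp_neg_two_abs (L θ : ℝ) :
    Integrable (fun u : ℝ => Complex.exp (θ * u * Complex.I) * (Real.exp (-2 * |u - L|) : ℂ)) ∧
    ‖∫ u : ℝ, Complex.exp (θ * u * Complex.I) * (Real.exp (-2 * |u - L|) : ℂ)‖ = 4 / (4 + θ ^ 2) := by
  set f : ℝ → ℂ := fun u => Complex.exp (θ * u * Complex.I) * (Real.exp (-2 * |u - L|) : ℂ) with hf
  have r1 : (0 : ℝ) < (2 + θ * Complex.I : ℂ).re := by simp
  have r2 : (-2 + θ * Complex.I : ℂ).re < 0 := by simp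
  have e1 : ∀ u ∈ Set.Iic L, f u
      = Complex.exp (-2 * L) * Complex.exp ((2 + θ * Complex.I) * u) := by
    intro u hu
    simp only [hf]
    rw [abs_of_nonpos (by simpa using hu), Complex.ofReal_exp, ← Complex.exp_add, ← Complex.exp_add]
    congr 1; push_cast; ring
  have e2 : ∀ u ∈ Set.Ioi L, f u
      = Complex.exp (2 * L) * Complex.exp ((-2 + θ * Complex.I) * u) := by
    intro u hu
    have hu' : L < u := hu
    simp only [hf]
    rw [abs_of_nonneg (by linarith), Complex.ofReal_exp, ← Complex.exp_add, ← Complex.exp_add]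
    congr 1; push_cast; ring
  have i1 : IntegrableOn f (Set.Iic L) := by
    have h : IntegrableOn (fun u : ℝ => Complex.exp (-2 * L) * Complex.exp ((2 + θ * Complex.I) * u)) (Set.Iic L) :=
      (integrableOn_exp_mul_complex_Iic r1 L).const_mul _
    exact h.congr_fun (fun u hu => (e1 u hu).symm) measurableSet_Iic
  have i2 : IntegrableOn f (Set.Ioi L) := by
    have h : IntegrableOn (fun u : ℝ => Complex.exp (2 * L) * Complex.exp ((-2 + θ * Complex.I) * u)) (Set.Ioi L) :=
      (integrableOn_exp_mul_complex_Ioi r2 L).const_mul _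
    exact h.congr_fun (fun u hu => (e2 u hu).symm) measurableSet_Ioi
  have hi : Integrable f := by
    rw [← integrableOn_univ, ← Set.Iic_union_Ioi (a := L)]
    exact i1.union i2
  refine ⟨hi, ?_⟩
  have n1 : (2 + θ * Complex.I : ℂ) ≠ 0 := by intro h; rw [h] at r1; simp at r1
  have n2 : (2 - θ * Complex.I : ℂ) ≠ 0 := by
    intro h; have := congrArg Complex.re h; simp at this
  have n3 : (4 + θ ^ 2 : ℂ) ≠ 0 := by
    have : (4 + θ ^ 2 : ℂ) = ((4 + θ ^ 2 : ℝ) : ℂ) := by push_cast; ring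
    rw [this]; exact_mod_cast (by positivity : (4 + θ ^ 2 : ℝ) ≠ 0)
  have hval : ∫ u, f u = Complex.exp (θ * L * Complex.I) * ((4 / (4 + θ ^ 2) : ℝ) : ℂ) := by
    rw [← intervalIntegral.integral_Iic_add_Ioi i1 i2, setIntegral_congr_fun measurableSet_Iic e1,
      setIntegral_congr_fun measurableSet_Ioi e2, integral_const_mul, integral_const_mul,
      integral_exp_mul_complex_Iic r1, integral_exp_mul_complex_Ioi r2]
    have h1 : Complex.exp (-2 * L) * (Complex.exp ((2 + θ * Complex.I) * L) / (2 + θ * Complex.I))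
        = Complex.exp (θ * L * Complex.I) / (2 + θ * Complex.I) := by
      rw [← mul_div_assoc, ← Complex.exp_add]; congr 2; ring
    have h2 : Complex.exp (2 * L) * (-Complex.exp ((-2 + θ * Complex.I) * L)
        / (-2 + θ * Complex.I)) = Complex.exp (θ * L * Complex.I) / (2 - θ * Complex.I) := by
      rw [show (-2 + θ * Complex.I : ℂ) = -(2 - θ * Complex.I) by ring, neg_div_neg_eq,
        ← mul_div_assoc, ← Complex.exp_add]
      congr 2; ring
    rw [h1, h2]
    have h3 : (2 + θ * Complex.I : ℂ) * (2 - θ * Complex.I) = 4 + θ ^ 2 := by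
      ring_nf; rw [Complex.I_sq]; ring
    push_cast
    rw [div_add_div _ _ n1 n2, h3]
    ring
  rw [hval, norm_mul, Complex.norm_real, Real.norm_eq_abs, abs_of_pos (by positivity),
    show (θ * L * Complex.I : ℂ) = ((θ * L : ℝ) : ℂ) * Complex.I by push_cast; ring,
    Complex.norm_exp_ofReal_mul_I, one_mul]

section MeanSquare

variable {ι : Type*} {c : ι → ℂ} {g : ι → ℝ} {M : ℝ}

/-- A weighted mean-square bound for finite exponential sums. -/
lemma intervalIntegral_normSq_finset_sum_exp_le (T : Finset ι)
    (hM : ∑ i ∈ T, ∑ j ∈ T, ‖c i‖ * ‖c j‖ * (4 / (4 + (g i - g j) ^ 2)) ≤ M) {a L : ℝ}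
    (haL : a ≤ L) :
    ∫ u in a..L, ‖∑ i ∈ T, c i * Complex.exp (g i * u * Complex.I)‖ ^ 2 * Real.exp (2 * u)
      ≤ M * Real.exp (2 * L) := by
  set S : ℝ → ℂ := fun u => ∑ i ∈ T, c i * Complex.exp (g i * u * Complex.I) with hS
  -- For u ≤ L the weight exp(-2|u - L|) equals exp(2u) exp(-2L), so integrating over all of ℝ only
  -- enlarges the quantity wanted. Expanding the square leaves the Fourier transform of the weight
  -- at g i - g j, of modulus 4/(4 + (g i - g j)²).
  set f : ℝ → ℝ := fun u => ‖S u‖ ^ 2 * Real.exp (-2 * |u - L|) with hf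
  have hexpand : ∀ u, (f u : ℂ) = ∑ i ∈ T, ∑ j ∈ T, (c i * starRingEnd ℂ (c j)) *
      (Complex.exp ((g i - g j : ℝ) * u * Complex.I) * (Real.exp (-2 * |u - L|) : ℂ)) := by
    intro u
    simp only [hf]
    rw [Complex.ofReal_mul, Complex.ofReal_pow, ← Complex.mul_conj', hS]
    simp only
    rw [map_sum, Finset.sum_mul_sum, Finset.sum_mul]
    refine Finset.sum_congr rfl fun i _ => ?_
    rw [Finset.sum_mul]
    refine Finset.sum_congr rfl fun j _ => ?_
    have : Complex.exp ((g i - g j : ℝ) * u * Complex.I)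
        = Complex.exp (g i * u * Complex.I) * starRingEnd ℂ (Complex.exp (g j * u * Complex.I)) := by
      rw [← Complex.exp_conj, ← Complex.exp_add]
      congr 1
      simp only [map_mul, Complex.conj_ofReal, Complex.conj_I]
      push_cast; ring
    rw [this, map_mul]; ring
  have hint : ∀ i j, Integrable (fun u : ℝ => (c i * starRingEnd ℂ (c j)) *
      (Complex.exp ((g i - g j : ℝ) * u * Complex.I) * (Real.exp (-2 * |u - L|) : ℂ))) := fun i j =>
    (integral_exp_mul_exp_neg_two_abs L (g i - g j)).1.const_mul _
  have hfint : Integrable f := by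
    have : Integrable (fun u => (f u : ℂ)) := by
      simp_rw [hexpand]
      exact integrable_finsetSum _ fun i _ => integrable_finsetSum _ fun j _ => hint i j
    simpa using this.re
  have hf0 : ∀ u, 0 ≤ f u := fun u => by simp only [hf]; positivity
  have hbound : ∫ u, f u ≤ M := by
    have h1 : ((∫ u, f u : ℝ) : ℂ) = ∑ i ∈ T, ∑ j ∈ T, ∫ u : ℝ, (c i * starRingEnd ℂ (c j)) *
        (Complex.exp ((g i - g j : ℝ) * u * Complex.I) * (Real.exp (-2 * |u - L|) : ℂ)) := by
      rw [← integral_complex_ofReal]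
      simp_rw [hexpand]
      rw [integral_finsetSum _ fun i _ => integrable_finsetSum _ fun j _ => hint i j]
      exact Finset.sum_congr rfl fun i _ => integral_finsetSum _ fun j _ => hint i j
    have h2 : ∫ u, f u = ‖((∫ u, f u : ℝ) : ℂ)‖ := by
      rw [Complex.norm_real, Real.norm_eq_abs, abs_of_nonneg (integral_nonneg hf0)]
    rw [h2, h1]
    refine le_trans ?_ hM
    refine norm_sum_le_of_le _ fun i _ => norm_sum_le_of_le _ fun j _ => ?_
    rw [integral_const_mul, norm_mul, norm_mul, RCLike.norm_conj,
      (integral_exp_mul_exp_neg_two_abs L (g i - g j)).2]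
  have hcongr : ∫ u in a..L, ‖S u‖ ^ 2 * Real.exp (2 * u)
      = ∫ u in Set.Ioc a L, Real.exp (2 * L) * f u := by
    rw [intervalIntegral.integral_of_le haL]
    refine setIntegral_congr_fun measurableSet_Ioc fun u hu => ?_
    simp only [hf]
    rw [abs_of_nonpos (by linarith [hu.2])]
    have : Real.exp (2 * u) = Real.exp (2 * L) * Real.exp (-2 * -(u - L)) := by
      rw [← Real.exp_add]; ring_nf
    rw [this]; ring
  rw [hcongr, integral_const_mul, mul_comm]
  refine mul_le_mul_of_nonneg_right ?_ (Real.exp_nonneg _)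
  exact (setIntegral_le_integral hfint (Eventually.of_forall hf0)).trans hbound

/-- A weighted mean-square bound for absolutely convergent exponential sums. -/
lemma intervalIntegral_normSq_tsum_exp_le [Countable ι] (hc : Summable fun i => ‖c i‖)
    (hM : ∀ T : Finset ι,
      ∑ i ∈ T, ∑ j ∈ T, ‖c i‖ * ‖c j‖ * (4 / (4 + (g i - g j) ^ 2)) ≤ M) {a L : ℝ} (haL : a ≤ L) :
    ∫ u in a..L, ‖∑' i, c i * Complex.exp (g i * u * Complex.I)‖ ^ 2 * Real.exp (2 * u)
      ≤ M * Real.exp (2 * L) := by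
  have hnorm : ∀ i (u : ℝ), ‖c i * Complex.exp (g i * u * Complex.I)‖ = ‖c i‖ := by
    intro i u
    rw [norm_mul, show (g i * u * Complex.I : ℂ) = ((g i * u : ℝ) : ℂ) * Complex.I by push_cast; ring,
      Complex.norm_exp_ofReal_mul_I, mul_one]
  have hs : ∀ u : ℝ, Summable fun i => c i * Complex.exp (g i * u * Complex.I) := fun u =>
    Summable.of_norm (by simp_rw [hnorm]; exact hc)
  have hlim : Tendsto (fun T : Finset ι => ∫ u in a..L,
      ‖∑ i ∈ T, c i * Complex.exp (g i * u * Complex.I)‖ ^ 2 * Real.exp (2 * u)) atTop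
      (𝓝 (∫ u in a..L,
        ‖∑' i, c i * Complex.exp (g i * u * Complex.I)‖ ^ 2 * Real.exp (2 * u))) := by
    refine intervalIntegral.tendsto_integral_filter_of_dominated_convergence
      (fun _ => (∑' i, ‖c i‖) ^ 2 * Real.exp (2 * L)) ?_ ?_ (by simp) ?_
    · exact Eventually.of_forall fun T => (by fun_prop : Continuous _).aestronglyMeasurable
    · refine Eventually.of_forall fun T => Eventually.of_forall fun u hu => ?_
      rw [Set.uIoc_of_le haL] at hu
      rw [Real.norm_eq_abs, abs_of_nonneg (by positivity)]
      have h1 : ‖∑ i ∈ T, c i * Complex.exp (g i * u * Complex.I)‖ ≤ ∑' i, ‖c i‖ := by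
        refine (norm_sum_le _ _).trans ?_
        simp_rw [hnorm]
        exact hc.sum_le_tsum T fun _ _ => norm_nonneg _
      have h2 : Real.exp (2 * u) ≤ Real.exp (2 * L) := Real.exp_le_exp.2 (by linarith [hu.2])
      gcongr
    · refine Eventually.of_forall fun u _ => ?_
      exact (((hs u).hasSum.norm).pow 2).mul_const _
  exact le_of_tendsto' hlim fun T => intervalIntegral_normSq_finset_sum_exp_le T (hM T) haL

end MeanSquare

/-! ### Cramér's mean-square bound from difference quotients of the explicit formula. -/

lemma Complex.norm_exp_sub_one_le_mul {z : ℂ} {b : ℝ} (hb : 0 ≤ b) (hz : z.re ≤ b) :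
    ‖Complex.exp z - 1‖ ≤ Real.exp b * ‖z‖ := by
  have := Convex.norm_image_sub_le_of_norm_deriv_le (f := Complex.exp) (s := {z : ℂ | z.re ≤ b})
    (x := 0) (y := z) (C := Real.exp b) (fun w _ => Complex.differentiableAt_exp)
    (fun w hw => by
      rw [Complex.deriv_exp, Complex.norm_exp]; exact Real.exp_le_exp.2 hw)
    (convex_halfSpace_re_le b) (by simpa using hb) hz
  simpa using this

/-- The zeros of `(s - 1) ζ(s)` on the critical line. -/
abbrev LineZero : Type := {w : ZetaZero // (w : ℂ).re = 1 / 2}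

/-- By 2/(|v||w|) ≤ 1/|v|² + 1/|w|² and symmetry it suffices to weight by 1/|v|². The inner sum over
w is then O(|v|^(1/2)) by the density bound, leaving the convergent ∑ m|v|^(-3/2). -/
lemma RiemannHypothesis.exists_sum_sum_le (hRH : RiemannHypothesis) : ∃ A : ℝ, 0 ≤ A ∧
    ∀ T : Finset LineZero, ∑ v ∈ T, ∑ w ∈ T, zetaOrder v / ‖(v : ℂ)‖ * (zetaOrder w / ‖(w : ℂ)‖) *
      (4 / (4 + ((v : ℂ).im - (w : ℂ).im) ^ 2)) ≤ A := by
  obtain ⟨A, hA0, hA⟩ := hRH.exists_sum_div_le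
  set S := ∑' w : ZetaZero, zetaOrder w * ‖(w : ℂ)‖ ^ (-(3 / 2) : ℝ) with hS
  have hS0 : 0 ≤ S := tsum_nonneg fun w => mul_nonneg (zetaOrder_nonneg _) (by positivity)
  refine ⟨4 * A * 5 ^ (1 / 2 : ℝ) * S, by positivity, fun T => ?_⟩
  have hpos : ∀ v : LineZero, 0 < ‖(v : ℂ)‖ := fun v => v.1.norm_pos
  set m : LineZero → ℝ := fun v => zetaOrder v with hm
  have hm0 : ∀ v, 0 ≤ m v := fun v => zetaOrder_nonneg _
  set k : LineZero → LineZero → ℝ := fun v w => 1 / (1 + ((v : ℂ).im - (w : ℂ).im) ^ 2) with hk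
  have hk0 : ∀ v w, 0 ≤ k v w := fun v w => by simp only [hk]; positivity
  have hksymm : ∀ v w, k v w = k w v := fun v w => by
    simp only [hk]; rw [← neg_sq, neg_sub]
  have hinner : ∀ v : LineZero, ∑ w ∈ T, m w * k v w ≤ A * (2 + |(v : ℂ).im|) ^ (1 / 2 : ℝ) := by
    intro v
    have := hA (v : ℂ).im (T.map (Function.Embedding.subtype _)) (by
      intro w hw
      obtain ⟨w', -, rfl⟩ := Finset.mem_map.1 hw
      exact w'.2)
    rw [Finset.sum_map] at this
    refine le_trans (le_of_eq (Finset.sum_congr rfl fun w _ => ?_)) this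
    simp only [hm, hk, mul_one_div]; rfl
  have hterm : ∀ v w : LineZero, m v / ‖(v : ℂ)‖ * (m w / ‖(w : ℂ)‖) *
      (4 / (4 + ((v : ℂ).im - (w : ℂ).im) ^ 2))
      ≤ 2 * (m v / ‖(v : ℂ)‖ ^ 2 * (m w * k v w)) + 2 * (m w / ‖(w : ℂ)‖ ^ 2 * (m v * k w v)) := by
    intro v w
    have h1 : 4 / (4 + ((v : ℂ).im - (w : ℂ).im) ^ 2) ≤ 4 * k v w := by
      simp only [hk, mul_one_div]
      gcongr; norm_num
    have h2 : 2 * ((1 / ‖(v : ℂ)‖) * (1 / ‖(w : ℂ)‖)) ≤ 1 / ‖(v : ℂ)‖ ^ 2 + 1 / ‖(w : ℂ)‖ ^ 2 := by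
      have := two_mul_le_add_sq (1 / ‖(v : ℂ)‖) (1 / ‖(w : ℂ)‖)
      rw [div_pow, div_pow, one_pow] at this
      linarith
    rw [hksymm w v]
    have h3 : 0 ≤ m v * m w * k v w := mul_nonneg (mul_nonneg (hm0 v) (hm0 w)) (hk0 v w)
    have h4 : 0 ≤ m v / ‖(v : ℂ)‖ * (m w / ‖(w : ℂ)‖) :=
      mul_nonneg (div_nonneg (hm0 v) (hpos v).le) (div_nonneg (hm0 w) (hpos w).le)
    calc _ ≤ m v / ‖(v : ℂ)‖ * (m w / ‖(w : ℂ)‖) * (4 * k v w) := mul_le_mul_of_nonneg_left h1 h4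
      _ = 2 * (m v * m w * k v w) * (2 * ((1 / ‖(v : ℂ)‖) * (1 / ‖(w : ℂ)‖))) := by
          simp only [div_eq_mul_inv]; ring
      _ ≤ 2 * (m v * m w * k v w) * (1 / ‖(v : ℂ)‖ ^ 2 + 1 / ‖(w : ℂ)‖ ^ 2) := by gcongr
      _ = _ := by simp only [div_eq_mul_inv]; ring
  have hdiag : ∑ v ∈ T, ∑ w ∈ T, m v / ‖(v : ℂ)‖ ^ 2 * (m w * k v w) ≤ A * 5 ^ (1 / 2 : ℝ) * S := by
    calc _ = ∑ v ∈ T, m v / ‖(v : ℂ)‖ ^ 2 * ∑ w ∈ T, m w * k v w := by simp_rw [Finset.mul_sum]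
      _ ≤ ∑ v ∈ T, A * 5 ^ (1 / 2 : ℝ) * (m v * ‖(v : ℂ)‖ ^ (-(3 / 2) : ℝ)) := by
          refine Finset.sum_le_sum fun v _ => ?_
          have h1 : 2 + |(v : ℂ).im| ≤ 5 * ‖(v : ℂ)‖ := by
            have := hRH.norm_ge_half v.1
            have := Complex.abs_im_le_norm (v : ℂ)
            linarith
          have h2 : (2 + |(v : ℂ).im|) ^ (1 / 2 : ℝ) ≤ 5 ^ (1 / 2 : ℝ) * ‖(v : ℂ)‖ ^ (1 / 2 : ℝ) := by
            rw [← Real.mul_rpow (by norm_num) (hpos v).le]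
            exact Real.rpow_le_rpow (by positivity) h1 (by norm_num)
          have h3 : ‖(v : ℂ)‖ ^ (-(3 / 2) : ℝ) = ‖(v : ℂ)‖ ^ (1 / 2 : ℝ) / ‖(v : ℂ)‖ ^ 2 := by
            rw [show (-(3 / 2) : ℝ) = 1 / 2 - (2 : ℕ) by norm_num, Real.rpow_sub (hpos v),
              Real.rpow_natCast]
          rw [h3]
          calc _ ≤ m v / ‖(v : ℂ)‖ ^ 2 * (A * (5 ^ (1 / 2 : ℝ) * ‖(v : ℂ)‖ ^ (1 / 2 : ℝ))) := by
                have := hm0 v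
                refine mul_le_mul_of_nonneg_left ((hinner v).trans ?_) (by positivity)
                gcongr
            _ = _ := by ring
      _ = A * 5 ^ (1 / 2 : ℝ) * ∑ v ∈ T, m v * ‖(v : ℂ)‖ ^ (-(3 / 2) : ℝ) := by rw [Finset.mul_sum]
      _ ≤ A * 5 ^ (1 / 2 : ℝ) * S := by
          gcongr
          have := summable_zetaOrder_mul_rpow.sum_le_tsum (T.map (Function.Embedding.subtype _))
            (fun w _ => mul_nonneg (zetaOrder_nonneg _) (by positivity))
          rw [Finset.sum_map] at this
          exact this
  calc _ ≤ ∑ v ∈ T, ∑ w ∈ T, (2 * (m v / ‖(v : ℂ)‖ ^ 2 * (m w * k v w))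
        + 2 * (m w / ‖(w : ℂ)‖ ^ 2 * (m v * k w v))) :=
        Finset.sum_le_sum fun v _ => Finset.sum_le_sum fun w _ => hterm v w
    _ = 2 * (∑ v ∈ T, ∑ w ∈ T, m v / ‖(v : ℂ)‖ ^ 2 * (m w * k v w))
        + 2 * (∑ v ∈ T, ∑ w ∈ T, m v / ‖(v : ℂ)‖ ^ 2 * (m w * k v w)) := by
        simp_rw [Finset.sum_add_distrib]
        rw [Finset.sum_comm (f := fun v w => 2 * (m w / ‖(w : ℂ)‖ ^ 2 * (m v * k w v)))]
        simp only [Finset.mul_sum]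
    _ ≤ _ := by linarith

/-- Right continuity of ψ makes ψ the right derivative of its primitive at every x ≥ 0, jumps
included. -/
lemma continuousWithinAt_psi_Ici {x : ℝ} (hx : 0 ≤ x) :
    ContinuousWithinAt Chebyshev.psi (Set.Ici x) x := by
  refine (continuousWithinAt_const (b := Chebyshev.psi x)).congr_of_eventuallyEq ?_ rfl
  have h : Set.Iio ((⌊x⌋₊ : ℝ) + 1) ∈ 𝓝[≥] x :=
    mem_nhdsWithin_of_mem_nhds (Iio_mem_nhds (Nat.lt_floor_add_one x))
  filter_upwards [h, self_mem_nhdsWithin] with y hy hxy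
  rw [Chebyshev.psi_eq_psi_coe_floor y, Chebyshev.psi_eq_psi_coe_floor x]
  congr 2
  exact le_antisymm (Nat.lt_add_one_iff.1 ((Nat.floor_lt (hx.trans hxy)).2 (by exact_mod_cast hy)))
    (Nat.floor_mono hxy)

lemma hasDerivWithinAt_psiPrimitive {x : ℝ} (hx : 0 ≤ x) :
    HasDerivWithinAt psiPrimitive (Chebyshev.psi x) (Set.Ioi x) x := by
  have hs : StronglyMeasurableAtFilter Chebyshev.psi (𝓝[>] x) volume :=
    Chebyshev.psi_mono.measurable.stronglyMeasurable.stronglyMeasurableAtFilter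
  exact intervalIntegral.integral_hasDerivWithinAt_right (intervalIntegrable_psi 0 x)
    (s := Set.Ici x) hs ((continuousWithinAt_psi_Ici hx).mono Set.Ioi_subset_Ici_self) |>.mono
      Set.Ioi_subset_Ici_self

/-- The normalised difference quotient of the primitive of `ψ(x) - x` in the variable `log x`. -/
noncomputable def psiErrorSlope (h u : ℝ) : ℝ :=
  ((psiPrimitive (Real.exp (u + h)) - Real.exp (2 * (u + h)) / 2)
    - (psiPrimitive (Real.exp u) - Real.exp (2 * u) / 2)) / (h * Real.exp u)

lemma continuous_psiErrorSlope {h : ℝ} (hh : 0 < h) : Continuous (psiErrorSlope h) := by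
  have := continuous_psiPrimitive
  unfold psiErrorSlope
  refine Continuous.div (by fun_prop) (by fun_prop) fun u => by positivity

lemma tendsto_psiErrorSlope (u : ℝ) : Tendsto (fun n : ℕ => psiErrorSlope (1 / ((n : ℝ) + 1)) u)
    atTop (𝓝 (Chebyshev.psi (Real.exp u) - Real.exp u)) := by
  set e : ℝ → ℝ := fun u => psiPrimitive (Real.exp u) - Real.exp (2 * u) / 2 with he
  have hd : HasDerivWithinAt e (Chebyshev.psi (Real.exp u) * Real.exp u - Real.exp (2 * u))
      (Set.Ioi u) u := by
    have h1 : HasDerivWithinAt (fun u => psiPrimitive (Real.exp u))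
        (Chebyshev.psi (Real.exp u) * Real.exp u) (Set.Ioi u) u :=
      (hasDerivWithinAt_psiPrimitive (Real.exp_nonneg u)).comp u
        (Real.hasDerivAt_exp u).hasDerivWithinAt fun v hv => Real.exp_lt_exp.2 hv
    have h2 : HasDerivAt (fun u : ℝ => Real.exp (2 * u) / 2) (Real.exp (2 * u)) u := by
      have := (((hasDerivAt_id u).const_mul 2).exp).div_const 2
      simpa using this
    exact h1.sub h2.hasDerivWithinAt
  rw [hasDerivWithinAt_iff_tendsto_slope' (by simp)] at hd
  have hn : Tendsto (fun n : ℕ => u + 1 / ((n : ℝ) + 1)) atTop (𝓝[>] u) := by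
    refine tendsto_nhdsWithin_iff.2 ⟨?_, Eventually.of_forall fun n => ?_⟩
    · simpa using tendsto_one_div_add_atTop_nhds_zero_nat.const_add u
    · simp only [Set.mem_Ioi, lt_add_iff_pos_right]; positivity
  have h3 := (hd.comp hn).div_const (Real.exp u)
  have h4 : (Chebyshev.psi (Real.exp u) * Real.exp u - Real.exp (2 * u)) / Real.exp u
      = Chebyshev.psi (Real.exp u) - Real.exp u := by
    rw [two_mul, Real.exp_add]; field_simp
  rw [h4] at h3
  refine h3.congr fun n => ?_
  simp only [Function.comp, slope_def_field, psiErrorSlope, he, add_sub_cancel_left]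
  rw [div_div]

/-- A bound independent of h: it provides the dominating function when the step tends to 0. -/
lemma abs_psiErrorSlope_le {h u L : ℝ} (hh : 0 < h) (hh1 : h ≤ 1) (hu : u ≤ L) :
    |psiErrorSlope h u| ≤ Real.exp 1 * (Chebyshev.psi (Real.exp (L + 1)) + Real.exp (L + 1)) := by
  set x := Real.exp u with hx
  set y := Real.exp (u + h) with hy
  have hxy : x ≤ y := Real.exp_le_exp.2 (by linarith)
  have hyL : y ≤ Real.exp (L + 1) := Real.exp_le_exp.2 (by linarith)
  have hx0 : 0 < x := Real.exp_pos _
  have h1 : psiPrimitive y - psiPrimitive x = ∫ t in x..y, Chebyshev.psi t :=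
    intervalIntegral.integral_interval_sub_left (intervalIntegrable_psi _ _)
      (intervalIntegrable_psi _ _)
  have h2 : |psiPrimitive y - psiPrimitive x| ≤ Chebyshev.psi (Real.exp (L + 1)) * (y - x) := by
    rw [h1, ← Real.norm_eq_abs]
    refine (intervalIntegral.norm_integral_le_of_norm_le_const
      (C := Chebyshev.psi (Real.exp (L + 1))) fun t ht => ?_).trans
      (by rw [abs_of_nonneg (by linarith)])
    rw [Set.uIoc_of_le hxy] at ht
    rw [Real.norm_eq_abs, abs_of_nonneg (Chebyshev.psi_nonneg _)]
    exact Chebyshev.psi_mono (ht.2.trans hyL)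
  have h3 : |y ^ 2 / 2 - x ^ 2 / 2| ≤ Real.exp (L + 1) * (y - x) := by
    rw [show y ^ 2 / 2 - x ^ 2 / 2 = (y + x) / 2 * (y - x) by ring, abs_mul,
      abs_of_nonneg (by linarith : 0 ≤ y - x), abs_of_nonneg (by linarith)]
    gcongr; linarith
  have h4 : y - x ≤ Real.exp 1 * (h * x) := by
    have h5 := Complex.norm_exp_sub_one_le_mul (z := (h : ℂ)) zero_le_one (by simpa using hh1)
    rw [← Complex.ofReal_exp, ← Complex.ofReal_one, ← Complex.ofReal_sub, Complex.norm_real,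
      Complex.norm_real, Real.norm_eq_abs, Real.norm_eq_abs, abs_of_pos hh] at h5
    have h6 := (le_abs_self _).trans h5
    have h7 : y - x = (Real.exp h - 1) * x := by rw [hy, Real.exp_add]; ring
    rw [h7]; nlinarith
  have hp : 0 < h * x := by positivity
  have hψ := Chebyshev.psi_nonneg (Real.exp (L + 1))
  have e1 : Real.exp (2 * (u + h)) = y ^ 2 := by rw [hy, ← Real.exp_nat_mul]; norm_num
  have e2 : Real.exp (2 * u) = x ^ 2 := by rw [hx, ← Real.exp_nat_mul]; norm_num
  rw [psiErrorSlope, e1, e2, abs_div, abs_of_pos hp, div_le_iff₀ hp]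
  calc _ = |(psiPrimitive y - psiPrimitive x) - (y ^ 2 / 2 - x ^ 2 / 2)| := by congr 1; ring
    _ ≤ _ := abs_sub _ _
    _ ≤ (Chebyshev.psi (Real.exp (L + 1)) + Real.exp (L + 1)) * (y - x) := by linarith
    _ ≤ (Chebyshev.psi (Real.exp (L + 1)) + Real.exp (L + 1)) * (Real.exp 1 * (h * x)) := by
        gcongr
    _ = _ := by ring

/-- The increment of the exponential is O(|w + 1|h), which cancels the factor w + 1 in the
denominator. After division by h the coefficients are O(m/|w|), uniformly in h. -/
lemma RiemannHypothesis.norm_zeroTerm_le_mul (hRH : RiemannHypothesis) (w : ZetaZero) {h : ℝ}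
    (hh : 0 ≤ h) (hh1 : h ≤ 1) :
    ‖zeroTerm w h‖ ≤ Real.exp (3 / 2) * (zetaOrder w / ‖(w : ℂ)‖) * h := by
  have hw := w.norm_pos
  have hw1 : 0 < ‖(w : ℂ) + 1‖ := norm_pos_iff.2 (hRH.add_one_ne_zero w)
  have h1 : ‖Complex.exp (((w : ℂ) + 1) * h) - 1‖ ≤ Real.exp (3 / 2) * (‖(w : ℂ) + 1‖ * h) := by
    refine (Complex.norm_exp_sub_one_le_mul (b := 3 / 2) (by norm_num) ?_).trans (le_of_eq ?_)
    · rw [Complex.re_mul_ofReal, Complex.add_re, Complex.one_re]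
      have := hRH.re_le w
      nlinarith
    · rw [norm_mul, Complex.norm_real, Real.norm_eq_abs, abs_of_nonneg hh]
  rw [zeroTerm, norm_mul, norm_div, norm_mul, Complex.norm_real, Real.norm_eq_abs,
    abs_of_nonneg (zetaOrder_nonneg _)]
  calc _ ≤ zetaOrder w * (Real.exp (3 / 2) * (‖(w : ℂ) + 1‖ * h) / (‖(w : ℂ)‖ * ‖(w : ℂ) + 1‖)) := by
        have := zetaOrder_nonneg (w : ℂ)
        gcongr
    _ = _ := by field_simp

lemma zeroTerm_add_sub (w : ZetaZero) (u h : ℝ) : zeroTerm w (u + h) - zeroTerm w u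
    = Complex.exp (((w : ℂ) + 1) * u) * zeroTerm w h := by
  simp only [zeroTerm]
  have : Complex.exp (((w : ℂ) + 1) * ((u + h : ℝ) : ℂ))
      = Complex.exp (((w : ℂ) + 1) * u) * Complex.exp (((w : ℂ) + 1) * h) := by
    rw [← Complex.exp_add]; push_cast; ring_nf
  rw [this]; ring

lemma RiemannHypothesis.psiErrorSlope_eq (hRH : RiemannHypothesis) {h u : ℝ} (hh : 0 < h)
    (hu : 0 ≤ u) : (psiErrorSlope h u : ℂ)
      = -(1 + logDeriv riemannZeta₁ 0) * ((Complex.exp h - 1) / h)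
        - ∑' w : ZetaZero, Complex.exp (w * u) * (zeroTerm w h / h) := by
  have hhC : (h : ℂ) ≠ 0 := by exact_mod_cast hh.ne'
  have hexp : (Complex.exp u) ≠ 0 := Complex.exp_ne_zero _
  have hts : ∑' w, zeroTerm w (u + h) - ∑' w, zeroTerm w u
      = h * Complex.exp u * ∑' w : ZetaZero, Complex.exp (w * u) * (zeroTerm w h / h) := by
    rw [← (hRH.summable_zeroTerm (by linarith)).tsum_sub (hRH.summable_zeroTerm hu),
      ← tsum_mul_left]
    refine tsum_congr fun w => ?_
    rw [zeroTerm_add_sub, add_mul, one_mul, Complex.exp_add]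
    field_simp
  rw [psiErrorSlope]
  push_cast
  rw [hRH.psiPrimitive_exp_eq hu, hRH.psiPrimitive_exp_eq (by linarith : 0 ≤ u + h)]
  push_cast
  rw [div_eq_iff (mul_ne_zero hhC hexp), sub_mul, mul_comm (∑' w : ZetaZero, _) (_ * _), ← hts,
    Complex.exp_add (u : ℂ) (h : ℂ)]
  field_simp
  ring

/-- K collects everything bounded: the linear term of the explicit formula and the trivial zeros.
Under RH the critical zeros factor as exp(u/2) times a purely oscillating sum. -/
lemma RiemannHypothesis.exists_psiErrorSlope_sq_le (hRH : RiemannHypothesis) :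
    ∃ K : ℝ, 0 ≤ K ∧ ∀ h u : ℝ, 0 < h → h ≤ 1 → 1 ≤ u → psiErrorSlope h u ^ 2 ≤ 2 * K ^ 2
      + 2 * (Real.exp u * ‖∑' w : LineZero, zeroTerm w h / h
        * Complex.exp ((w : ℂ).im * u * Complex.I)‖ ^ 2) := by
  set B := logDeriv riemannZeta₁ 0 with hB
  set S := ∑' w : ZetaZero, zetaOrder w / ‖(w : ℂ)‖ ^ 2 with hS
  have hS0 : ∀ w : ZetaZero, 0 ≤ zetaOrder w / ‖(w : ℂ)‖ ^ 2 := fun w =>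
    div_nonneg (zetaOrder_nonneg _) (by positivity)
  have hSn : 0 ≤ S := tsum_nonneg hS0
  refine ⟨‖1 + B‖ * Real.exp 1 + Real.exp (3 / 2) * S, by positivity, fun h u hh hh1 hu => ?_⟩
  have hhC : ‖(h : ℂ)‖ = h := by rw [Complex.norm_real, Real.norm_eq_abs, abs_of_pos hh]
  set f : ZetaZero → ℂ := fun w => Complex.exp (w * u) * (zeroTerm w h / h) with hf
  have hcoef : ∀ w : ZetaZero, ‖zeroTerm w h / h‖ ≤ Real.exp (3 / 2) * (zetaOrder w / ‖(w : ℂ)‖) := by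
    intro w
    rw [norm_div, hhC, div_le_iff₀ hh]
    exact hRH.norm_zeroTerm_le_mul w hh.le hh1
  have hfs : Summable f := by
    refine Summable.of_norm_bounded (g := fun w => Real.exp (1 / 2 * u) * ‖zeroTerm w h / h‖)
      (((hRH.summable_zeroTerm hh.le).div_const _).norm.mul_left _) fun w => ?_
    rw [hf, norm_mul, Complex.norm_exp, Complex.re_mul_ofReal]
    have := hRH.re_le w
    gcongr
  set s : Set ZetaZero := {w | (w : ℂ).re = 1 / 2} with hs
  have hsplit := hfs.tsum_subtype_add_tsum_subtype_compl s
  have htriv : ‖∑' w : ↑sᶜ, f w‖ ≤ Real.exp (3 / 2) * S := by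
    have hb : ∀ w : ↑sᶜ, ‖f w‖ ≤ Real.exp (3 / 2) * (zetaOrder w / ‖(w : ℂ)‖ ^ 2) := by
      rintro ⟨w, hw⟩
      have hw0 := w.norm_pos
      obtain ⟨hre, him⟩ := (hRH.re_eq_or w).resolve_left hw
      have hnorm : ‖(w : ℂ)‖ = -(w : ℂ).re := by
        rw [Complex.abs_re_eq_norm.2 him |>.symm, abs_of_nonpos (by linarith)]
      -- Here u ≥ 1 enters: the decay exp(-|w|) supplies the missing power of |w|, so the trivial
      -- zeros sum like m/|w|².
      have he : Real.exp ((w : ℂ).re * u) ≤ 1 / ‖(w : ℂ)‖ := by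
        have h1 : ‖(w : ℂ)‖ ≤ Real.exp ‖(w : ℂ)‖ := by
          have := Real.add_one_le_exp ‖(w : ℂ)‖; linarith
        calc _ ≤ Real.exp (-‖(w : ℂ)‖) := Real.exp_le_exp.2 (by nlinarith)
          _ = 1 / Real.exp ‖(w : ℂ)‖ := by rw [Real.exp_neg, one_div]
          _ ≤ _ := one_div_le_one_div_of_le hw0 h1
      simp only [hf]
      rw [norm_mul, Complex.norm_exp, Complex.re_mul_ofReal]
      calc _ ≤ 1 / ‖(w : ℂ)‖ * (Real.exp (3 / 2) * (zetaOrder w / ‖(w : ℂ)‖)) :=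
            mul_le_mul he (hcoef w) (norm_nonneg _) (by positivity)
        _ = _ := by field_simp
    have hsum := (summable_zetaOrder_div_sq.mul_left (Real.exp (3 / 2)))
    refine (tsum_of_norm_bounded (hsum.subtype sᶜ).hasSum hb).trans ?_
    rw [hS, ← tsum_mul_left]
    exact hsum.tsum_subtype_le _ sᶜ fun w => mul_nonneg (Real.exp_nonneg _) (hS0 w)
  have hline : ∑' w : s, f w = Complex.exp (u / 2) *
      ∑' w : LineZero, zeroTerm w h / h * Complex.exp ((w : ℂ).im * u * Complex.I) := by
    rw [← tsum_mul_left]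
    refine tsum_congr fun w => ?_
    have hw : (w.1 : ℂ) = 1 / 2 + (w.1 : ℂ).im * Complex.I := by
      have : (w.1 : ℂ).re = 1 / 2 := w.2
      apply Complex.ext <;> simp [this]
    have : Complex.exp ((w.1 : ℂ) * u)
        = Complex.exp (u / 2) * Complex.exp ((w.1 : ℂ).im * u * Complex.I) := by
      rw [← Complex.exp_add]
      congr 1
      conv_lhs => rw [hw]
      ring
    simp only [hf]
    rw [this]; ring
  set Y := ∑' w : LineZero, zeroTerm w h / h * Complex.exp ((w : ℂ).im * u * Complex.I) with hY
  have hmain : |psiErrorSlope h u| ≤ (‖1 + B‖ * Real.exp 1 + Real.exp (3 / 2) * S)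
      + Real.exp (u / 2) * ‖Y‖ := by
    have h1 : |psiErrorSlope h u| = ‖(psiErrorSlope h u : ℂ)‖ := by
      rw [Complex.norm_real, Real.norm_eq_abs]
    rw [h1, hRH.psiErrorSlope_eq hh (by linarith), ← hB, ← hsplit, hline]
    have h2 : ‖-(1 + B) * ((Complex.exp h - 1) / h)‖ ≤ ‖1 + B‖ * Real.exp 1 := by
      rw [norm_mul, norm_neg, norm_div, hhC]
      have := Complex.norm_exp_sub_one_le_mul (z := (h : ℂ)) zero_le_one (by simpa using hh1)
      rw [hhC] at this
      gcongr
      rwa [div_le_iff₀ hh]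
    have h3 : ‖Complex.exp (u / 2) * Y‖ = Real.exp (u / 2) * ‖Y‖ := by
      rw [norm_mul, Complex.norm_exp]; congr 2; simp
    calc _ ≤ _ := norm_sub_le _ _
      _ ≤ ‖-(1 + B) * ((Complex.exp h - 1) / h)‖
          + (‖Complex.exp (u / 2) * Y‖ + ‖∑' w : ↑sᶜ, f w‖) := by
          gcongr; exact norm_add_le _ _
      _ ≤ _ := by rw [h3]; linarith
  have hsq : Real.exp u * ‖Y‖ ^ 2 = (Real.exp (u / 2) * ‖Y‖) ^ 2 := by
    rw [mul_pow, ← Real.exp_nat_mul]; congr 2; push_cast; ring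
  rw [hsq, ← sq_abs (psiErrorSlope h u)]
  set K := ‖1 + B‖ * Real.exp 1 + Real.exp (3 / 2) * S
  set T := Real.exp (u / 2) * ‖Y‖
  calc _ ≤ (K + T) ^ 2 := by gcongr
    _ ≤ _ := by nlinarith [sq_nonneg (K - T)]

lemma RiemannHypothesis.exists_integral_psiErrorSlope_sq_le (hRH : RiemannHypothesis) :
    ∃ C : ℝ, 0 ≤ C ∧ ∀ h L : ℝ, 0 < h → h ≤ 1 → 1 ≤ L →
      ∫ u in (1 : ℝ)..L, psiErrorSlope h u ^ 2 * Real.exp u ≤ C * Real.exp (2 * L) := by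
  obtain ⟨K, hK0, hK⟩ := hRH.exists_psiErrorSlope_sq_le
  obtain ⟨A, hA0, hA⟩ := hRH.exists_sum_sum_le
  refine ⟨2 * K ^ 2 + 2 * (Real.exp (3 / 2) ^ 2 * A), by positivity, fun h L hh hh1 hL => ?_⟩
  have hhC : ‖(h : ℂ)‖ = h := by rw [Complex.norm_real, Real.norm_eq_abs, abs_of_pos hh]
  set c : LineZero → ℂ := fun w => zeroTerm w h / h with hc
  set g : LineZero → ℝ := fun w => (w : ℂ).im with hg
  have hcoef : ∀ w : LineZero, ‖c w‖ ≤ Real.exp (3 / 2) * (zetaOrder w / ‖(w : ℂ)‖) := by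
    intro w
    rw [hc, norm_div, hhC, div_le_iff₀ hh]
    exact hRH.norm_zeroTerm_le_mul w hh.le hh1
  have hcs : Summable fun w => ‖c w‖ :=
    ((hRH.summable_zeroTerm hh.le).div_const _).norm.subtype {w : ZetaZero | (w : ℂ).re = 1 / 2}
  have hsum : ∀ T : Finset LineZero, ∑ v ∈ T, ∑ w ∈ T,
      ‖c v‖ * ‖c w‖ * (4 / (4 + (g v - g w) ^ 2)) ≤ Real.exp (3 / 2) ^ 2 * A := by
    intro T
    refine le_trans ?_ (mul_le_mul_of_nonneg_left (hA T) (by positivity))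
    rw [Finset.mul_sum]
    refine Finset.sum_le_sum fun v _ => ?_
    rw [Finset.mul_sum]
    refine Finset.sum_le_sum fun w _ => ?_
    have hk : 0 ≤ 4 / (4 + (g v - g w) ^ 2) := by positivity
    calc _ ≤ Real.exp (3 / 2) * (zetaOrder v / ‖(v : ℂ)‖) *
          (Real.exp (3 / 2) * (zetaOrder w / ‖(w : ℂ)‖)) * (4 / (4 + (g v - g w) ^ 2)) := by
          refine mul_le_mul_of_nonneg_right (mul_le_mul (hcoef v) (hcoef w) (norm_nonneg _) ?_) hk
          exact (norm_nonneg _).trans (hcoef v)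
      _ = _ := by ring
  have hms := intervalIntegral_normSq_tsum_exp_le hcs hsum hL
  have hcont : Continuous fun u : ℝ => ∑' w, c w * Complex.exp (g w * u * Complex.I) := by
    refine continuous_tsum (fun w => by fun_prop) hcs fun w u => ?_
    rw [norm_mul, show (g w * u * Complex.I : ℂ) = ((g w * u : ℝ) : ℂ) * Complex.I by push_cast; ring,
      Complex.norm_exp_ofReal_mul_I, mul_one]
  have hexp : ∫ u in (1 : ℝ)..L, 2 * K ^ 2 * Real.exp u ≤ 2 * K ^ 2 * Real.exp (2 * L) := by
    rw [intervalIntegral.integral_const_mul, integral_exp]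
    have h1 : Real.exp L ≤ Real.exp (2 * L) := Real.exp_le_exp.2 (by linarith)
    have h2 := Real.exp_pos 1
    gcongr; linarith
  have hps := continuous_psiErrorSlope hh
  calc _ ≤ ∫ u in (1 : ℝ)..L, (2 * K ^ 2 * Real.exp u
        + 2 * (‖∑' w, c w * Complex.exp (g w * u * Complex.I)‖ ^ 2 * Real.exp (2 * u))) := by
        refine intervalIntegral.integral_mono_on hL
          ((by fun_prop : Continuous _).intervalIntegrable _ _)
          ((by fun_prop : Continuous _).intervalIntegrable _ _) fun u hu => ?_
        refine (mul_le_mul_of_nonneg_right (hK h u hh hh1 hu.1) (Real.exp_nonneg u)).trans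
          (le_of_eq ?_)
        simp only [hc, hg]
        rw [two_mul u, Real.exp_add]; ring
    _ = (∫ u in (1 : ℝ)..L, 2 * K ^ 2 * Real.exp u) + 2 * ∫ u in (1 : ℝ)..L,
        ‖∑' w, c w * Complex.exp (g w * u * Complex.I)‖ ^ 2 * Real.exp (2 * u) := by
        rw [intervalIntegral.integral_add, intervalIntegral.integral_const_mul 2]
        · exact (by fun_prop : Continuous _).intervalIntegrable _ _
        · exact (by fun_prop : Continuous _).intervalIntegrable _ _
    _ ≤ _ := by linarith

lemma intervalIntegrable_psi_sub_id_sq (a b : ℝ) :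
    IntervalIntegrable (fun x => (Chebyshev.psi x - x) ^ 2) volume a b := by
  have h1 : IntervalIntegrable (fun x => Chebyshev.psi x ^ 2) volume a b :=
    Monotone.intervalIntegrable fun x y hxy =>
      pow_le_pow_left₀ (Chebyshev.psi_nonneg x) (Chebyshev.psi_mono hxy) 2
  have h2 : IntervalIntegrable (fun x => Chebyshev.psi x * (-(2 * x))) volume a b :=
    (intervalIntegrable_psi a b).mul_continuousOn (by fun_prop)
  have h3 : IntervalIntegrable (fun x : ℝ => x ^ 2) volume a b :=
    (by fun_prop : Continuous _).intervalIntegrable _ _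
  refine ((h1.add h2).add h3).congr fun x _ => ?_
  ring

/-- Cramér's mean-square estimate for `ψ(x) - x` under the Riemann hypothesis. -/
lemma RiemannHypothesis.exists_integral_psi_sub_id_sq_le (hRH : RiemannHypothesis) :
    ∃ C : ℝ, 0 ≤ C ∧ ∀ X : ℝ, 1 ≤ X → ∫ x in (0 : ℝ)..X, (Chebyshev.psi x - x) ^ 2 ≤ C * X ^ 2 := by
  obtain ⟨C, hC0, hC⟩ := hRH.exists_integral_psiErrorSlope_sq_le
  have hlog : ∀ L : ℝ, 1 ≤ L → ∫ u in (1 : ℝ)..L,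
      (Chebyshev.psi (Real.exp u) - Real.exp u) ^ 2 * Real.exp u ≤ C * Real.exp (2 * L) := by
    intro L hL
    have hn1 : ∀ n : ℕ, 1 / ((n : ℝ) + 1) ≤ 1 := fun n => by
      rw [div_le_one (by positivity)]; linarith [n.cast_nonneg (α := ℝ)]
    have hn0 : ∀ n : ℕ, 0 < 1 / ((n : ℝ) + 1) := fun n => by positivity
    have hlim : Tendsto (fun n : ℕ => ∫ u in (1 : ℝ)..L,
        psiErrorSlope (1 / ((n : ℝ) + 1)) u ^ 2 * Real.exp u) atTop (𝓝 (∫ u in (1 : ℝ)..L,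
        (Chebyshev.psi (Real.exp u) - Real.exp u) ^ 2 * Real.exp u)) := by
      refine intervalIntegral.tendsto_integral_filter_of_dominated_convergence
        (fun u => (Real.exp 1 * (Chebyshev.psi (Real.exp (L + 1)) + Real.exp (L + 1))) ^ 2
          * Real.exp L) ?_ ?_ (by simp) ?_
      · refine Eventually.of_forall fun n => ?_
        have := continuous_psiErrorSlope (hn0 n)
        exact (by fun_prop : Continuous _).aestronglyMeasurable
      · refine Eventually.of_forall fun n => Eventually.of_forall fun u hu => ?_
        rw [Set.uIoc_of_le hL] at hu
        have h1 := abs_psiErrorSlope_le (hn0 n) (hn1 n) hu.2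
        have h2 : Real.exp u ≤ Real.exp L := Real.exp_le_exp.2 hu.2
        rw [Real.norm_eq_abs, abs_mul, abs_pow, abs_of_pos (Real.exp_pos u)]
        gcongr
      · exact Eventually.of_forall fun u _ => ((tendsto_psiErrorSlope u).pow 2).mul_const _
    exact le_of_tendsto' hlim fun n => hC _ L (hn0 n) (hn1 n) hL
  -- The slope estimate starts at u = 1, so the range [0, e] is absorbed as a constant.
  set D := ∫ x in (0 : ℝ)..Real.exp 1, (Chebyshev.psi x - x) ^ 2 with hD
  have hD0 : 0 ≤ D := intervalIntegral.integral_nonneg (Real.exp_nonneg _) fun _ _ => sq_nonneg _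
  refine ⟨D + C, by positivity, fun X hX => ?_⟩
  have hX2 : 1 ≤ X ^ 2 := one_le_pow₀ hX
  rcases le_total X (Real.exp 1) with h | h
  · have h1 : ∫ x in (0 : ℝ)..X, (Chebyshev.psi x - x) ^ 2 ≤ D :=
      intervalIntegral.integral_mono_interval le_rfl (by linarith) h
        (Eventually.of_forall fun _ => sq_nonneg _) (intervalIntegrable_psi_sub_id_sq _ _)
    nlinarith
  · have hL : 1 ≤ Real.log X := (Real.le_log_iff_exp_le (by linarith)).2 h
    have hsub := intervalIntegral.integral_comp_mul_deriv_of_deriv_nonneg (a := 1) (b := Real.log X)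
      (f := Real.exp) (f' := Real.exp) (g := fun x => (Chebyshev.psi x - x) ^ 2)
      Real.continuous_exp.continuousOn (fun x _ => Real.hasDerivAt_exp x)
      (fun x _ => Real.exp_nonneg x)
    rw [Real.exp_log (by linarith)] at hsub
    have h2 := hlog _ hL
    have h3 : Real.exp (2 * Real.log X) = X ^ 2 := by
      rw [mul_comm, Real.exp_mul, Real.exp_log (by linarith)]; norm_num
    rw [h3] at h2
    rw [← intervalIntegral.integral_add_adjacent_intervals
      (intervalIntegrable_psi_sub_id_sq 0 (Real.exp 1)) (intervalIntegrable_psi_sub_id_sq _ X),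
      ← hsub]
    simp only [Function.comp]
    nlinarith

/-! ### The Goldbach sum as a convolution integral of ψ. -/

lemma sum_mul_goldbachR2_eq (N : ℕ) : ∑ n ∈ Finset.Icc 1 N, ((N : ℝ) - n) * goldbachR2 n
    = ∑ k ∈ Finset.Icc 1 N, ∑ m ∈ Finset.Icc 1 N, ArithmeticFunction.vonMangoldt k *
      (ArithmeticFunction.vonMangoldt m * max ((N : ℝ) - k - m) 0) := by
  set F : ℕ × ℕ → ℝ := fun p => ArithmeticFunction.vonMangoldt p.1 *
    (ArithmeticFunction.vonMangoldt p.2 * max ((N : ℝ) - p.1 - p.2) 0) with hF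
  rw [← Finset.sum_product' (f := fun k m => F (k, m))]
  set s := (Finset.Icc 1 N ×ˢ Finset.Icc 1 N) with hs
  have h1 : ∑ p ∈ s, F p = ∑ p ∈ s with p.1 + p.2 ≤ N, F p := by
    refine (Finset.sum_filter_of_ne fun p _ hp => ?_).symm
    by_contra hlt
    refine hp ?_
    have : (N : ℝ) < p.1 + p.2 := by exact_mod_cast not_le.1 hlt
    simp only [hF]
    rw [max_eq_right (by linarith), mul_zero, mul_zero]
  change _ = ∑ p ∈ s, F p
  rw [h1, ← Finset.sum_fiberwise_of_maps_to (t := Finset.Icc 1 N) (g := fun p : ℕ × ℕ => p.1 + p.2)]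
  · refine Finset.sum_congr rfl fun n hn => ?_
    rw [Finset.mem_Icc] at hn
    rw [goldbachR2, Finset.mul_sum]
    symm
    have hsub : Finset.filter (fun p => p.1 + p.2 = n) (Finset.filter (fun p => p.1 + p.2 ≤ N) s)
        ⊆ Finset.HasAntidiagonal.antidiagonal n := by
      intro p hp
      simp only [Finset.mem_filter] at hp
      exact Finset.HasAntidiagonal.mem_antidiagonal.2 hp.2
    have hval : ∀ p ∈ Finset.HasAntidiagonal.antidiagonal n, ((N : ℝ) - n) *
        (ArithmeticFunction.vonMangoldt p.1 * ArithmeticFunction.vonMangoldt p.2) = F p := by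
      intro p hp
      have hp' : (p.1 : ℝ) + p.2 = n := by exact_mod_cast Finset.HasAntidiagonal.mem_antidiagonal.1 hp
      have hnN : (n : ℝ) ≤ N := by exact_mod_cast hn.2
      simp only [hF]
      rw [max_eq_left (by linarith), ← hp']; ring
    rw [Finset.sum_congr rfl hval]
    refine Finset.sum_subset hsub fun p hp hnot => ?_
    have hp' := Finset.HasAntidiagonal.mem_antidiagonal.1 hp
    -- The antidiagonal has exactly these pairs beyond the square [1, N]², and they vanish since
    -- Λ(0) = 0.
    have : p.1 = 0 ∨ p.2 = 0 := by
      by_contra hne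
      push Not at hne
      refine hnot ?_
      simp only [hs, Finset.mem_filter, Finset.mem_product, Finset.mem_Icc]
      omega
    rcases this with h | h <;> simp [hF, h]
  · intro p hp
    simp only [hs, Finset.mem_filter, Finset.mem_product, Finset.mem_Icc] at hp ⊢
    omega

lemma intervalIntegral_psi_mul_indicator {a x : ℝ} (ha : 0 ≤ a) (hax : a ≤ x) :
    IntervalIntegrable (fun t => Chebyshev.psi t * (Set.Ici a).indicator 1 (x - t)) volume 0 x ∧
    ∫ t in (0 : ℝ)..x, Chebyshev.psi t * (Set.Ici a).indicator 1 (x - t)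
      = psiPrimitive (x - a) := by
  set f : ℝ → ℝ := fun t => Chebyshev.psi t * (Set.Ici a).indicator 1 (x - t) with hf
  have e1 : Set.EqOn Chebyshev.psi f (Set.uIoc 0 (x - a)) := fun t ht => by
    rw [Set.uIoc_of_le (by linarith)] at ht
    have : a ≤ x - t := by linarith [ht.2]
    simp [hf, this]
  have e2 : Set.EqOn (fun _ => (0 : ℝ)) f (Set.uIoc (x - a) x) := fun t ht => by
    rw [Set.uIoc_of_le (by linarith)] at ht
    have : ¬ a ≤ x - t := by linarith [ht.1]
    simp [hf, this]
  have i1 : IntervalIntegrable f volume 0 (x - a) := (intervalIntegrable_psi _ _).congr e1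
  have i2 : IntervalIntegrable f volume (x - a) x := intervalIntegrable_const.congr e2
  refine ⟨i1.trans i2, ?_⟩
  rw [← intervalIntegral.integral_add_adjacent_intervals i1 i2,
    ← intervalIntegral.integral_congr_ae (Eventually.of_forall e1),
    ← intervalIntegral.integral_congr_ae (Eventually.of_forall e2)]
  simp [psiPrimitive]

lemma integral_psi_mul_psi_sub (N : ℕ) : ∫ t in (0 : ℝ)..N, Chebyshev.psi t * Chebyshev.psi (N - t)
    = ∑ n ∈ Finset.Icc 1 N, ((N : ℝ) - n) * goldbachR2 n := by
  have hN : (0 : ℝ) ≤ N := N.cast_nonneg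
  have h1 : ∫ t in (0 : ℝ)..N, Chebyshev.psi t * Chebyshev.psi (N - t)
      = ∫ t in (0 : ℝ)..N, ∑ k ∈ Finset.Icc 1 N, ArithmeticFunction.vonMangoldt k *
        (Chebyshev.psi t * (Set.Ici (k : ℝ)).indicator 1 (N - t)) := by
    refine intervalIntegral.integral_congr fun t ht => ?_
    rw [Set.uIcc_of_le hN] at ht
    rw [psi_eq_sum_ite (M := N) (t := N - t) (by linarith [ht.1]), Finset.mul_sum]
    exact Finset.sum_congr rfl fun k _ => by ring
  have hk : ∀ k ∈ Finset.Icc 1 N, (k : ℝ) ≤ N := fun k hk => by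
    exact_mod_cast (Finset.mem_Icc.1 hk).2
  rw [h1, intervalIntegral.integral_finsetSum fun k hk' =>
    (intervalIntegral_psi_mul_indicator k.cast_nonneg (hk k hk')).1.const_mul _,
    sum_mul_goldbachR2_eq]
  refine Finset.sum_congr rfl fun k hk' => ?_
  have := hk k hk'
  rw [intervalIntegral.integral_const_mul,
    (intervalIntegral_psi_mul_indicator k.cast_nonneg this).2, ← Finset.mul_sum,
    psiPrimitive_eq_sum (M := N) (by linarith) (by linarith [k.cast_nonneg (α := ℝ)])]

/-- Integration by parts in the one-sided form, since ψ is only the right derivative of its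
primitive at the jumps. -/
lemma integral_sub_mul_psi {x : ℝ} (hx : 0 ≤ x) :
    ∫ t in (0 : ℝ)..x, (x - t) * Chebyshev.psi t = ∫ t in (0 : ℝ)..x, psiPrimitive t := by
  have := intervalIntegral.integral_mul_deriv_eq_deriv_mul_of_hasDeriv_right (a := 0) (b := x)
    (u := fun t => x - t) (v := psiPrimitive) (u' := fun _ => -1) (v' := Chebyshev.psi)
    (by fun_prop) continuous_psiPrimitive.continuousOn
    (fun t _ => ((hasDerivAt_id t).const_sub x).hasDerivWithinAt)
    (fun t ht => hasDerivWithinAt_psiPrimitive (by rw [min_eq_left hx] at ht; exact ht.1.le))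
    (by simp) (intervalIntegrable_psi _ _)
  rw [this]
  simp [psiPrimitive]

lemma intervalIntegrable_psi_comp_sub (c a b : ℝ) :
    IntervalIntegrable (fun t => Chebyshev.psi (c - t)) volume a b :=
  Antitone.intervalIntegrable fun _ _ hst => Chebyshev.psi_mono (by linarith)

/-- Expand the product of the errors: the two cross terms agree under t ↦ x - t and each is the
integral of `psiPrimitive`, while ∫ t(x - t) gives x³/6. -/
lemma integral_psi_mul_psi_sub_eq {x : ℝ} (hx : 0 ≤ x) :
    ∫ t in (0 : ℝ)..x, Chebyshev.psi t * Chebyshev.psi (x - t)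
      = 2 * (∫ t in (0 : ℝ)..x, psiPrimitive t) - x ^ 3 / 6
        + ∫ t in (0 : ℝ)..x, (Chebyshev.psi t - t) * (Chebyshev.psi (x - t) - (x - t)) := by
  have i1 : IntervalIntegrable (fun t => (x - t) * Chebyshev.psi t) volume 0 x :=
    (intervalIntegrable_psi 0 x).continuousOn_mul (by fun_prop)
  have i2 : IntervalIntegrable (fun t => t * Chebyshev.psi (x - t)) volume 0 x :=
    (intervalIntegrable_psi_comp_sub x 0 x).continuousOn_mul (by fun_prop)
  have i3 : IntervalIntegrable (fun t : ℝ => t * (x - t)) volume 0 x :=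
    (by fun_prop : Continuous _).intervalIntegrable _ _
  have i4 : IntervalIntegrable (fun t => Chebyshev.psi t * Chebyshev.psi (x - t)) volume 0 x := by
    refine intervalIntegrable_iff.2 (Integrable.mul_bdd (c := Chebyshev.psi x)
      (intervalIntegrable_iff.1 (intervalIntegrable_psi 0 x)) ?_ ?_)
    · exact (Chebyshev.psi_mono.measurable.comp (by fun_prop)).aestronglyMeasurable
    · refine (ae_restrict_iff' measurableSet_uIoc).2 (Eventually.of_forall fun t ht => ?_)
      rw [Set.uIoc_of_le hx] at ht
      rw [Real.norm_eq_abs, abs_of_nonneg (Chebyshev.psi_nonneg _)]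
      exact Chebyshev.psi_mono (by linarith [ht.1])
  have h1 : ∫ t in (0 : ℝ)..x, (Chebyshev.psi t - t) * (Chebyshev.psi (x - t) - (x - t))
      = ∫ t in (0 : ℝ)..x, (Chebyshev.psi t * Chebyshev.psi (x - t) - (x - t) * Chebyshev.psi t
        - t * Chebyshev.psi (x - t) + t * (x - t)) :=
    intervalIntegral.integral_congr fun t _ => by ring
  have h2 : ∫ t in (0 : ℝ)..x, t * Chebyshev.psi (x - t)
      = ∫ t in (0 : ℝ)..x, (x - t) * Chebyshev.psi t := by
    have := intervalIntegral.integral_comp_sub_left (a := 0) (b := x)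
      (fun t => (x - t) * Chebyshev.psi t) x
    simpa using this
  have h3 : ∫ t in (0 : ℝ)..x, t * (x - t) = x ^ 3 / 6 := by
    have : ∀ t : ℝ, t * (x - t) = x * t - t ^ 2 := fun t => by ring
    simp_rw [this]
    rw [intervalIntegral.integral_sub
      ((by fun_prop : Continuous _).intervalIntegrable _ _)
      ((by fun_prop : Continuous _).intervalIntegrable _ _), intervalIntegral.integral_const_mul,
      integral_id, integral_pow]
    norm_num; ring
  rw [h1, intervalIntegral.integral_add ((i4.sub i1).sub i2) i3,
    intervalIntegral.integral_sub (i4.sub i1) i2, intervalIntegral.integral_sub i4 i1, h2, h3,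
    integral_sub_mul_psi hx]
  ring

/-- From 2|ab| ≤ a² + b², the reflection t ↦ x - t identifying the two square integrals. -/
lemma abs_integral_psi_error_mul_le {x : ℝ} (hx : 0 ≤ x) :
    |∫ t in (0 : ℝ)..x, (Chebyshev.psi t - t) * (Chebyshev.psi (x - t) - (x - t))|
      ≤ ∫ t in (0 : ℝ)..x, (Chebyshev.psi t - t) ^ 2 := by
  have i1 := intervalIntegrable_psi_sub_id_sq 0 x
  have i2 : IntervalIntegrable (fun t => (Chebyshev.psi (x - t) - (x - t)) ^ 2) volume 0 x := by
    have := (intervalIntegrable_psi_sub_id_sq x 0).comp_sub_left x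
    simpa using this
  have h2 : ∫ t in (0 : ℝ)..x, (Chebyshev.psi (x - t) - (x - t)) ^ 2
      = ∫ t in (0 : ℝ)..x, (Chebyshev.psi t - t) ^ 2 := by
    have := intervalIntegral.integral_comp_sub_left (a := 0) (b := x)
      (fun t => (Chebyshev.psi t - t) ^ 2) x
    simpa using this
  have h3 := intervalIntegral.norm_integral_le_of_norm_le (μ := volume) hx
    (f := fun t => (Chebyshev.psi t - t) * (Chebyshev.psi (x - t) - (x - t)))
    (g := fun t => (1 / 2) * (Chebyshev.psi t - t) ^ 2
      + (1 / 2) * (Chebyshev.psi (x - t) - (x - t)) ^ 2)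
    (Eventually.of_forall fun t _ => by
      rw [Real.norm_eq_abs, abs_mul, ← sq_abs (Chebyshev.psi t - t),
        ← sq_abs (Chebyshev.psi (x - t) - (x - t))]
      nlinarith [sq_nonneg (|Chebyshev.psi t - t| - |Chebyshev.psi (x - t) - (x - t)|)])
    ((i1.const_mul _).add (i2.const_mul _))
  rw [intervalIntegral.integral_add (i1.const_mul _) (i2.const_mul _),
    intervalIntegral.integral_const_mul, intervalIntegral.integral_const_mul, h2,
    Real.norm_eq_abs] at h3
  linarith

/-! ### The integrated explicit formula over the critical zeros. -/

lemma RiemannHypothesis.norm_zeroTerm_log_le_of_re_ne (hRH : RiemannHypothesis) {w : ZetaZero}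
    (hw : (w : ℂ).re ≠ 1 / 2) {u : ℝ} (hu : 0 ≤ u) :
    ‖zeroTerm w u‖ ≤ 4 * (zetaOrder w / ‖(w : ℂ)‖ ^ 2) := by
  have hw0 := w.norm_pos
  have hre := ((hRH.re_eq_or w).resolve_left hw).1
  have h1 := hRH.norm_le_two_mul_norm_add_one w
  have h2 : ‖Complex.exp (((w : ℂ) + 1) * u) - 1‖ ≤ 2 := by
    refine (norm_sub_le _ _).trans ?_
    rw [Complex.norm_exp, norm_one, Complex.re_mul_ofReal, Complex.add_re, Complex.one_re]
    have : Real.exp (((w : ℂ).re + 1) * u) ≤ 1 := Real.exp_le_one_iff.2 (by nlinarith)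
    linarith
  rw [zeroTerm, norm_mul, norm_div, norm_mul, Complex.norm_real, Real.norm_eq_abs,
    abs_of_nonneg (zetaOrder_nonneg _)]
  have h3 : 1 / ‖(w : ℂ) + 1‖ ≤ 2 / ‖(w : ℂ)‖ := by
    rw [div_le_div_iff₀ (by linarith) hw0]; linarith
  have h0 := zetaOrder_nonneg (w : ℂ)
  calc _ ≤ zetaOrder w * (2 / (‖(w : ℂ)‖ * ‖(w : ℂ) + 1‖)) := by gcongr
    _ = 2 * (zetaOrder w / ‖(w : ℂ)‖) * (1 / ‖(w : ℂ) + 1‖) := by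
        simp only [div_eq_mul_inv, mul_inv]; ring
    _ ≤ 2 * (zetaOrder w / ‖(w : ℂ)‖) * (2 / ‖(w : ℂ)‖) := by gcongr
    _ = _ := by field_simp; ring

lemma summable_lineZero_div_sq :
    Summable fun w : LineZero => zetaOrder w / ‖(w : ℂ)‖ ^ 2 :=
  summable_zetaOrder_div_sq.subtype {w : ZetaZero | (w : ℂ).re = 1 / 2}

/-- Trivial zeros have Re(w + 1) ≤ -1, so together they contribute O(1); the linear term of the
explicit formula is the whole O(x). -/
lemma RiemannHypothesis.exists_norm_psiPrimitive_sub_add_le (hRH : RiemannHypothesis) :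
    ∃ C : ℝ, 0 ≤ C ∧ ∀ x : ℝ, 1 ≤ x →
      ‖(psiPrimitive x : ℂ) - x ^ 2 / 2 + ∑' w : LineZero, zeroTerm w (Real.log x)‖ ≤ C * x := by
  set B := logDeriv riemannZeta₁ 0 with hB
  set S := ∑' w : ZetaZero, zetaOrder w / ‖(w : ℂ)‖ ^ 2 with hS
  have hS0 : ∀ w : ZetaZero, 0 ≤ zetaOrder w / ‖(w : ℂ)‖ ^ 2 := fun w =>
    div_nonneg (zetaOrder_nonneg _) (by positivity)
  have hSn : 0 ≤ S := tsum_nonneg hS0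
  refine ⟨1 + ‖1 + B‖ + 4 * S, by positivity, fun x hx => ?_⟩
  have hx0 : 0 < x := by linarith
  have hu := Real.log_nonneg hx
  have hex := hRH.psiPrimitive_exp_eq hu
  have e1 : Complex.exp (Real.log x) = x := by rw [← Complex.ofReal_exp, Real.exp_log hx0]
  have e2 : Complex.exp (2 * Real.log x) = x ^ 2 := by
    rw [← e1, ← Complex.exp_nat_mul]; norm_num
  rw [Real.exp_log hx0, e1, e2, ← hB] at hex
  set s : Set ZetaZero := {w | (w : ℂ).re = 1 / 2} with hs
  have hsplit : (∑' w : LineZero, zeroTerm w (Real.log x)) + ∑' w : ↑sᶜ, zeroTerm w (Real.log x)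
      = _ := (hRH.summable_zeroTerm hu).tsum_subtype_add_tsum_subtype_compl s
  have htriv : ‖∑' w : ↑sᶜ, zeroTerm w (Real.log x)‖ ≤ 4 * S := by
    have hsum := summable_zetaOrder_div_sq.mul_left 4
    refine (tsum_of_norm_bounded (hsum.subtype sᶜ).hasSum fun w =>
      hRH.norm_zeroTerm_log_le_of_re_ne w.2 hu).trans ?_
    rw [hS, ← tsum_mul_left]
    exact hsum.tsum_subtype_le _ sᶜ fun w => mul_nonneg (by norm_num) (hS0 w)
  have hform : (psiPrimitive x : ℂ) - x ^ 2 / 2 + ∑' w : LineZero, zeroTerm w (Real.log x)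
      = -(1 / 2) - (1 + B) * ((x - 1 : ℝ) : ℂ) - ∑' w : ↑sᶜ, zeroTerm w (Real.log x) := by
    rw [hex, ← hsplit]; push_cast; ring
  have hn1 : ‖(1 + B) * ((x - 1 : ℝ) : ℂ)‖ = ‖1 + B‖ * (x - 1) := by
    rw [norm_mul, Complex.norm_real, Real.norm_eq_abs, abs_of_nonneg (by linarith)]
  rw [hform]
  have hhalf : ‖(-(1 / 2) : ℂ)‖ ≤ 1 := by norm_num
  have hB0 := norm_nonneg (1 + B)
  calc _ ≤ ‖(-(1 / 2) : ℂ)‖ + ‖(1 + B) * ((x - 1 : ℝ) : ℂ)‖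
        + ‖∑' w : ↑sᶜ, zeroTerm w (Real.log x)‖ :=
        (norm_sub_le _ _).trans (add_le_add_left (norm_sub_le _ _) _)
    _ ≤ _ := by rw [hn1]; nlinarith

lemma zeroTerm_log (w : ZetaZero) {x : ℝ} (hx : 0 < x) :
    zeroTerm w (Real.log x) = zetaOrder w * (((x : ℂ) ^ ((w : ℂ) + 1) - 1) / (w * (w + 1))) := by
  have hx' : (x : ℂ) ≠ 0 := by exact_mod_cast hx.ne'
  rw [zeroTerm, Complex.cpow_def_of_ne_zero hx', ← Complex.ofReal_log hx.le, mul_comm (_ + _)]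

lemma LineZero.re_eq (w : LineZero) : (w : ℂ).re = 1 / 2 := w.2

lemma LineZero.add_two_ne_zero (w : LineZero) : (w : ℂ) + 2 ≠ 0 := by
  intro h
  have := congrArg Complex.re h
  rw [Complex.add_re, w.re_eq] at this
  norm_num at this

lemma LineZero.one_le_norm_add_two (w : LineZero) : 1 ≤ ‖(w : ℂ) + 2‖ := by
  refine le_trans ?_ (Complex.re_le_norm _)
  rw [Complex.add_re, w.re_eq]; norm_num

lemma integral_zeroTerm_log (w : LineZero) {x : ℝ} (hx : 1 ≤ x) :
    ∫ t in (1 : ℝ)..x, zeroTerm w (Real.log t) = zetaOrder w *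
      ((((x : ℂ) ^ ((w : ℂ) + 2) - 1) / (w + 2) - ((x : ℂ) - 1)) / (w * (w + 1))) := by
  have hre : -1 < ((w : ℂ) + 1).re := by rw [Complex.add_re, w.re_eq]; norm_num
  have h1 : ∫ t in (1 : ℝ)..x, zeroTerm w (Real.log t) = ∫ t in (1 : ℝ)..x,
      zetaOrder w * (((t : ℂ) ^ ((w : ℂ) + 1) - 1) / (w * (w + 1))) := by
    refine intervalIntegral.integral_congr fun t ht => ?_
    rw [Set.uIcc_of_le hx] at ht
    exact zeroTerm_log _ (by linarith [ht.1])
  rw [h1, intervalIntegral.integral_const_mul, intervalIntegral.integral_div,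
    intervalIntegral.integral_sub (intervalIntegral.intervalIntegrable_cpow' hre) (by simp),
    integral_cpow (Or.inl hre)]
  rw [show (w : ℂ) + 1 + 1 = w + 2 by ring]
  simp

lemma RiemannHypothesis.hasSum_integral_zeroTerm_log (hRH : RiemannHypothesis) {x : ℝ} (hx : 1 ≤ x) :
    IntervalIntegrable (fun t => ∑' w : LineZero, zeroTerm w (Real.log t)) volume 1 x ∧
    HasSum (fun w : LineZero => ∫ t in (1 : ℝ)..x, zeroTerm w (Real.log t))
      (∫ t in (1 : ℝ)..x, ∑' w : LineZero, zeroTerm w (Real.log t)) := by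
  set b : LineZero → ℝ := fun w =>
    4 * (zetaOrder w / ‖(w : ℂ)‖ ^ 2) * Real.exp (3 / 2 * Real.log x) with hb
  have hbs : Summable b := (summable_lineZero_div_sq.mul_left 4).mul_right _
  have hle : ∀ (w : LineZero) (t : ℝ), t ∈ Set.Icc 1 x → ‖zeroTerm w (Real.log t)‖ ≤ b w := by
    intro w t ht
    refine (hRH.norm_zeroTerm_le w (Real.log_nonneg ht.1)).trans ?_
    have h1 : Real.log t ≤ Real.log x := Real.log_le_log (by linarith [ht.1]) ht.2
    have h2 := zetaOrder_nonneg (w : ℂ)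
    simp only [hb]
    gcongr
  have hct : ∀ w : LineZero, ContinuousOn (fun t => zeroTerm w (Real.log t)) (Set.Icc 1 x) := by
    intro w
    have h1 : ContinuousOn Real.log (Set.Icc 1 x) :=
      Real.continuousOn_log.mono fun t ht => (by
        rw [Set.mem_compl_iff, Set.mem_singleton_iff]; rintro rfl; linarith [ht.1])
    have h2 : Continuous (zeroTerm w) := by unfold zeroTerm; fun_prop
    exact h2.comp_continuousOn h1
  constructor
  · refine ContinuousOn.intervalIntegrable ?_
    rw [Set.uIcc_of_le hx]
    exact continuousOn_tsum hct hbs hle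
  · refine intervalIntegral.hasSum_integral_of_dominated_convergence (fun w _ => b w) ?_ ?_ ?_ ?_ ?_
    · intro w
      rw [Set.uIoc_of_le hx]
      exact ((hct w).mono Set.Ioc_subset_Icc_self).aestronglyMeasurable measurableSet_Ioc
    · intro w
      refine Eventually.of_forall fun t ht => ?_
      rw [Set.uIoc_of_le hx] at ht
      exact hle w t (Set.Ioc_subset_Icc_self ht)
    · exact Eventually.of_forall fun t _ => hbs
    · simp
    · refine Eventually.of_forall fun t ht => ?_
      rw [Set.uIoc_of_le hx] at ht
      exact (Summable.of_norm_bounded hbs fun w => hle w t (Set.Ioc_subset_Icc_self ht)).hasSum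

lemma cesaroZeroTerm_lineZero (N : ℕ) (w : LineZero) : cesaroZeroTerm N w
    = zetaOrder w * ((N : ℂ) ^ ((w : ℂ) + 1) / (w * (w + 1) * (w + 2))) := by
  have : (analyticOrderNatAt riemannZeta w : ℂ) = (zetaOrder w : ℂ) := by
    rw [← analyticOrderNatAt_riemannZeta_eq w.1.ne_one, Complex.ofReal_natCast]
  rw [cesaroZeroTerm, this]

lemma RiemannHypothesis.one_div_norm_mul_le (hRH : RiemannHypothesis) (w : ZetaZero) :
    1 / (‖(w : ℂ)‖ * ‖(w : ℂ) + 1‖) ≤ 2 / ‖(w : ℂ)‖ ^ 2 := by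
  have h1 := hRH.norm_le_two_mul_norm_add_one w
  have hw0 := w.norm_pos
  rw [div_le_div_iff₀ (mul_pos hw0 (by linarith)) (by positivity)]
  nlinarith

lemma RiemannHypothesis.summable_norm_cesaroZeroTerm_lineZero (hRH : RiemannHypothesis) {N : ℕ}
    (hN : 1 ≤ N) : Summable fun w : LineZero => ‖cesaroZeroTerm N w‖ := by
  have hN0 : 0 < N := hN
  refine Summable.of_nonneg_of_le (fun _ => norm_nonneg _) (fun w => ?_)
    (summable_lineZero_div_sq.mul_left (2 * (N : ℝ) ^ (3 / 2 : ℝ)))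
  have h1 := hRH.one_div_norm_mul_le w
  have h2 := w.one_le_norm_add_two
  have h3 := zetaOrder_nonneg (w : ℂ)
  rw [cesaroZeroTerm_lineZero, norm_mul, norm_div, norm_mul, norm_mul, Complex.norm_real,
    Real.norm_eq_abs, abs_of_nonneg h3, Complex.norm_natCast_cpow_of_pos hN0, Complex.add_re, w.re_eq,
    Complex.one_re]
  have h4 : (N : ℝ) ^ (1 / 2 + 1 : ℝ) / (‖(w : ℂ)‖ * ‖(w : ℂ) + 1‖ * ‖(w : ℂ) + 2‖)
      ≤ (N : ℝ) ^ (3 / 2 : ℝ) * (2 / ‖(w : ℂ)‖ ^ 2) := by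
    calc _ = (N : ℝ) ^ (3 / 2 : ℝ) * (1 / (‖(w : ℂ)‖ * ‖(w : ℂ) + 1‖)) * (1 / ‖(w : ℂ) + 2‖) := by
          rw [show (1 / 2 + 1 : ℝ) = 3 / 2 by norm_num]
          simp only [div_eq_mul_inv, mul_inv]; ring
      _ ≤ (N : ℝ) ^ (3 / 2 : ℝ) * (2 / ‖(w : ℂ)‖ ^ 2) * 1 := by
          gcongr
          exact (div_le_one (by linarith)).2 h2
      _ = _ := mul_one _
  calc _ ≤ zetaOrder w * ((N : ℝ) ^ (3 / 2 : ℝ) * (2 / ‖(w : ℂ)‖ ^ 2)) := by gcongr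
    _ = _ := by ring

lemma RiemannHypothesis.exists_norm_integral_zeroTerm_sub_le (hRH : RiemannHypothesis) :
    ∃ C : ℝ, 0 ≤ C ∧ ∀ N : ℕ, 1 ≤ N →
      ‖(∫ t in (1 : ℝ)..N, ∑' w : LineZero, zeroTerm w (Real.log t))
        - N * ∑' w : LineZero, cesaroZeroTerm N w‖ ≤ C * N := by
  set S := ∑' w : LineZero, zetaOrder w / ‖(w : ℂ)‖ ^ 2 with hS
  have hS0 : 0 ≤ S := tsum_nonneg fun w => div_nonneg (zetaOrder_nonneg _) (by positivity)
  refine ⟨2 * S, by positivity, fun N hN => ?_⟩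
  have hNR : (1 : ℝ) ≤ N := by exact_mod_cast hN
  have hNC : (N : ℂ) ≠ 0 := by exact_mod_cast (by omega : N ≠ 0)
  have h1 := (hRH.hasSum_integral_zeroTerm_log hNR).2
  have h2 := ((hRH.summable_norm_cesaroZeroTerm_lineZero hN).of_norm.hasSum).mul_left (N : ℂ)
  have h3 := h1.sub h2
  have hterm : ∀ w : LineZero, ‖(∫ t in (1 : ℝ)..N, zeroTerm w (Real.log t))
      - N * cesaroZeroTerm N w‖ ≤ 2 * N * (zetaOrder w / ‖(w : ℂ)‖ ^ 2) := by
    intro w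
    have hw := w.1.ne_zero
    have hw1 := hRH.add_one_ne_zero w
    have hw2 := w.add_two_ne_zero
    -- The powers N^(w+2) cancel. What is left comes from the lower limit of integration and from
    -- the "- 1" in `zeroTerm`, and is O(N/|w|²) after the factor m.
    have he : (∫ t in (1 : ℝ)..N, zeroTerm w (Real.log t)) - N * cesaroZeroTerm N w
        = -(zetaOrder w * ((1 / ((w : ℂ) + 2) + ((N - 1 : ℝ) : ℂ)) / (w * (w + 1)))) := by
      rw [integral_zeroTerm_log w hNR, cesaroZeroTerm_lineZero]
      have : ((N : ℝ) : ℂ) ^ ((w : ℂ) + 2) = N * (N : ℂ) ^ ((w : ℂ) + 1) := by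
        rw [Complex.ofReal_natCast, show (w : ℂ) + 2 = (w + 1) + 1 by ring,
          Complex.cpow_add _ _ hNC, Complex.cpow_one, mul_comm]
      rw [this]
      push_cast
      field_simp
      ring
    have h4 : ‖1 / ((w : ℂ) + 2) + ((N - 1 : ℝ) : ℂ)‖ ≤ N := by
      refine (norm_add_le _ _).trans ?_
      rw [norm_div, norm_one, Complex.norm_real, Real.norm_eq_abs, abs_of_nonneg (by linarith)]
      have h5 := w.one_le_norm_add_two
      have := (div_le_one (by linarith)).2 h5
      linarith
    have h6 := hRH.one_div_norm_mul_le w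
    have h7 := zetaOrder_nonneg (w : ℂ)
    rw [he, norm_neg, norm_mul, norm_div, norm_mul, Complex.norm_real, Real.norm_eq_abs,
      abs_of_nonneg h7]
    calc _ ≤ zetaOrder w * (N / (‖(w : ℂ)‖ * ‖(w : ℂ) + 1‖)) := by gcongr
      _ = zetaOrder w * N * (1 / (‖(w : ℂ)‖ * ‖(w : ℂ) + 1‖)) := by ring
      _ ≤ zetaOrder w * N * (2 / ‖(w : ℂ)‖ ^ 2) := by gcongr
      _ = _ := by ring
  rw [← h3.tsum_eq]
  refine (tsum_of_norm_bounded (summable_lineZero_div_sq.mul_left _).hasSum hterm).trans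
    (le_of_eq ?_)
  rw [tsum_mul_left, ← hS]; ring

/-- The first moment of the explicit formula: `∫₀^N ∫₀^t ψ` up to `O(N²)`. -/
lemma RiemannHypothesis.exists_norm_integral_psiPrimitive_sub_le (hRH : RiemannHypothesis) :
    ∃ C : ℝ, 0 ≤ C ∧ ∀ N : ℕ, 1 ≤ N →
      ‖((∫ t in (0 : ℝ)..N, psiPrimitive t : ℝ) : ℂ)
        - ((N : ℂ) ^ 3 / 6 - N * ∑' w : LineZero, cesaroZeroTerm N w)‖ ≤ C * (N : ℝ) ^ 2 := by
  obtain ⟨C₁, hC₁, h₁⟩ := hRH.exists_norm_psiPrimitive_sub_add_le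
  obtain ⟨C₂, hC₂, h₂⟩ := hRH.exists_norm_integral_zeroTerm_sub_le
  refine ⟨C₁ + C₂ + 1, by positivity, fun N hN => ?_⟩
  have hNR : (1 : ℝ) ≤ N := by exact_mod_cast hN
  obtain ⟨hint, -⟩ := hRH.hasSum_integral_zeroTerm_log hNR
  have hp : ∀ a b, IntervalIntegrable psiPrimitive volume a b := fun a b =>
    continuous_psiPrimitive.intervalIntegrable a b
  -- Nothing is lost by starting at 1, where the explicit formula becomes available.
  have hzero : ∫ t in (0 : ℝ)..1, psiPrimitive t = 0 := by
    have : ∫ t in (0 : ℝ)..1, psiPrimitive t = ∫ t in (0 : ℝ)..1, (0 : ℝ) := by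
      refine intervalIntegral.integral_congr fun t ht => ?_
      rw [Set.uIcc_of_le zero_le_one] at ht
      rw [psiPrimitive_eq_sum (M := 1) ht.1 (by simpa using ht.2)]
      simp
    rw [this]; simp
  have hsq : IntervalIntegrable (fun t : ℝ => (t : ℂ) ^ 2 / 2) volume 1 N :=
    (by fun_prop : Continuous _).intervalIntegrable _ _
  have hpc : IntervalIntegrable (fun t : ℝ => (psiPrimitive t : ℂ)) volume 1 N := by
    have := continuous_psiPrimitive
    exact (by fun_prop : Continuous _).intervalIntegrable _ _
  have hsqv : ∫ t in (1 : ℝ)..N, (t : ℂ) ^ 2 / 2 = ((N : ℂ) ^ 3 - 1) / 6 := by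
    have : ∀ t : ℝ, (t : ℂ) ^ 2 / 2 = ((t ^ 2 / 2 : ℝ) : ℂ) := fun t => by push_cast; ring
    simp_rw [this]
    rw [intervalIntegral.integral_ofReal, intervalIntegral.integral_div, integral_pow]
    push_cast; ring
  set J := ∫ t in (1 : ℝ)..N, ∑' w : LineZero, zeroTerm w (Real.log t) with hJ
  have hR : ∫ t in (1 : ℝ)..N, ((psiPrimitive t : ℂ) - t ^ 2 / 2
      + ∑' w : LineZero, zeroTerm w (Real.log t))
      = ((∫ t in (0 : ℝ)..N, psiPrimitive t : ℝ) : ℂ) - ((N : ℂ) ^ 3 - 1) / 6 + J := by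
    rw [intervalIntegral.integral_add (hpc.sub hsq) hint, intervalIntegral.integral_sub hpc hsq,
      hsqv, intervalIntegral.integral_ofReal,
      ← intervalIntegral.integral_add_adjacent_intervals (hp 0 1) (hp 1 N), hzero, zero_add]
  have hRn : ‖∫ t in (1 : ℝ)..N, ((psiPrimitive t : ℂ) - t ^ 2 / 2
      + ∑' w : LineZero, zeroTerm w (Real.log t))‖ ≤ C₁ * N * (N - 1) := by
    refine (intervalIntegral.norm_integral_le_of_norm_le_const (C := C₁ * N) fun t ht => ?_).trans
      (le_of_eq (by rw [abs_of_nonneg (by linarith)]))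
    rw [Set.uIoc_of_le hNR] at ht
    exact (h₁ t ht.1.le).trans (mul_le_mul_of_nonneg_left ht.2 hC₁)
  rw [hR] at hRn
  have h₃ := h₂ N hN
  rw [← hJ] at h₃
  set I := ((∫ t in (0 : ℝ)..N, psiPrimitive t : ℝ) : ℂ) with hI
  set Z := ∑' w : LineZero, cesaroZeroTerm N w with hZ
  have h6 : ‖(1 / 6 : ℂ)‖ ≤ 1 := by norm_num
  calc _ = ‖(I - ((N : ℂ) ^ 3 - 1) / 6 + J) - (J - N * Z) - 1 / 6‖ := by congr 1; ring
    _ ≤ ‖I - ((N : ℂ) ^ 3 - 1) / 6 + J‖ + ‖J - N * Z‖ + ‖(1 / 6 : ℂ)‖ :=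
        (norm_sub_le _ _).trans (add_le_add_left (norm_sub_le _ _) _)
    _ ≤ C₁ * N * (N - 1) + C₂ * N + 1 := by gcongr
    _ ≤ _ := by nlinarith [mul_nonneg hC₁ (by linarith : (0 : ℝ) ≤ N),
        mul_nonneg (mul_nonneg hC₂ (by linarith : (0 : ℝ) ≤ N)) (by linarith : (0 : ℝ) ≤ N - 1)]

lemma RiemannHypothesis.exists_equiv_lineZero (hRH : RiemannHypothesis) :
    ∃ e : LineZero ≃ nontrivialZetaZeros, ∀ w, ((e w : nontrivialZetaZeros) : ℂ) = w :=
  ⟨{ toFun := fun w => ⟨w, hRH.mem_nontrivialZetaZeros_iff.2 ⟨w.1.2, w.2⟩⟩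
     invFun := fun ρ => ⟨⟨ρ, (hRH.mem_nontrivialZetaZeros_iff.1 ρ.2).1⟩,
      (hRH.mem_nontrivialZetaZeros_iff.1 ρ.2).2⟩
     left_inv := fun _ => rfl
     right_inv := fun _ => rfl }, fun _ => rfl⟩

end ExplicitFormula

/-! ### Assembly of the main theorem. -/

theorem theorem2 (hRH : RiemannHypothesis) :
    ∃ C : ℝ, ∀ N : ℕ, 1 ≤ N →
      Summable (fun ρ : nontrivialZetaZeros => ‖cesaroZeroTerm N (ρ : ℂ)‖) ∧
      ‖((∑ n ∈ Finset.Icc 1 N, (1 - (n : ℝ) / (N : ℝ)) * goldbachR2 n : ℝ) : ℂ)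
          - ((1 / 6 : ℂ) * (N : ℂ) ^ 2
              - 2 * ∑' ρ : nontrivialZetaZeros, cesaroZeroTerm N (ρ : ℂ))‖
        ≤ C * (N : ℝ) := by
  obtain ⟨e, he⟩ := hRH.exists_equiv_lineZero
  obtain ⟨C₁, hC₁, h₁⟩ := hRH.exists_integral_psi_sub_id_sq_le
  obtain ⟨C₂, hC₂, h₂⟩ := hRH.exists_norm_integral_psiPrimitive_sub_le
  refine ⟨C₁ + 2 * C₂, fun N hN => ⟨?_, ?_⟩⟩
  · rw [← e.summable_iff]
    refine (hRH.summable_norm_cesaroZeroTerm_lineZero hN).congr fun w => ?_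
    simp only [Function.comp, he]
  · have hNR : (1 : ℝ) ≤ N := by exact_mod_cast hN
    have hN0 : (N : ℝ) ≠ 0 := by linarith
    have hNC : (N : ℂ) ≠ 0 := by exact_mod_cast hN0
    have hZ : ∑' ρ : nontrivialZetaZeros, cesaroZeroTerm N (ρ : ℂ)
        = ∑' w : LineZero, cesaroZeroTerm N w := by
      rw [← e.tsum_eq]
      simp only [he]
    rw [hZ]
    set Z := ∑' w : LineZero, cesaroZeroTerm N w
    set A := ∑ n ∈ Finset.Icc 1 N, (1 - (n : ℝ) / (N : ℝ)) * goldbachR2 n with hA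
    set I := ∫ t in (0 : ℝ)..N, psiPrimitive t with hI
    set R := ∫ t in (0 : ℝ)..N, (Chebyshev.psi t - t) * (Chebyshev.psi (N - t) - (N - t)) with hR
    have hNA : N * A = 2 * I - (N : ℝ) ^ 3 / 6 + R := by
      rw [← integral_psi_mul_psi_sub_eq (by linarith), integral_psi_mul_psi_sub, hA, Finset.mul_sum]
      refine Finset.sum_congr rfl fun n _ => ?_
      field_simp
    have hRle : |R| ≤ C₁ * (N : ℝ) ^ 2 :=
      (abs_integral_psi_error_mul_le (by linarith)).trans (h₁ N hNR)
    -- The main terms match as 2·N³/6 - N³/6 = N³/6, so N times the error is twice the error for ∫ψ₁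
    -- plus the convolution R, both O(N²).
    have hkey : (N : ℂ) * ((A : ℂ) - ((1 / 6 : ℂ) * (N : ℂ) ^ 2 - 2 * Z))
        = 2 * ((I : ℂ) - ((N : ℂ) ^ 3 / 6 - N * Z)) + R := by
      have : (N : ℂ) * A = 2 * I - (N : ℂ) ^ 3 / 6 + R := by
        have h := congrArg Complex.ofReal hNA
        push_cast at h
        exact h
      rw [mul_sub, this]; ring
    have hnorm : N * ‖(A : ℂ) - ((1 / 6 : ℂ) * (N : ℂ) ^ 2 - 2 * Z)‖
        ≤ N * ((C₁ + 2 * C₂) * (N : ℝ)) := by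
      have h3 : N * ‖(A : ℂ) - ((1 / 6 : ℂ) * (N : ℂ) ^ 2 - 2 * Z)‖
          = ‖(N : ℂ) * ((A : ℂ) - ((1 / 6 : ℂ) * (N : ℂ) ^ 2 - 2 * Z))‖ := by
        rw [norm_mul, Complex.norm_natCast]
      rw [h3, hkey]
      have h4 := h₂ N hN
      calc _ ≤ ‖2 * ((I : ℂ) - ((N : ℂ) ^ 3 / 6 - N * Z))‖ + ‖(R : ℂ)‖ := norm_add_le _ _
        _ ≤ 2 * (C₂ * (N : ℝ) ^ 2) + C₁ * (N : ℝ) ^ 2 := by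
            rw [norm_mul, Complex.norm_real, Real.norm_eq_abs, Complex.norm_ofNat]
            gcongr
        _ = _ := by ring
    exact le_of_mul_le_mul_left hnorm (by linarith)
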